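/- Let $\mathbb F$ be an algebraically closed field of characteristic $0$, $n\ge 1$ and $R=\mathrm{Mat}_n(\mathbb F)$. All grading groups are abelian, written additively. **Definitions.** Let $\varphi$ be an ($\mathbb F$-linear) antiautomorphism of $R$. A grading $\Gamma: R=\bigoplus_{g\in G}R_g$ is a *$\varphi$-grading* if, for all $g\in G$, $\varphi(R_g)=R_g$ and $\varphi^2|_{R_g}=\alpha_g\,\mathrm{id}$ for some $0\neq\alpha_g\in\mathbb F$, with $\alpha_0=1$. It is a *fine* $\varphi$-grading if no $\varphi$-grading is a proper refinement of it. The *diagonal group* $\mathrm{Diag}_\Gamma(R)$ is the group of all automorphisms of $R$ that act as a scalar on each $R_g$. A *graded isomorphism* of graded algebras (possibly over different groups) is an algebra isomorphism mapping each nonzero homogeneous component onto a homogeneous component. A *central graded division algebra* is a finite-dimensional graded algebra $D=\bigoplus_h D_h$ with center $\mathbb F$ all of whose nonzero homogeneous elements are invertible. Consider pairs $(D,(d_1,\dots,d_p))$, $p\ge 0$, where $D$ is a central graded division algebra with $2$-elementary support and the $d_i\in D$ are nonzero and homogeneous. Two pairs $(D,(d_1,\dots,d_p))$ and $(D',(d'_1,\dots,d'_q))$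 are equivalent if $p=q$ and there are a graded isomorphism $\Phi:D\to D'$, a permutation $\pi\in S_p$ and a nonzero homogeneous $z\in D$ with $\Phi(zd_i)\in\mathbb F d'_{\pi(i)}$ for all $i$. Write $[D,(d_1,\dots,d_p)]$ for the equivalence class. Let $\Gamma$ be a fine $\varphi$-grading of $R$. Choose a central graded division algebra $D$ with $2$-elementary support and with a graded involution $\tau$ (one with $D_h^\tau=D_h$ for all $h$), a graded right $D$-module $V$, and a nondegenerate homogeneous $\mathbb F$-bilinear form $B:V\times V\to D$ which is $\tau$-sesquilinear ($B(xd,y)=d^\tau B(x,y)$, $B(x,yd)=B(x,y)d$) and balanced ($B(v,w)=0\iff B(w,v)=0$ for homogeneous $v,w$), such that there is a graded isomorphism from $(R,\Gamma)$ to $\mathrm{End}_D(V)$, with the grading induced by that of $V$, carrying $\varphi$ to the adjoint map $\varphi_B$ given by $B(rv,w)=B(v,\varphi_B(r)w)$; and choose a good basis of $V$, that is, a homogeneous $D$-basis $v_1,\dots,v_{p+2s}$ such that $B(v_i,v_i)^2=1$ for $i\le p$, $B(v_{p+2j-1},v_{p+2j})=\nu_j$ and $B(v_{p+2j},v_{p+2j-1})=\nu_j^{-1}$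 with $0\ne\nu_j\in\mathbb F$ for $j\le s$, and all other values $B(v_k,v_l)$ are $0$. Put $$\mathcal I(R,\varphi,\Gamma)=[D,(B(v_1,v_1),\dots,B(v_p,v_p))].$$ **Theorem.** For every fine $\varphi$-grading $\Gamma$ of $R$, such choices exist and $\mathcal I(R,\varphi,\Gamma)$ does not depend on them. Moreover: 1. Let $\varphi$ be an antiautomorphism of $R$, $\Gamma$ a fine $\varphi$-grading and $\Psi\in\mathrm{Diag}_\Gamma(R)$. Then $\Gamma$ is a fine $\Psi\varphi$-grading too, and $\mathcal I(R,\varphi,\Gamma)=\mathcal I(R,\Psi\varphi,\Gamma)$. 2. Let $\varphi_1,\varphi_2$ be antiautomorphisms of $R$ and let $\Gamma_i$ be a fine $\varphi_i$-grading, $i=1,2$. Then $\mathcal I(R,\varphi_1,\Gamma_1)=\mathcal I(R,\varphi_2,\Gamma_2)$ if and only if there exist a graded isomorphism $\Phi:(R,\Gamma_1)\to(R,\Gamma_2)$ and $\Psi\in\mathrm{Diag}_{\Gamma_2}(R)$ such that $\Phi\varphi_1\Phi^{-1}=\Psi\varphi_2$. -/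

import Mathlib

universe u v

/-- A grading of a unital `F`-algebra `A` by an abelian group `G` (written additively): `A` is the
direct sum of the subspaces `Γ g`, `1 ∈ Γ 0` and `Γ g * Γ h ⊆ Γ (g + h)`. -/
structure IsAbGrading {F A G : Type*} [Field F] [Ring A] [Algebra F A] [AddCommGroup G]
    (Γ : G → Submodule F A) : Prop where
  gradedMonoid : SetLike.GradedMonoid Γ
  indep : iSupIndep Γ
  iSup_eq_top : ⨆ g, Γ g = ⊤

/-- `Γ` is a refinement of `Γ'`: every component of `Γ` is contained in a component of `Γ'`. -/
def Refines {F A G G' : Type*} [Field F] [Ring A] [Algebra F A]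
    (Γ : G → Submodule F A) (Γ' : G' → Submodule F A) : Prop :=
  ∀ g, ∃ g', Γ g ≤ Γ' g'

/-- A graded isomorphism (equivalence of gradings, the grading groups may be different): an algebra
isomorphism mapping every nonzero homogeneous component onto a homogeneous component. -/
def IsGradedIso {F A A' G G' : Type*} [Field F] [Ring A] [Algebra F A] [Ring A'] [Algebra F A']
    (Γ : G → Submodule F A) (Γ' : G' → Submodule F A') (Φ : A ≃ₐ[F] A') : Prop :=
  ∀ g, Γ g ≠ ⊥ → ∃ g', (Γ g).map Φ.toLinearMap = Γ' g'

/-- An antiautomorphism of the `F`-algebra `A`, as an isomorphism onto the opposite algebra. -/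
abbrev AntiAut (F A : Type*) [Field F] [Ring A] [Algebra F A] := A ≃ₐ[F] Aᵐᵒᵖ

/-- The value `φ(x) ∈ A` of an antiautomorphism `φ` of `A`. -/
def AntiAut.app {F A : Type*} [Field F] [Ring A] [Algebra F A] (φ : AntiAut F A) (x : A) : A :=
  (φ x).unop

/-- The antiautomorphism `Ψφ : x ↦ Ψ(φ(x))`. -/
def AntiAut.leftComp {F A : Type*} [Field F] [Ring A] [Algebra F A]
    (Ψ : A ≃ₐ[F] A) (φ : AntiAut F A) : AntiAut F A :=
  AlgEquiv.trans φ (AlgEquiv.op Ψ)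

theorem AntiAut.leftComp_app {F A : Type*} [Field F] [Ring A] [Algebra F A]
    (Ψ : A ≃ₐ[F] A) (φ : AntiAut F A) (x : A) : (leftComp Ψ φ).app x = Ψ (φ.app x) := rfl

/-- The diagonal group of `Γ`: the automorphisms acting as a scalar on every component. -/
def diagGroup {F A G : Type*} [Field F] [Ring A] [Algebra F A] (Γ : G → Submodule F A) :
    Subgroup (A ≃ₐ[F] A) where
  carrier := {Ψ | ∀ g, ∃ c : F, ∀ x ∈ Γ g, Ψ x = c • x}
  one_mem' := fun _ => ⟨1, fun x _ => by simp⟩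
  mul_mem' := by
    intro Ψ Θ hΨ hΘ g
    obtain ⟨c, hc⟩ := hΨ g
    obtain ⟨e, he⟩ := hΘ g
    refine ⟨e * c, fun x hx => ?_⟩
    rw [AlgEquiv.mul_apply, he x hx, map_smul, hc x hx, smul_smul]
  inv_mem' := by
    intro Ψ hΨ g
    obtain ⟨c, hc⟩ := hΨ g
    refine ⟨c⁻¹, fun x hx => ?_⟩
    apply Ψ.injective
    have h1 : Ψ ((Ψ⁻¹ : A ≃ₐ[F] A) x) = x := Ψ.apply_symm_apply x
    rw [h1, map_smul, hc x hx]
    by_cases h0 : c = 0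
    · have h2 : Ψ x = 0 := by rw [hc x hx, h0, zero_smul]
      have h3 : x = 0 := Ψ.injective (by rw [h2, map_zero])
      simp [h3]
    · rw [smul_smul, inv_mul_cancel₀ h0, one_smul]

/-- `Γ` is a `φ`-grading: `φ(A_g) = A_g` for every `g`, and `φ²` acts on `A_g` as a nonzero scalar
`α_g`, with `α_0 = 1`. -/
structure IsPhiGrading {F A G : Type*} [Field F] [Ring A] [Algebra F A] [AddCommGroup G]
    (φ : AntiAut F A) (Γ : G → Submodule F A) : Prop where
  isAbGrading : IsAbGrading Γ
  image_eq : ∀ g, φ.app '' (Γ g : Set A) = Γ g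
  sq_scalar : ∀ g, ∃ α : F, α ≠ 0 ∧ ∀ x ∈ Γ g, φ.app (φ.app x) = α • x
  sq_zero : ∀ x ∈ Γ 0, φ.app (φ.app x) = x

/-- A fine `φ`-grading: a `φ`-grading which has no proper refinement among `φ`-gradings. -/
structure IsFinePhiGrading {F A : Type u} {G : Type v} [Field F] [Ring A] [Algebra F A]
    [AddCommGroup G] (φ : AntiAut F A) (Γ : G → Submodule F A) : Prop where
  isPhiGrading : IsPhiGrading φ Γ
  fine : ∀ (K : Type v) [AddCommGroup K] (Γ' : K → Submodule F A),
    IsPhiGrading φ Γ' → Refines Γ' Γ → Refines Γ Γ'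

/-- Finite-dimensional central graded division algebras over `F`: every nonzero homogeneous element
is invertible and the center is `F`. -/
structure IsCentralGradedDivision {F D K : Type*} [Field F] [Ring D] [Algebra F D]
    [AddCommGroup K] (𝒟 : K → Submodule F D) : Prop where
  isAbGrading : IsAbGrading 𝒟
  nontrivial : Nontrivial D
  finiteDimensional : FiniteDimensional F D
  isCentral : Algebra.IsCentral F D
  isUnit : ∀ k, ∀ x ∈ 𝒟 k, x ≠ 0 → IsUnit x

theorem IsCentralGradedDivision.exists_inv {F D K : Type*} [Field F] [Ring D] [Algebra F D]
    [AddCommGroup K] {𝒟 : K → Submodule F D} (h : IsCentralGradedDivision 𝒟) {k : K} {z : D}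
    (hz : z ∈ 𝒟 k) (hz0 : z ≠ 0) : ∃ w ∈ 𝒟 (-k), z * w = 1 ∧ w * z = 1 := by
  classical
  obtain ⟨t, rfl⟩ := h.isUnit k z hz hz0
  refine ⟨(t⁻¹ : Dˣ), ?_, by simp, by simp⟩
  have := h.isAbGrading.gradedMonoid
  have hint : DirectSum.IsInternal 𝒟 :=
    (DirectSum.isInternal_submodule_iff_iSupIndep_and_iSup_eq_top 𝒟).2
      ⟨h.isAbGrading.indep, h.isAbGrading.iSup_eq_top⟩
  let _ : DirectSum.Decomposition 𝒟 := hint.chooseDecomposition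
  let _ : GradedRing 𝒟 := {}
  have h1 := DirectSum.coe_decompose_mul_add_of_left_mem 𝒟 (i := k) (j := -k)
    (b := ((t⁻¹ : Dˣ) : D)) hz
  rw [Units.mul_inv, add_neg_cancel,
    DirectSum.decompose_of_mem_same 𝒟 (SetLike.GradedOne.one_mem (A := 𝒟))] at h1
  have h2 : ((t⁻¹ : Dˣ) : D) = (DirectSum.decompose 𝒟 ((t⁻¹ : Dˣ) : D) (-k) : D) := by
    calc ((t⁻¹ : Dˣ) : D) = (t⁻¹ : Dˣ) * 1 := (mul_one _).symm
      _ = _ := by rw [h1, ← mul_assoc, Units.inv_mul, one_mul]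
  rw [h2]
  exact SetLike.coe_mem _

/-- Pairs `(D, (d_1, …, d_p))`: `D` is a central graded division algebra whose support is
2-elementary and the `d_i` are nonzero homogeneous elements of `D`. -/
structure DivPair (F : Type u) [Field F] where
  D : Type u
  K : Type v
  [ringD : Ring D]
  [algebraD : Algebra F D]
  [groupK : AddCommGroup K]
  grade : K → Submodule F D
  isDivision : IsCentralGradedDivision grade
  two_elementary : ∀ k, grade k ≠ ⊥ → k + k = 0
  p : ℕ
  d : Fin p → D
  d_ne_zero : ∀ i, d i ≠ 0
  d_homogeneous : ∀ i, ∃ k, d i ∈ grade k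

attribute [instance] DivPair.ringD DivPair.algebraD DivPair.groupK

/-- Equivalence of pairs: there are a graded isomorphism `Φ : D → D'`, a bijection `π` of the
indices and a nonzero homogeneous `z ∈ D` with `Φ(z d_i) ∈ F d'_{π(i)}` for all `i`. -/
def DivPair.Equivalent {F : Type u} [Field F] (P Q : DivPair.{u, v} F) : Prop :=
  ∃ (Φ : P.D ≃ₐ[F] Q.D) (π : Fin P.p ≃ Fin Q.p) (z : P.D),
    IsGradedIso P.grade Q.grade Φ ∧ z ≠ 0 ∧ (∃ k, z ∈ P.grade k) ∧
    ∀ i, ∃ c : F, Φ (z * P.d i) = c • Q.d (π i)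

theorem IsGradedIso.symm_of {F A A' G G' : Type*} [Field F] [Ring A] [Algebra F A] [Ring A']
    [Algebra F A'] [AddCommGroup G] [AddCommGroup G'] {Γ : G → Submodule F A}
    {Γ' : G' → Submodule F A'} {Φ : A ≃ₐ[F] A'} (hΓ : IsAbGrading Γ) (hΓ' : IsAbGrading Γ')
    (h : IsGradedIso Γ Γ' Φ) : IsGradedIso Γ' Γ Φ.symm := by
  intro g' hg'
  by_contra hcon
  push Not at hcon
  apply hg'
  have hmap : ∀ g, (Γ g).map Φ.toLinearMap ≤ ⨆ j, ⨆ (_ : j ≠ g'), Γ' j := by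
    intro g
    by_cases hg : Γ g = ⊥
    · rw [hg, Submodule.map_bot]
      exact bot_le
    · obtain ⟨j, hj⟩ := h g hg
      have hne : j ≠ g' := by
        rintro rfl
        apply hcon g
        rw [← hj, ← Submodule.map_comp]
        have : Φ.symm.toLinearMap ∘ₗ Φ.toLinearMap = LinearMap.id := by
          ext x
          simp
        rw [this, Submodule.map_id]
      rw [hj]
      exact le_iSup₂_of_le j hne le_rfl
  have htop : (⊤ : Submodule F A') ≤ ⨆ j, ⨆ (_ : j ≠ g'), Γ' j := by
    have h1 : (⊤ : Submodule F A).map Φ.toLinearMap = ⊤ := by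
      rw [Submodule.map_top, LinearMap.range_eq_top]
      exact Φ.surjective
    rw [← h1, ← hΓ.iSup_eq_top, Submodule.map_iSup]
    exact iSup_le hmap
  have hd := hΓ'.indep g'
  rw [disjoint_iff] at hd
  rw [← hd]
  exact (inf_eq_left.2 (le_top.trans htop)).symm

theorem IsGradedIso.map_homogeneous {F A A' G G' : Type*} [Field F] [Ring A] [Algebra F A]
    [Ring A'] [Algebra F A'] {Γ : G → Submodule F A} {Γ' : G' → Submodule F A'}
    {Φ : A ≃ₐ[F] A'} (h : IsGradedIso Γ Γ' Φ) {x : A} (hx0 : x ≠ 0) (hx : ∃ g, x ∈ Γ g) :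
    ∃ g', Φ x ∈ Γ' g' := by
  obtain ⟨g, hg⟩ := hx
  obtain ⟨g', hg'⟩ := h g (fun hb => hx0 (by rw [hb] at hg; simpa using hg))
  exact ⟨g', hg' ▸ Submodule.mem_map_of_mem (f := Φ.toLinearMap) hg⟩

theorem IsGradedIso.comp {F A A' A'' G G' G'' : Type*} [Field F] [Ring A] [Algebra F A]
    [Ring A'] [Algebra F A'] [Ring A''] [Algebra F A''] {Γ : G → Submodule F A}
    {Γ' : G' → Submodule F A'} {Γ'' : G'' → Submodule F A''}
    {Φ : A ≃ₐ[F] A'} {Θ : A' ≃ₐ[F] A''} (h : IsGradedIso Γ Γ' Φ) (h' : IsGradedIso Γ' Γ'' Θ) :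
    IsGradedIso Γ Γ'' (Φ.trans Θ) := by
  intro g hg
  obtain ⟨g', hg'⟩ := h g hg
  have hne : Γ' g' ≠ ⊥ := by
    intro hb
    rw [hb] at hg'
    apply hg
    rw [Submodule.eq_bot_iff]
    intro x hx
    have : Φ x ∈ (Γ g).map Φ.toLinearMap := Submodule.mem_map_of_mem (f := Φ.toLinearMap) hx
    rw [hg'] at this
    exact Φ.injective (by simpa using this)
  obtain ⟨g'', hg''⟩ := h' g' hne
  refine ⟨g'', ?_⟩
  rw [← hg'', ← hg', ← Submodule.map_comp]
  rfl

theorem DivPair.equivalent_refl {F : Type u} [Field F] (P : DivPair.{u, v} F) :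
    P.Equivalent P := by
  have := P.isDivision.nontrivial
  have := P.isDivision.isAbGrading.gradedMonoid
  refine ⟨AlgEquiv.refl, Equiv.refl _, 1, ?_, one_ne_zero,
    ⟨0, SetLike.GradedOne.one_mem (A := P.grade)⟩, fun i => ⟨1, by simp⟩⟩
  exact fun g _ => ⟨g, Submodule.map_id _⟩

theorem DivPair.equivalent_symm {F : Type u} [Field F] {P Q : DivPair.{u, v} F}
    (h : P.Equivalent Q) : Q.Equivalent P := by
  obtain ⟨Φ, π, z, hΦ, hz0, ⟨k, hk⟩, hc⟩ := h
  obtain ⟨w, hw, hzw, hwz⟩ := P.isDivision.exists_inv hk hz0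
  have := P.isDivision.nontrivial
  have hw0 : w ≠ 0 := by
    rintro rfl
    simp at hzw
  refine ⟨Φ.symm, π.symm, Φ w, hΦ.symm_of P.isDivision.isAbGrading Q.isDivision.isAbGrading,
    by simpa using hw0, hΦ.map_homogeneous hw0 ⟨_, hw⟩, fun j => ?_⟩
  obtain ⟨c, hc⟩ := hc (π.symm j)
  rw [Equiv.apply_symm_apply] at hc
  have hc0 : c ≠ 0 := by
    rintro rfl
    rw [zero_smul, map_eq_zero_iff _ Φ.injective] at hc
    apply P.d_ne_zero (π.symm j)
    rw [← one_mul (P.d (π.symm j)), ← hwz, mul_assoc, hc, mul_zero]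
  have hd : Q.d j = c⁻¹ • Φ (z * P.d (π.symm j)) := by
    rw [hc, smul_smul, inv_mul_cancel₀ hc0, one_smul]
  refine ⟨c⁻¹, ?_⟩
  rw [hd, mul_smul_comm, ← map_mul, ← mul_assoc, hwz, one_mul, map_smul,
    AlgEquiv.symm_apply_apply]

theorem DivPair.equivalent_trans {F : Type u} [Field F] {P Q S : DivPair.{u, v} F}
    (h : P.Equivalent Q) (h' : Q.Equivalent S) : P.Equivalent S := by
  obtain ⟨Φ, π, z, hΦ, hz0, ⟨k, hk⟩, hc⟩ := h
  obtain ⟨Θ, ρ, y, hΘ, hy0, hy, hc'⟩ := h'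
  have hΦs := hΦ.symm_of P.isDivision.isAbGrading Q.isDivision.isAbGrading
  obtain ⟨j, hj⟩ := hΦs.map_homogeneous hy0 hy
  have hy0' : Φ.symm y ≠ 0 := by simpa using hy0
  have := P.isDivision.isAbGrading.gradedMonoid
  refine ⟨Φ.trans Θ, π.trans ρ, Φ.symm y * z, hΦ.comp hΘ, ?_,
    ⟨j + k, SetLike.GradedMul.mul_mem hj hk⟩, fun i => ?_⟩
  · rw [Ne, (P.isDivision.isUnit j _ hj hy0').mul_right_eq_zero]
    exact hz0
  · obtain ⟨c, hc⟩ := hc i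
    obtain ⟨e, he⟩ := hc' (π i)
    refine ⟨c * e, ?_⟩
    rw [AlgEquiv.trans_apply, mul_assoc, map_mul, AlgEquiv.apply_symm_apply, hc,
      mul_smul_comm, map_smul, he, smul_smul, Equiv.trans_apply]

instance DivPair.setoid (F : Type u) [Field F] : Setoid (DivPair.{u, v} F) where
  r := DivPair.Equivalent
  iseqv := ⟨equivalent_refl, equivalent_symm, equivalent_trans⟩

/-- The equivalence classes `[D, (d_1, …, d_p)]`. -/
def DivPairClass (F : Type u) [Field F] : Type (max (u + 1) (v + 1)) :=
  Quotient (DivPair.setoid.{u, v} F)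

/-- The pair `(F, ())`, with `F` trivially graded. -/
def DivPair.trivialPair (F : Type u) [Field F] : DivPair.{u, v} F where
  D := F
  K := PUnit
  grade := fun _ => ⊤
  isDivision :=
    { isAbGrading :=
        { gradedMonoid := { one_mem := trivial, mul_mem := fun _ _ _ _ _ _ => trivial }
          indep := fun i => by
            have : (⨆ j, ⨆ (_ : j ≠ i), (⊤ : Submodule F F)) = ⊥ := by simp
            rw [this]
            exact disjoint_bot_right
          iSup_eq_top := by simp }
      nontrivial := inferInstance
      finiteDimensional := inferInstance
      isCentral := inferInstance
      isUnit := fun _ _ _ hx => isUnit_iff_ne_zero.2 hx }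
  two_elementary := fun _ _ => rfl
  p := 0
  d := Fin.elim0
  d_ne_zero := fun i => i.elim0
  d_homogeneous := fun i => i.elim0

instance (F : Type u) [Field F] : Nonempty (DivPairClass.{u, v} F) :=
  ⟨Quotient.mk _ (DivPair.trivialPair F)⟩

/-- The component of degree `k` of `End_D(V)` in the grading induced by the grading `𝒱` of the
right `D`-module `V`: the endomorphisms `f` with `f(V_j) ⊆ V_{k+j}` for all `j`. -/
def inducedGrading {F D V K : Type*} [Field F] [Ring D] [Algebra F D] [AddCommGroup V]
    [Module F V] [Module Dᵐᵒᵖ V] [IsScalarTower F Dᵐᵒᵖ V] [AddCommGroup K]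
    (𝒱 : K → Submodule F V) (k : K) : Submodule F (Module.End Dᵐᵒᵖ V) where
  carrier := {f | ∀ j, ∀ x ∈ 𝒱 j, f x ∈ 𝒱 (k + j)}
  zero_mem' := fun _ _ _ => Submodule.zero_mem _
  add_mem' := fun hf hg j x hx => Submodule.add_mem _ (hf j x hx) (hg j x hx)
  smul_mem' := fun c _ hf j x hx => Submodule.smul_mem _ c (hf j x hx)

/-- The Gram matrix
`diag(d_1, …, d_p, (0, ν_1; ν_1⁻¹, 0), …, (0, ν_s; ν_s⁻¹, 0))` of a good basis, where `inl i` is the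
index of `v_i`, and `inr (inl j)`, `inr (inr j)` are the indices of `v_{p+2j-1}`, `v_{p+2j}`. -/
def goodGram {F D : Type*} [Field F] [Ring D] [Algebra F D] {p s : ℕ} (d : Fin p → D)
    (ν : Fin s → F) : Fin p ⊕ (Fin s ⊕ Fin s) → Fin p ⊕ (Fin s ⊕ Fin s) → D
  | .inl i, .inl j => if i = j then d i else 0
  | .inr (.inl i), .inr (.inr j) => if i = j then algebraMap F D (ν i) else 0
  | .inr (.inr i), .inr (.inl j) => if i = j then algebraMap F D (ν i)⁻¹ else 0
  | _, _ => 0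

/-- A realization of the algebra `A` with antiautomorphism `φ` and `φ`-grading `Γ` as `End_D(V)`,
with the grading induced from a graded right `D`-module `V` and the antiautomorphism given by the
adjoint with respect to a nondegenerate balanced homogeneous `τ`-sesquilinear form `B` on `V`,
together with a good basis of `V` such that `P = (D, (B(v_1,v_1), …, B(v_p,v_p)))`. -/
structure Realization {F A : Type u} {G : Type v} [Field F] [Ring A] [Algebra F A]
    [AddCommGroup G] (φ : AntiAut F A) (Γ : G → Submodule F A) (P : DivPair.{u, v} F) where
  /-- a graded involution of `D` -/
  τ : AntiAut F P.D
  τ_involutive : ∀ x, τ.app (τ.app x) = x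
  τ_graded : ∀ k, ∀ x ∈ P.grade k, τ.app x ∈ P.grade k
  /-- a graded right `D`-module -/
  V : Type u
  [addCommGroupV : AddCommGroup V]
  [moduleV : Module F V]
  [rightModuleV : Module P.Dᵐᵒᵖ V]
  [isScalarTowerV : IsScalarTower F P.Dᵐᵒᵖ V]
  gradeV : P.K → Submodule F V
  gradeV_indep : iSupIndep gradeV
  gradeV_iSup_eq_top : ⨆ k, gradeV k = ⊤
  gradeV_smul_mem : ∀ j k, ∀ x ∈ gradeV j, ∀ d ∈ P.grade k, MulOpposite.op d • x ∈ gradeV (j + k)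
  /-- a nondegenerate balanced homogeneous `τ`-sesquilinear form -/
  B : V →ₗ[F] V →ₗ[F] P.D
  degB : P.K
  B_homogeneous : ∀ j k, ∀ x ∈ gradeV j, ∀ y ∈ gradeV k, B x y ∈ P.grade (j + k + degB)
  B_smul_left : ∀ x y (d : P.D), B (MulOpposite.op d • x) y = τ.app d * B x y
  B_smul_right : ∀ x y (d : P.D), B x (MulOpposite.op d • y) = B x y * d
  B_left_nondegenerate : ∀ x, (∀ y, B x y = 0) → x = 0
  B_right_nondegenerate : ∀ y, (∀ x, B x y = 0) → y = 0
  B_balanced : ∀ j k, ∀ x ∈ gradeV j, ∀ y ∈ gradeV k, B x y = 0 ↔ B y x = 0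
  /-- an equivalence from `(A, φ, Γ)` to `End_D(V)` with the adjoint and the induced grading -/
  iso : A ≃ₐ[F] Module.End P.Dᵐᵒᵖ V
  iso_graded : IsGradedIso Γ (inducedGrading (D := P.D) gradeV) iso
  iso_adjoint : ∀ (r : A) (x y : V), B (iso r x) y = B x (iso (φ.app r) y)
  /-- a good basis -/
  s : ℕ
  basis : Module.Basis (Fin P.p ⊕ (Fin s ⊕ Fin s)) P.Dᵐᵒᵖ V
  basis_homogeneous : ∀ a, ∃ k, basis a ∈ gradeV k
  d_sq : ∀ i, P.d i * P.d i = 1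
  ν : Fin s → F
  ν_ne_zero : ∀ j, ν j ≠ 0
  gram : ∀ a b, B (basis a) (basis b) = goodGram P.d ν a b

attribute [instance] Realization.addCommGroupV Realization.moduleV Realization.rightModuleV
  Realization.isScalarTowerV

/-- The class `c` is obtained from some realization of `(A, φ, Γ)`. -/
def IsInvariantClass {F A : Type u} {G : Type v} [Field F] [Ring A] [Algebra F A]
    [AddCommGroup G] (φ : AntiAut F A) (Γ : G → Submodule F A) (c : DivPairClass.{u, v} F) : Prop :=
  ∃ P : DivPair.{u, v} F, Nonempty (Realization φ Γ P) ∧ c = Quotient.mk _ P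

/-- The invariant `ℐ(A, φ, Γ) = [D, (B(v_1,v_1), …, B(v_p,v_p))]`, computed from a chosen
realization (an arbitrary class if there is no realization). -/
noncomputable def calI {F A : Type u} {G : Type v} [Field F] [Ring A] [Algebra F A]
    [AddCommGroup G] (φ : AntiAut F A) (Γ : G → Submodule F A) : DivPairClass.{u, v} F :=
  Classical.epsilon (IsInvariantClass φ Γ)

/-! Existence of a realization needs only that `R` is simple and that `Γ` is a `φ`-grading. An
idempotent `e` of degree `0` generating a minimal graded left ideal gives the graded division
algebra `D = eRe`, and `R` becomes `End_D(Re)` by left multiplication. Simplicity provides mutually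
inverse homogeneous elements `w ∈ eRφ(e)` and `w' ∈ φ(e)Re`; the form `B(x, y) = w φ(x) y` has
adjoint `φ` and is sesquilinear for `τ(d) = w φ(d) w'`. It is balanced because `φ²` is a scalar on
each component, and over an algebraically closed field a maximal partial good basis spans
(`exists_isGoodSystem_span_eq_top`).

A good basis turns `R` into matrices over `D`, with `φ` the adjoint for a Gram matrix having one
nonzero entry `γ a` in row `a`, in column `star a` (`MonomialModel`). Such a presentation carries a
`φ`-grading of its own, `refined`: the basis vectors receive extra weights, independent except that
those of `a` and `star a` cancel. Indeed `φ²` multiplies the `(a, b)` entry by `s a / s b` with `s a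
* s (star a) = 1`, a number determined by the difference of weights. A fine `Γ` therefore has the
same nonzero components as `refined`; in particular its identity component consists of diagonal
matrices with scalar entries.

Hence a graded isomorphism permutes the diagonal idempotents and induces an isomorphism `ψ : D → D'`
of corners. If it carries `φ₁` to `φ₂` up to a diagonal automorphism, the permutation commutes with
`star`, so fixed indices correspond and `p` is preserved. Comparing the images of the matrix units
in one column shows that the entries `γ a` at fixed indices agree up to scalars and one common
homogeneous factor `z` (`exists_coordinate_equiv`). This is one half of part 2; with the identity as
graded isomorphism it also gives independence of choices and part 1.

Conversely, let the pairs be equivalent through `ψ`, `π` and `z`. A dimension count equates the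
numbers of hyperbolic pairs, and after multiplying one vector of each such pair by `ψ z` all Gram
entries correspond up to scalars. Applying `ψ` to all entries is the required `Φ`. The two
antiautomorphisms then differ by a diagonal automorphism of `D'` applied to the entries and a
conjugation by a diagonal scalar matrix; a normalization by fourth roots makes this composite an
element of the diagonal group. Fineness of both gradings forces `Φ` to be graded
(`exists_gradedIso`). -/

/-! ### Linear algebra of graded vector spaces. -/

section GradedLinearAlgebra

variable {F M κ : Type*} [Field F] [AddCommGroup M] [Module F M]

/-- An element of `𝒜 k` that is also a sum of elements of the other components is killed by every `π
x`. The maps `π x` will be matrix entries, inclusions, and evaluations at homogeneous vectors. -/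
theorem iSupIndep.of_jointly_injective {ι : Type*} {N : ι → Type*} [∀ x, AddCommGroup (N x)]
    [∀ x, Module F (N x)] (π : ∀ x, M →ₗ[F] N x) (hπ : ∀ m, (∀ x, π x m = 0) → m = 0)
    {𝒩 : ∀ x, κ → Submodule F (N x)} (h𝒩 : ∀ x, iSupIndep (𝒩 x)) {𝒜 : κ → Submodule F M}
    (h : ∀ x k, ∀ m ∈ 𝒜 k, π x m ∈ 𝒩 x k) : iSupIndep 𝒜 := by
  rw [iSupIndep_def]
  intro k
  rw [Submodule.disjoint_def]
  intro m hm hm'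
  refine hπ m fun x => ?_
  have hle : (⨆ j, ⨆ (_ : j ≠ k), 𝒜 j) ≤ (⨆ j, ⨆ (_ : j ≠ k), 𝒩 x j).comap (π x) :=
    iSup₂_le fun j hj y hy =>
      Submodule.mem_iSup_of_mem j (Submodule.mem_iSup_of_mem hj (h x j y hy))
  exact Submodule.disjoint_def.1 (iSupIndep_def.1 (h𝒩 x) k) _ (h x k m hm) (hle hm')

/-- Decompose `x ∈ ℬ k` along `𝒜`: the part outside degree `k` lies both in `ℬ k` and in the sum of
the other `ℬ j`, so it vanishes. This identifies two gradings from a single family of inclusions. -/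
theorem iSupIndep.eq_of_le {𝒜 ℬ : κ → Submodule F M} (hℬ : iSupIndep ℬ) (hle : ∀ k, 𝒜 k ≤ ℬ k)
    (htop : ⨆ k, 𝒜 k = ⊤) (k : κ) : 𝒜 k = ℬ k := by
  refine le_antisymm (hle k) fun x hx => ?_
  have hx' : x ∈ 𝒜 k ⊔ ⨆ j, ⨆ (_ : j ≠ k), 𝒜 j := by
    have : (⊤ : Submodule F M) ≤ 𝒜 k ⊔ ⨆ j, ⨆ (_ : j ≠ k), 𝒜 j := by
      rw [← htop]
      refine iSup_le fun j => ?_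
      by_cases hj : j = k
      · exact hj ▸ le_sup_left
      · exact (le_iSup₂_of_le (f := fun j (_ : j ≠ k) => 𝒜 j) j hj le_rfl).trans le_sup_right
    exact this trivial
  obtain ⟨y, hy, z, hz, rfl⟩ := Submodule.mem_sup.1 hx'
  have hz' : z ∈ ⨆ j, ⨆ (_ : j ≠ k), ℬ j := (iSup₂_mono fun j _ => hle j) hz
  have hzk : z ∈ ℬ k := by
    have := Submodule.sub_mem _ hx (hle k hy)
    rwa [add_sub_cancel_left] at this
  rw [Submodule.disjoint_def.1 (iSupIndep_def.1 hℬ k) z hzk hz', add_zero]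
  exact hy

theorem iSupIndep.eq_of_mem {𝒜 : κ → Submodule F M} (h𝒜 : iSupIndep 𝒜) {j k : κ} {x : M}
    (hj : x ∈ 𝒜 j) (hk : x ∈ 𝒜 k) (hx : x ≠ 0) : j = k := by
  by_contra hjk
  exact hx (Submodule.disjoint_def.1 (h𝒜.pairwiseDisjoint hjk) x hj hk)

theorem LinearMap.eq_zero_of_iSup_eq_top {N : Type*} [AddCommGroup N] [Module F N]
    {𝒜 : κ → Submodule F M} (htop : ⨆ k, 𝒜 k = ⊤) (f : M →ₗ[F] N)
    (h : ∀ k, ∀ x ∈ 𝒜 k, f x = 0) (x : M) : f x = 0 := by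
  have : (⊤ : Submodule F M) ≤ LinearMap.ker f := by
    rw [← htop]
    exact iSup_le fun k y hy => h k y hy
  exact this (x := x) trivial

theorem exists_homogeneous_ne_zero {N : Type*} [AddCommGroup N] [Module F N]
    {𝒜 : κ → Submodule F M} (htop : ⨆ k, 𝒜 k = ⊤) (f : M →ₗ[F] N) {x : M} (hx : f x ≠ 0) :
    ∃ k, ∃ y ∈ 𝒜 k, f y ≠ 0 := by
  by_contra! h
  exact hx (f.eq_zero_of_iSup_eq_top htop h x)

end GradedLinearAlgebra

section AbGrading

variable {F A G : Type*} [Field F] [Ring A] [Algebra F A] [AddCommGroup G]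
  {Γ : G → Submodule F A}

theorem IsAbGrading.one_mem (h : IsAbGrading Γ) : (1 : A) ∈ Γ 0 :=
  h.gradedMonoid.one_mem

theorem IsAbGrading.mul_mem (h : IsAbGrading Γ) {g k : G} {x y : A} (hx : x ∈ Γ g) (hy : y ∈ Γ k) :
    x * y ∈ Γ (g + k) :=
  h.gradedMonoid.mul_mem hx hy

theorem IsAbGrading.mul_mem_of_eq (h : IsAbGrading Γ) {g k l : G} {x y : A} (hx : x ∈ Γ g)
    (hy : y ∈ Γ k) (hl : g + k = l) : x * y ∈ Γ l :=
  hl ▸ h.mul_mem hx hy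

/-- Only the component of `r` of degree `m - l` contributes to the part of `r * s` in degree `m`, so
`t` is that component. -/
theorem IsAbGrading.exists_homogeneous_mul_eq (h : IsAbGrading Γ) {l m : G} {r s : A}
    (hs : s ∈ Γ l) (hrs : r * s ∈ Γ m) : ∃ t ∈ Γ (m - l), t * s = r * s := by
  classical
  have := h.gradedMonoid
  have hint : DirectSum.IsInternal Γ :=
    (DirectSum.isInternal_submodule_iff_iSupIndep_and_iSup_eq_top Γ).2 ⟨h.indep, h.iSup_eq_top⟩
  let _ : DirectSum.Decomposition Γ := hint.chooseDecomposition
  let _ : GradedRing Γ := {}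
  have h1 := DirectSum.coe_decompose_mul_add_of_right_mem Γ (i := m - l) (j := l) (a := r) hs
  rw [sub_add_cancel, DirectSum.decompose_of_mem_same Γ hrs] at h1
  exact ⟨_, SetLike.coe_mem _, h1.symm⟩

end AbGrading

section AntiAut

variable {F A : Type*} [Field F] [Ring A] [Algebra F A] (φ : AntiAut F A)

@[simp] theorem AntiAut.app_mul (x y : A) : φ.app (x * y) = φ.app y * φ.app x := by
  simp [AntiAut.app]

@[simp] theorem AntiAut.app_one : φ.app (1 : A) = 1 := by
  simp [AntiAut.app]

@[simp] theorem AntiAut.app_zero : φ.app (0 : A) = 0 := by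
  simp [AntiAut.app]

@[simp] theorem AntiAut.app_smul (c : F) (x : A) : φ.app (c • x) = c • φ.app x := by
  simp [AntiAut.app]

@[simp] theorem AntiAut.app_add (x y : A) : φ.app (x + y) = φ.app x + φ.app y := by
  simp [AntiAut.app]

@[simp] theorem AntiAut.app_eq_zero {x : A} : φ.app x = 0 ↔ x = 0 := by
  simp [AntiAut.app]

theorem AntiAut.app_injective : Function.Injective φ.app := fun _ _ h =>
  φ.injective (MulOpposite.unop_injective h)

theorem AntiAut.app_surjective : Function.Surjective φ.app := fun x =>
  ⟨φ.symm (MulOpposite.op x), by simp [AntiAut.app]⟩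

/-- An antiautomorphism as a linear map. -/
def AntiAut.linearMap : A →ₗ[F] A where
  toFun := φ.app
  map_add' := φ.app_add
  map_smul' := φ.app_smul

@[simp] theorem AntiAut.linearMap_apply (x : A) : φ.linearMap x = φ.app x := rfl

end AntiAut

/-! ### Graded division algebras over an algebraically closed field. -/

namespace IsCentralGradedDivision

variable {F D K : Type*} [Field F] [Ring D] [Algebra F D] [AddCommGroup K]
  {𝒟 : K → Submodule F D}

theorem mul_ne_zero (h : IsCentralGradedDivision 𝒟) {k : K} {x y : D} (hx : x ∈ 𝒟 k)
    (hx0 : x ≠ 0) (hy0 : y ≠ 0) : x * y ≠ 0 := by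
  rw [Ne, (h.isUnit k x hx hx0).mul_right_eq_zero]
  exact hy0

variable [IsAlgClosed F]

/-- For `c` in the spectrum of `x`, the element `c - x` is homogeneous of degree `0` and not
invertible, hence zero. Consequently all nonzero components are one-dimensional, homogeneous
elements commute up to scalars, and graded antiautomorphisms act on components by scalars. -/
theorem exists_eq_smul_one (h : IsCentralGradedDivision 𝒟) {x : D} (hx : x ∈ 𝒟 0) :
    ∃ c : F, x = c • 1 := by
  have := h.nontrivial
  have := h.finiteDimensional
  obtain ⟨c, hc⟩ := spectrum.nonempty_of_isAlgClosed_of_finiteDimensional F x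
  refine ⟨c, ?_⟩
  by_contra hne
  refine hc ?_
  rw [spectrum.mem_resolventSet_iff, Algebra.algebraMap_eq_smul_one]
  refine h.isUnit 0 _ (Submodule.sub_mem _ (Submodule.smul_mem _ _ h.isAbGrading.one_mem) hx) ?_
  exact sub_ne_zero.2 (Ne.symm hne)

theorem exists_smul_eq (h : IsCentralGradedDivision 𝒟) {k : K} {x y : D} (hx : x ∈ 𝒟 k)
    (hy : y ∈ 𝒟 k) (hx0 : x ≠ 0) : ∃ c : F, y = c • x := by
  obtain ⟨w, hw, -, hwx⟩ := h.exists_inv hx hx0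
  have h0 : y * w ∈ 𝒟 0 := h.isAbGrading.mul_mem_of_eq hy hw (by abel)
  obtain ⟨c, hc⟩ := h.exists_eq_smul_one h0
  exact ⟨c, by rw [← mul_one y, ← hwx, ← mul_assoc, hc, smul_one_mul]⟩

theorem exists_mul_comm (h : IsCentralGradedDivision 𝒟) {k l : K} {x y : D} (hx : x ∈ 𝒟 k)
    (hy : y ∈ 𝒟 l) : ∃ c : F, x * y = c • (y * x) := by
  by_cases hx0 : x = 0
  · exact ⟨0, by simp [hx0]⟩
  by_cases hy0 : y = 0
  · exact ⟨0, by simp [hy0]⟩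
  exact h.exists_smul_eq (h.isAbGrading.mul_mem hy hx)
    (h.isAbGrading.mul_mem_of_eq hx hy (add_comm k l)) (h.mul_ne_zero hy hy0 hx0)

theorem exists_mul_self (h : IsCentralGradedDivision 𝒟) (h2 : ∀ k, 𝒟 k ≠ ⊥ → k + k = 0) {k : K}
    {x : D} (hx : x ∈ 𝒟 k) : ∃ c : F, x * x = c • 1 := by
  by_cases hx0 : x = 0
  · exact ⟨0, by simp [hx0]⟩
  refine h.exists_eq_smul_one (h.isAbGrading.mul_mem_of_eq hx hx (h2 k ?_))
  rintro hb
  rw [hb] at hx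
  exact hx0 (by simpa using hx)

theorem exists_antiAut_app (h : IsCentralGradedDivision 𝒟) {τ : AntiAut F D}
    (hτ : ∀ k, ∀ x ∈ 𝒟 k, τ.app x ∈ 𝒟 k) {k : K} {x : D} (hx : x ∈ 𝒟 k) :
    ∃ c : F, c ≠ 0 ∧ τ.app x = c • x := by
  by_cases hx0 : x = 0
  · exact ⟨1, one_ne_zero, by simp [hx0]⟩
  obtain ⟨c, hc⟩ := h.exists_smul_eq hx (hτ k x hx) hx0
  refine ⟨c, ?_, hc⟩
  rintro rfl
  exact hx0 (by simpa using hc)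

/-- The support of a graded division algebra with a graded antiautomorphism is 2-elementary. -/
theorem two_elementary_of_antiAut (h : IsCentralGradedDivision 𝒟) {τ : AntiAut F D}
    (hτ : ∀ k, ∀ x ∈ 𝒟 k, τ.app x ∈ 𝒟 k) (k : K) (hk : 𝒟 k ≠ ⊥) : k + k = 0 := by
  obtain ⟨x, hx, hx0⟩ := Submodule.exists_mem_ne_zero_of_ne_bot hk
  have hcomm : ∀ l, ∀ y ∈ 𝒟 l, x * x * y = y * (x * x) := by
    intro l y hy
    by_cases hy0 : y = 0
    · simp [hy0]
    obtain ⟨b, hb⟩ := h.exists_mul_comm hx hy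
    obtain ⟨c, hc0, hc⟩ := h.exists_antiAut_app hτ hx
    obtain ⟨e, he0, he⟩ := h.exists_antiAut_app hτ hy
    -- Since `τ` acts on `x` and `y` by scalars and reverses products, `xy = b yx` turns into `yx =
    -- b xy`. Together they say that `x²` commutes with `y`; being central, `x²` is a scalar and has
    -- degree `0`.
    have h1 := congrArg τ.app hb
    simp only [AntiAut.app_mul, AntiAut.app_smul, hc, he, smul_mul_smul_comm] at h1
    rw [mul_comm c e, smul_comm b] at h1
    have h2 : y * x = b • (x * y) := smul_right_injective D (_root_.mul_ne_zero he0 hc0) h1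
    calc x * x * y = x * (x * y) := mul_assoc _ _ _
      _ = x * (b • (y * x)) := congrArg _ hb
      _ = (b • (x * y)) * x := by rw [mul_smul_comm, ← mul_assoc, smul_mul_assoc]
      _ = y * (x * x) := by rw [← h2, mul_assoc]
  have hcen : x * x ∈ Subalgebra.center F D := by
    rw [Subalgebra.mem_center_iff]
    intro y
    have := LinearMap.eq_zero_of_iSup_eq_top h.isAbGrading.iSup_eq_top
      (LinearMap.mulLeft F (x * x) - LinearMap.mulRight F (x * x))
      (fun l y hy => sub_eq_zero.2 (hcomm l y hy)) y
    exact (sub_eq_zero.1 this).symm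
  have := h.isCentral
  rw [Algebra.IsCentral.center_eq_bot, Algebra.mem_bot] at hcen
  obtain ⟨c, hc⟩ := hcen
  rw [Algebra.algebraMap_eq_smul_one] at hc
  have h0 : x * x ∈ 𝒟 0 := hc ▸ Submodule.smul_mem _ _ h.isAbGrading.one_mem
  exact h.isAbGrading.indep.eq_of_mem (h.isAbGrading.mul_mem hx hx) h0 (h.mul_ne_zero hx hx0 hx0)

/-- A graded antiautomorphism of a central graded division algebra is an involution. -/
theorem antiAut_involutive (h : IsCentralGradedDivision 𝒟) {τ : AntiAut F D}
    (hτ : ∀ k, ∀ x ∈ 𝒟 k, τ.app x ∈ 𝒟 k) (x : D) : τ.app (τ.app x) = x := by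
  have := LinearMap.eq_zero_of_iSup_eq_top h.isAbGrading.iSup_eq_top
    (τ.linearMap ∘ₗ τ.linearMap - LinearMap.id) (fun k x hx => ?_) x
  · simpa [sub_eq_zero] using this
  by_cases hx0 : x = 0
  · simp [hx0]
  have h2 := h.two_elementary_of_antiAut hτ
  -- Now `x²` is a nonzero scalar, fixed by `τ`, while `τ(x) = c x`; hence `c² = 1`.
  obtain ⟨m, hm⟩ := h.exists_mul_self h2 hx
  obtain ⟨c, hc0, hc⟩ := h.exists_antiAut_app hτ hx
  have h1 := congrArg τ.app hm
  simp only [AntiAut.app_mul, AntiAut.app_smul, AntiAut.app_one, hc, smul_mul_smul_comm] at h1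
  rw [← hm] at h1
  have hxx := h.mul_ne_zero hx hx0 hx0
  have h3 : c * c = 1 := by
    have : (c * c - 1) • (x * x) = 0 := by rw [sub_smul, h1, one_smul, sub_self]
    rcases smul_eq_zero.1 this with h | h
    · exact sub_eq_zero.1 h
    · exact absurd h hxx
  simp [hc, smul_smul, h3]

end IsCentralGradedDivision

/-! ### Graded matrix algebras over a graded algebra. -/

section MatrixGrading

variable {F D K I : Type*} [Field F] [Ring D] [Algebra F D] [AddCommGroup K]

/-- The component of degree `k` of the matrix algebra over the graded algebra `D` in which the
`(a, b)` matrix unit has degree `deg a - deg b`. -/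
def matGrade (𝒟 : K → Submodule F D) (deg : I → K) (k : K) : Submodule F (Matrix I I D) where
  carrier := {m | ∀ a b, m a b ∈ 𝒟 (k - deg a + deg b)}
  zero_mem' := fun _ _ => Submodule.zero_mem _
  add_mem' := fun hm hn a b => Submodule.add_mem _ (hm a b) (hn a b)
  smul_mem' := fun c _ hm a b => Submodule.smul_mem _ c (hm a b)

variable {𝒟 : K → Submodule F D} {deg : I → K}

theorem mem_matGrade {k : K} {m : Matrix I I D} :
    m ∈ matGrade 𝒟 deg k ↔ ∀ a b, m a b ∈ 𝒟 (k - deg a + deg b) := Iff.rfl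

theorem single_mem_matGrade [DecidableEq I] {k : K} {a b : I} {d : D}
    (hd : d ∈ 𝒟 (k - deg a + deg b)) : Matrix.single a b d ∈ matGrade 𝒟 deg k := by
  intro a' b'
  rw [Matrix.single_apply]
  split_ifs with h
  · rw [← h.1, ← h.2]
    exact hd
  · exact Submodule.zero_mem _

theorem IsAbGrading.matGrade [Fintype I] [DecidableEq I] (h : IsAbGrading 𝒟) (deg : I → K) :
    IsAbGrading (matGrade 𝒟 deg) where
  gradedMonoid :=
    { one_mem := fun a b => by
        rw [Matrix.one_apply]
        split_ifs with hab
        · simpa [hab] using h.one_mem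
        · exact Submodule.zero_mem _
      mul_mem := fun k l m n hm hn a b => by
        rw [Matrix.mul_apply]
        exact Submodule.sum_mem _ fun c _ => h.mul_mem_of_eq (hm a c) (hn c b) (by abel) }
  indep := by
    refine iSupIndep.of_jointly_injective (ι := I × I) (N := fun _ => D)
      (fun x => Matrix.entryLinearMap F D x.1 x.2) (fun m hm => ?_)
      (𝒩 := fun x k => 𝒟 (k - deg x.1 + deg x.2)) (fun x => ?_) (fun x k m hm => hm x.1 x.2)
    · ext a b
      exact hm (a, b)
    · refine h.indep.comp (f := fun k => k - deg x.1 + deg x.2) fun k l hkl => ?_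
      simpa using hkl
  iSup_eq_top := by
    rw [eq_top_iff]
    intro m _
    rw [Matrix.matrix_eq_sum_single m]
    refine Submodule.sum_mem _ fun a _ => Submodule.sum_mem _ fun b _ => ?_
    have hle : ⨆ k, 𝒟 k ≤ (⨆ k, _root_.matGrade 𝒟 deg k).comap (Matrix.singleLinearMap F a b) := by
      refine iSup_le fun k d hd => ?_
      refine Submodule.mem_iSup_of_mem (k + deg a - deg b) (single_mem_matGrade ?_)
      convert hd using 2
      abel
    rw [h.iSup_eq_top] at hle
    exact hle (x := m a b) trivial

end MatrixGrading

section Comap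

variable {F A A' G : Type*} [Field F] [Ring A] [Algebra F A] [Ring A'] [Algebra F A']
  [AddCommGroup G]

theorem IsAbGrading.comap {Γ : G → Submodule F A'} (h : IsAbGrading Γ) (θ : A ≃ₐ[F] A') :
    IsAbGrading fun g => (Γ g).comap θ.toLinearMap where
  gradedMonoid :=
    { one_mem := by simpa using h.one_mem
      mul_mem := fun g k x y hx hy => by
        simpa using h.mul_mem (x := θ x) (y := θ y) hx hy }
  indep := iSupIndep.of_jointly_injective (ι := Unit) (N := fun _ => A') (fun _ => θ.toLinearMap)
    (fun m hm => by simpa using hm ()) (𝒩 := fun _ => Γ) (fun _ => h.indep) fun _ _ _ hm => hm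
  iSup_eq_top := by
    have hmap : ∀ g, (Γ g).comap θ.toLinearMap = (Γ g).map θ.symm.toLinearMap := fun g => by
      ext x
      simp only [Submodule.mem_comap, AlgEquiv.toLinearMap_apply, Submodule.mem_map]
      constructor
      · exact fun hx => ⟨_, hx, by simp⟩
      · rintro ⟨y, hy, rfl⟩
        simpa using hy
    simp_rw [hmap]
    rw [← Submodule.map_iSup, h.iSup_eq_top, Submodule.map_top, LinearMap.range_eq_top]
    exact θ.symm.surjective

end Comap

/-! ### Enlarging the grading group. -/

section ExtendedGrading

variable {F D K W : Type*} [Field F] [Ring D] [Algebra F D] [AddCommGroup W]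

open scoped Classical in
/-- A `K`-grading seen as a `K × W`-grading concentrated in degrees `(k, 0)`. -/
noncomputable def extGrade (W : Type*) [AddCommGroup W] (𝒟 : K → Submodule F D) (u : K × W) :
    Submodule F D :=
  if u.2 = 0 then 𝒟 u.1 else ⊥

theorem mem_extGrade {𝒟 : K → Submodule F D} {u : K × W} {x : D} :
    x ∈ extGrade W 𝒟 u ↔ x ∈ 𝒟 u.1 ∧ (x ≠ 0 → u.2 = 0) := by
  unfold extGrade
  split_ifs with h
  · simp [h]
  · constructor
    · intro hx
      obtain rfl : x = 0 := by simpa using hx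
      simp
    · rintro ⟨-, hx⟩
      have : x = 0 := by
        by_contra h0
        exact h (hx h0)
      simp [this]

theorem IsAbGrading.extGrade [AddCommGroup K] {𝒟 : K → Submodule F D} (h : IsAbGrading 𝒟) :
    IsAbGrading (extGrade W 𝒟) where
  gradedMonoid :=
    { one_mem := mem_extGrade.2 ⟨h.one_mem, fun _ => rfl⟩
      mul_mem := fun u v x y hx hy => by
        rw [mem_extGrade] at hx hy ⊢
        refine ⟨h.mul_mem hx.1 hy.1, fun hxy => ?_⟩
        rw [Prod.snd_add, hx.2 (left_ne_zero_of_mul hxy), hy.2 (right_ne_zero_of_mul hxy),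
          add_zero] }
  indep := by
    rw [iSupIndep_def]
    rintro ⟨k, w⟩
    rw [Submodule.disjoint_def]
    intro x hx hx'
    by_contra hx0
    rw [mem_extGrade] at hx
    obtain rfl : w = 0 := hx.2 hx0
    refine hx0 (Submodule.disjoint_def.1 (iSupIndep_def.1 h.indep k) x hx.1 ?_)
    refine (iSup₂_le ?_ : _ ≤ ⨆ j, ⨆ (_ : j ≠ k), 𝒟 j) hx'
    rintro ⟨j, w⟩ hj y hy
    rw [mem_extGrade] at hy
    by_cases hy0 : y = 0
    · simp [hy0]
    · obtain rfl : w = 0 := hy.2 hy0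
      exact Submodule.mem_iSup_of_mem j (Submodule.mem_iSup_of_mem (by simpa using hj) hy.1)
  iSup_eq_top := by
    rw [eq_top_iff, ← h.iSup_eq_top]
    exact iSup_le fun k x hx => Submodule.mem_iSup_of_mem (k, 0) (mem_extGrade.2 ⟨hx, fun _ => rfl⟩)

end ExtendedGrading

/-! ### Weights on an index set with an involution. -/

section Weights

variable {I : Type*} [DecidableEq I] (star : I → I)

/-- Weights `w a` with `w a + w (star a) = 0` which are otherwise as independent as possible. -/
def starWeight (a : I) : I → ℤ × ZMod 2 := fun x =>
  ((if a = x then 1 else 0) - (if a = star x then 1 else 0), if a = x ∧ star x = x then 1 else 0)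

variable {star}

theorem starWeight_injective : Function.Injective (starWeight star) := by
  intro a b h
  have h1 := congrArg Prod.fst (congrFun h a)
  have h2 := congrArg Prod.snd (congrFun h a)
  simp only [starWeight] at h1 h2
  by_contra hab
  by_cases ha : star a = a
  · simp [ha, Ne.symm hab] at h2
  · simp only [if_true, Ne.symm ha, if_false, Ne.symm hab] at h1
    split_ifs at h1 <;> omega

/-- Look at coordinate `x`. On the left it is positive in `ℤ` if `x` is not fixed by `star`, and
equal to `1` in `ZMod 2` if it is; without `x` among `x'`, `y'` the right side could not match. -/
theorem eq_or_eq_of_starWeight_add {x y x' y' : I} (hy : y ≠ star x)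
    (h : starWeight star x + starWeight star y = starWeight star x' + starWeight star y') :
    x' = x ∨ y' = x := by
  have h1 := congrArg Prod.fst (congrFun h x)
  have h2 := congrArg Prod.snd (congrFun h x)
  simp only [starWeight, Pi.add_apply, Prod.fst_add, Prod.snd_add] at h1 h2
  by_contra! hne
  by_cases hx : star x = x
  · rw [hx] at hy
    simp [hx, hy, hne.1, hne.2] at h2
  · simp only [if_true, Ne.symm hx, if_false, hy, hne.1, hne.2] at h1
    split_ifs at h1 <;> omega

variable (hstar : ∀ a, star (star a) = a)
include hstar

theorem starWeight_add_star (a : I) : starWeight star a + starWeight star (star a) = 0 := by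
  have h1 : ∀ x, star a = x ↔ a = star x := fun x =>
    ⟨fun h => by rw [← h, hstar], fun h => by rw [h, hstar]⟩
  funext x
  refine Prod.ext ?_ ?_
  · simp only [starWeight, Pi.add_apply, Prod.fst_add, h1, hstar]
    simp
  · simp only [starWeight, Pi.add_apply, Prod.snd_add, h1]
    by_cases hx : star x = x
    · simp only [hx, and_true]
      split_ifs <;> simp
      decide
    · simp [hx]

/-- The combinatorial core: off the diagonal, a difference of weights determines the position `(a,
b)` up to the swap to `(star b, star a)` made by the adjoint. Writing `-w b` as `w (star b)` reduces
this to sums of weights. -/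
theorem starWeight_sub_eq {a b a' b' : I}
    (h : starWeight star a - starWeight star b = starWeight star a' - starWeight star b') :
    (a = b ∧ a' = b') ∨ (a' = a ∧ b' = b) ∨ (a' = star b ∧ b' = star a) := by
  by_cases hab : a = b
  · left
    refine ⟨hab, starWeight_injective (star := star) ?_⟩
    rw [hab, sub_self] at h
    exact (sub_eq_zero.1 h.symm)
  right
  have hneg : ∀ c, starWeight star (star c) = -starWeight star c := fun c =>
    (neg_eq_of_add_eq_zero_right (starWeight_add_star hstar c)).symm
  have h' : starWeight star a + starWeight star (star b) =
      starWeight star a' + starWeight star (star b') := by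
    rw [hneg, hneg, ← sub_eq_add_neg, ← sub_eq_add_neg, h]
  have hinj : Function.Injective star := fun x y hxy => by rw [← hstar x, hxy, hstar]
  rcases eq_or_eq_of_starWeight_add (fun hb => hab (hinj hb).symm) h' with h1 | h1
  · refine Or.inl ⟨h1, ?_⟩
    rw [h1] at h'
    exact (hinj (starWeight_injective (add_left_cancel h'))).symm
  · refine Or.inr ⟨?_, by rw [← h1, hstar]⟩
    rw [h1, add_comm] at h'
    exact (starWeight_injective (add_right_cancel h')).symm

end Weights

/-! ### Presentations with a monomial Gram matrix. -/

/-- A coordinate presentation of `(A, φ, Γ)` as a matrix algebra over the graded algebra `D`, in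
which `φ` is the adjoint with respect to a form with monomial Gram matrix: the only nonzero entry
in the row `a` is the entry `γ a` in the column `star a`. -/
structure MonomialModel {F A G D K : Type*} [Field F] [Ring A] [Algebra F A] [Ring D] [Algebra F D]
    [AddCommGroup K] (φ : AntiAut F A) (Γ : G → Submodule F A) (𝒟 : K → Submodule F D)
    (I : Type*) [Fintype I] [DecidableEq I] where
  τ : AntiAut F D
  τ_graded : ∀ k, ∀ x ∈ 𝒟 k, τ.app x ∈ 𝒟 k
  star : I → I
  star_star : ∀ a, star (star a) = a
  deg : I → K
  κ : K
  γ : I → D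
  γi : I → D
  γ_mul_γi : ∀ a, γ a * γi a = 1
  γi_mul_γ : ∀ a, γi a * γ a = 1
  γ_mem : ∀ a, γ a ∈ 𝒟 (deg a + deg (star a) + κ)
  θ : A ≃ₐ[F] Matrix I I D
  θ_graded : IsGradedIso Γ (matGrade 𝒟 deg) θ
  θ_app : ∀ r a b, θ (φ.app r) a b =
    γi (star a) * τ.app (θ r (star b) (star a)) * γ (star b)

namespace MonomialModel

variable {F A D K G I : Type*} [Field F] [Ring A] [Algebra F A]
  [Ring D] [Algebra F D] [AddCommGroup K] {φ : AntiAut F A} {Γ : G → Submodule F A}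
  {𝒟 : K → Submodule F D} [Fintype I] [DecidableEq I] (M : MonomialModel φ Γ 𝒟 I)

section

variable (hD : IsCentralGradedDivision 𝒟)
include hD

theorem γ_ne_zero (a : I) : M.γ a ≠ 0 := by
  have := hD.nontrivial
  intro h
  simpa [h] using M.γ_mul_γi a

theorem γi_mem (a : I) : M.γi a ∈ 𝒟 (-(M.deg a + M.deg (M.star a) + M.κ)) := by
  obtain ⟨w, hw, h1, h2⟩ := hD.exists_inv (M.γ_mem a) (M.γ_ne_zero hD a)
  have : M.γi a = w := by
    rw [← mul_one (M.γi a), ← h1, ← mul_assoc, M.γi_mul_γ, one_mul]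
  rwa [this]

/-- The contributions of `κ`, `deg a` and `deg b` from `γ` and its inverse combine so that the
adjoint preserves the degree `k`. -/
theorem γi_mul_mul_γ_mem {k : K} {a b : I} {d : D} (hd : d ∈ 𝒟 (k - M.deg a + M.deg b)) :
    M.γi b * M.τ.app d * M.γ a ∈ 𝒟 (k - M.deg (M.star b) + M.deg (M.star a)) :=
  hD.isAbGrading.mul_mem_of_eq
    (hD.isAbGrading.mul_mem (M.γi_mem hD b) (M.τ_graded _ _ hd)) (M.γ_mem a) (by abel)

end

theorem app_symm_single (a b : I) (d : D) :
    M.θ (φ.app (M.θ.symm (Matrix.single a b d))) =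
      Matrix.single (M.star b) (M.star a) (M.γi b * M.τ.app d * M.γ a) := by
  ext c e
  rw [M.θ_app, AlgEquiv.apply_symm_apply, Matrix.single_apply, Matrix.single_apply]
  have h1 : ∀ x y, M.star x = y ↔ x = M.star y := fun x y =>
    ⟨fun h => by rw [← h, M.star_star], fun h => by rw [h, M.star_star]⟩
  simp only [h1]
  by_cases h : b = M.star c ∧ a = M.star e
  · rw [if_pos h.symm, if_pos h, ← h.1, ← h.2]
  · rw [if_neg fun h' => h h'.symm, if_neg h]
    simp

variable [IsAlgClosed F]

theorem exists_γ_star (hD : IsCentralGradedDivision 𝒟) (a : I) :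
    ∃ m : F, M.γ (M.star a) = m • M.γ a := by
  refine hD.exists_smul_eq (M.γ_mem a) ?_ (M.γ_ne_zero hD a)
  have := M.γ_mem (M.star a)
  rwa [M.star_star, add_comm (M.deg (M.star a))] at this

/-- Applying the adjoint twice conjugates by a diagonal matrix. With `γ (star a) = m a • γ a` and `τ
(γ a) = ε a • γ a` its entries are `s a = ε a / m a`; the relation `s a * s (star a) = 1` follows
from `ε a ^ 2 = 1`, `ε (star a) = ε a` and `m a * m (star a) = 1`. -/
theorem exists_sq_scalar (hD : IsCentralGradedDivision 𝒟) :
    ∃ s : I → F, (∀ a, s a ≠ 0) ∧ (∀ a, s a * s (M.star a) = 1) ∧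
      ∀ r a b, M.θ (φ.app (φ.app r)) a b = (s a * (s b)⁻¹) • M.θ r a b := by
  have hne := M.γ_ne_zero hD
  choose m hm using M.exists_γ_star hD
  choose ε hε0 hε using fun a => hD.exists_antiAut_app M.τ_graded (M.γ_mem a)
  have hcancel : ∀ a (x y : F), x • M.γ a = y • M.γ a → x = y := fun a x y h =>
    smul_left_injective F (hne a) h
  have hmm : ∀ a, m (M.star a) * m a = 1 := fun a => by
    have h := hm (M.star a)
    rw [M.star_star, hm a, smul_smul] at h
    exact (hcancel a _ _ ((one_smul F _).trans h)).symm
  have hm0 : ∀ a, m a ≠ 0 := fun a => right_ne_zero_of_mul_eq_one (hmm a)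
  have hεε : ∀ a, ε a * ε a = 1 := fun a => by
    have h := hD.antiAut_involutive M.τ_graded (M.γ a)
    rw [hε, AntiAut.app_smul, hε, smul_smul] at h
    exact hcancel a _ _ (h.trans (one_smul F _).symm)
  have hεs : ∀ a, ε (M.star a) = ε a := fun a => by
    have h := hε (M.star a)
    rw [hm, AntiAut.app_smul, hε, smul_smul, smul_smul] at h
    exact mul_right_cancel₀ (hm0 a) ((hcancel a _ _ h).symm.trans (mul_comm _ _))
  have hγi : ∀ a, M.γi (M.star a) = (m a)⁻¹ • M.γi a := fun a => by
    calc M.γi (M.star a) = M.γi (M.star a) * (((m a)⁻¹ • m a • M.γ a) * M.γi a) := by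
          rw [smul_smul, inv_mul_cancel₀ (hm0 a), one_smul, M.γ_mul_γi, mul_one]
      _ = (m a)⁻¹ • M.γi a := by
          rw [← hm, smul_mul_assoc, mul_smul_comm, ← mul_assoc, M.γi_mul_γ, one_mul]
  have hτi : ∀ a, M.τ.app (M.γi a) = ε a • M.γi a := fun a => by
    have h : M.γ a * M.τ.app (M.γi a) = ε a • 1 := by
      have h1 := congrArg M.τ.app (M.γi_mul_γ a)
      rw [AntiAut.app_mul, AntiAut.app_one, hε, smul_mul_assoc] at h1
      rw [← h1, smul_smul, hεε, one_smul]
    calc M.τ.app (M.γi a) = M.γi a * (M.γ a * M.τ.app (M.γi a)) := by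
          rw [← mul_assoc, M.γi_mul_γ, one_mul]
      _ = ε a • M.γi a := by rw [h, mul_smul_comm, mul_one]
  refine ⟨fun a => ε a * (m a)⁻¹, fun a => mul_ne_zero (hε0 a) (inv_ne_zero (hm0 a)),
    fun a => ?_, fun r a b => ?_⟩
  · simp only
    rw [hεs, mul_mul_mul_comm, hεε, one_mul, ← mul_inv, mul_comm (m a), hmm, inv_one]
  · rw [M.θ_app, M.θ_app]
    simp only [M.star_star, AntiAut.app_mul, hD.antiAut_involutive M.τ_graded]
    rw [hτi, hε, hγi, hm]
    simp only [smul_mul_assoc, mul_smul_comm, smul_smul]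
    have hcan : ∀ x : D, M.γi a * (M.γ a * (x * M.γi b)) * M.γ b = x := fun x => by
      rw [← mul_assoc, M.γi_mul_γ, one_mul, mul_assoc, M.γi_mul_γ, mul_one]
    rw [hcan]
    congr 1
    rw [mul_inv, inv_inv, show (ε b)⁻¹ = ε b from inv_eq_of_mul_eq_one_left (hεε b)]
    ring

end MonomialModel

/-! ### The refined grading of a presentation, and fineness. -/

section Refined

variable {F A D : Type u} {K G : Type v} {I : Type} [Field F] [Ring A] [Algebra F A]
  [Ring D] [Algebra F D] [AddCommGroup K] {φ : AntiAut F A} {Γ : G → Submodule F A}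
  {𝒟 : K → Submodule F D} [Fintype I] [DecidableEq I] (M : MonomialModel φ Γ 𝒟 I)

namespace MonomialModel

/-- The finest `φ`-grading compatible with the monomial presentation. -/
noncomputable def refined (u : K × ULift.{v} (I → ℤ × ZMod 2)) : Submodule F A :=
  (matGrade (extGrade (ULift.{v} (I → ℤ × ZMod 2)) 𝒟)
    (fun a => (M.deg a, ULift.up (starWeight M.star a))) u).comap M.θ.toLinearMap

theorem mem_refined {u : K × ULift.{v} (I → ℤ × ZMod 2)} {r : A} :
    r ∈ M.refined u ↔ ∀ a b, M.θ r a b ∈ 𝒟 (u.1 - M.deg a + M.deg b) ∧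
      (M.θ r a b ≠ 0 → starWeight M.star a - starWeight M.star b = u.2.down) := by
  have h : ∀ a b, (u - (M.deg a, ULift.up (starWeight M.star a)) +
      (M.deg b, ULift.up (starWeight M.star b))).2 = 0 ↔
      starWeight M.star a - starWeight M.star b = u.2.down := fun a b => by
    rw [Prod.snd_add, Prod.snd_sub, sub_add, sub_eq_zero, eq_comm, ULift.ext_iff]
    rfl
  simp only [refined, Submodule.mem_comap, mem_matGrade, mem_extGrade, h]
  rfl

theorem refined_le (u : K × ULift.{v} (I → ℤ × ZMod 2)) :
    M.refined u ≤ (matGrade 𝒟 M.deg u.1).comap M.θ.toLinearMap := fun _ hr a b =>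
  (M.mem_refined.1 hr a b).1

theorem isAbGrading_refined (hD : IsCentralGradedDivision 𝒟) : IsAbGrading M.refined :=
  ((hD.isAbGrading.extGrade).matGrade _).comap M.θ

theorem app_mem_refined (hD : IsCentralGradedDivision 𝒟) {u : K × ULift.{v} (I → ℤ × ZMod 2)}
    {r : A} (hr : r ∈ M.refined u) : φ.app r ∈ M.refined u := by
  rw [mem_refined] at hr ⊢
  intro a b
  obtain ⟨h1, h2⟩ := hr (M.star b) (M.star a)
  rw [M.θ_app]
  refine ⟨?_, fun h0 => ?_⟩
  · have := M.γi_mul_mul_γ_mem hD h1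
    rwa [M.star_star, M.star_star] at this
  · have hs := h2 (by
      intro h
      simp [h] at h0)
    have hneg : ∀ c, starWeight M.star (M.star c) = -starWeight M.star c := fun c =>
      (neg_eq_of_add_eq_zero_right (starWeight_add_star M.star_star c)).symm
    rw [← hs, hneg, hneg]
    abel

variable [IsAlgClosed F]

/-- By `starWeight_sub_eq` a component lives on the diagonal or on the positions `(a, b)` and `(star
b, star a)`. The factor `s a / s b` of `φ²` is the same at both positions because `s (star a)` is
the inverse of `s a`, and it is `1` on the diagonal. -/
theorem isPhiGrading_refined (hD : IsCentralGradedDivision 𝒟) : IsPhiGrading φ M.refined := by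
  obtain ⟨s, hs0, hs1, hs⟩ := M.exists_sq_scalar hD
  have key : ∀ u, ∃ α : F, α ≠ 0 ∧ ∀ x ∈ M.refined u, φ.app (φ.app x) = α • x := by
    intro u
    by_cases hu : ∃ a b, starWeight M.star a - starWeight M.star b = u.2.down
    · obtain ⟨a, b, hab⟩ := hu
      refine ⟨s a * (s b)⁻¹, mul_ne_zero (hs0 a) (inv_ne_zero (hs0 b)), fun x hx => ?_⟩
      apply M.θ.injective
      ext a' b'
      rw [hs, map_smul, Matrix.smul_apply]
      by_cases h0 : M.θ x a' b' = 0
      · simp [h0]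
      have hab' := (M.mem_refined.1 hx a' b').2 h0
      congr 1
      rcases starWeight_sub_eq M.star_star (hab'.trans hab.symm) with h | h | h
      · rw [h.1, h.2, mul_inv_cancel₀ (hs0 _), mul_inv_cancel₀ (hs0 _)]
      · rw [h.1, h.2]
      · have hi : ∀ c, (s c)⁻¹ = s (M.star c) := fun c => inv_eq_of_mul_eq_one_right (hs1 c)
        rw [h.1, h.2, hi, hi, M.star_star, mul_comm]
    -- A weight that is not a difference of index weights has zero component, so any nonzero scalar
    -- serves.
    · refine ⟨1, one_ne_zero, fun x hx => ?_⟩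
      have : x = 0 := by
        apply M.θ.injective
        ext a b
        by_contra h0
        exact hu ⟨a, b, (M.mem_refined.1 hx a b).2 (by simpa using h0)⟩
      simp [this]
  refine ⟨M.isAbGrading_refined hD, fun u => ?_, key, fun x hx => ?_⟩
  · apply Set.Subset.antisymm
    · rintro _ ⟨x, hx, rfl⟩
      exact M.app_mem_refined hD hx
    · intro x hx
      obtain ⟨α, hα, h⟩ := key u
      refine ⟨α⁻¹ • φ.app x, Submodule.smul_mem _ _ (M.app_mem_refined hD hx), ?_⟩
      rw [AntiAut.app_smul, h x hx, smul_smul, inv_mul_cancel₀ hα, one_smul]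
  · apply M.θ.injective
    ext a b
    rw [hs]
    by_cases h0 : M.θ x a b = 0
    · simp [h0]
    have hab := (M.mem_refined.1 hx a b).2 h0
    have : a = b := starWeight_injective (star := M.star) (sub_eq_zero.1 hab)
    rw [this, mul_inv_cancel₀ (hs0 _), one_smul]

end MonomialModel

namespace MonomialModel

variable [AddCommGroup G]

theorem θ_symm_graded (hD : IsCentralGradedDivision 𝒟) (hΓ : IsAbGrading Γ) :
    IsGradedIso (matGrade 𝒟 M.deg) Γ M.θ.symm :=
  M.θ_graded.symm_of hΓ (hD.isAbGrading.matGrade _)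

theorem exists_comap_le (hD : IsCentralGradedDivision 𝒟) (hΓ : IsAbGrading Γ) (k : K) :
    ∃ g, (matGrade 𝒟 M.deg k).comap M.θ.toLinearMap ≤ Γ g := by
  by_cases hb : matGrade 𝒟 M.deg k = ⊥
  -- A graded isomorphism says nothing about zero components; any degree works here.
  · refine ⟨0, fun x hx => ?_⟩
    rw [hb] at hx
    have : x = 0 := by simpa using hx
    simp [this]
  · obtain ⟨g, hg⟩ := M.θ_symm_graded hD hΓ k hb
    refine ⟨g, fun x hx => ?_⟩
    rw [← hg]
    exact ⟨_, hx, by simp⟩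

theorem refined_refines (hD : IsCentralGradedDivision 𝒟) (hΓ : IsAbGrading Γ) :
    Refines M.refined Γ := fun u => by
  obtain ⟨g, hg⟩ := M.exists_comap_le hD hΓ u.1
  exact ⟨g, (M.refined_le u).trans hg⟩

variable [IsAlgClosed F]

/-- Here fineness enters: `refined` is a `φ`-grading that refines `Γ`. The `ULift` in its grading
group puts it in the universe over which `fine` quantifies. -/
theorem refines_refined (hD : IsCentralGradedDivision 𝒟) (hΓ : IsFinePhiGrading φ Γ) :
    Refines Γ M.refined :=
  hΓ.fine _ _ (M.isPhiGrading_refined hD) (M.refined_refines hD hΓ.isPhiGrading.isAbGrading)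

/-- In a presentation of a fine grading the matrices of degree `0` are diagonal. -/
theorem apply_eq_zero_of_mem_matGrade_zero (hD : IsCentralGradedDivision 𝒟)
    (hΓ : IsFinePhiGrading φ Γ) {m : Matrix I I D} (hm : m ∈ matGrade 𝒟 M.deg 0) {a b : I}
    (hab : a ≠ b) : m a b = 0 := by
  have hAb := hΓ.isPhiGrading.isAbGrading
  by_contra h0
  obtain ⟨g, hg⟩ := M.exists_comap_le hD hAb 0
  obtain ⟨u, hu⟩ := M.refines_refined hD hΓ g
  -- The identity component of the matrices lands inside one component of `refined`. That component
  -- contains `1`, so it is the one of degree `0`, where injectivity of the weights excludes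
  -- off-diagonal entries.
  have hmu : M.θ.symm m ∈ M.refined u := hu (hg (by simpa using hm))
  have h1u : (1 : A) ∈ M.refined u :=
    hu (hg (by simpa using (hD.isAbGrading.matGrade M.deg).one_mem))
  have := hD.nontrivial
  have h10 : (1 : A) ≠ 0 := by
    intro h
    have h2 : (M.θ (1 : A)) a a = 0 := by rw [h, map_zero, Matrix.zero_apply]
    simp at h2
  have hr := M.isAbGrading_refined hD
  obtain rfl : u = 0 := hr.indep.eq_of_mem h1u hr.one_mem h10
  have := (M.mem_refined.1 hmu a b).2 (by simpa using h0)
  exact hab (starWeight_injective (star := M.star) (sub_eq_zero.1 this))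

end MonomialModel

end Refined

/-! ### Endomorphisms of a graded right module as graded matrices. -/

section Coordinates

variable {F D V I : Type*} [Field F] [Ring D] [Algebra F D] [AddCommGroup V]
  [Module F V] [Module Dᵐᵒᵖ V] [IsScalarTower F Dᵐᵒᵖ V] [Fintype I]
  (b : Module.Basis I Dᵐᵒᵖ V)

theorem Module.Basis.sum_op_smul (x : V) : ∑ a, MulOpposite.op (b.repr x a).unop • b a = x :=
  b.sum_repr x

variable [DecidableEq I]

/-- The matrix of an endomorphism of a right module with respect to a basis, as a homomorphism. -/
noncomputable def Module.Basis.endToMatrixHom : Module.End Dᵐᵒᵖ V →ₐ[F] Matrix I I D where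
  toFun f := Matrix.of fun a c => (b.repr (f (b c)) a).unop
  map_one' := by
    ext a c
    simp only [Module.End.one_apply, Module.Basis.repr_self, Matrix.of_apply, Matrix.one_apply,
      Finsupp.single_apply, eq_comm (a := c)]
    split_ifs <;> rfl
  map_mul' f g := by
    ext a c
    have h : (f * g) (b c) = ∑ e, b.repr (g (b c)) e • f (b e) := by
      rw [Module.End.mul_apply]
      conv_lhs => rw [← b.sum_repr (g (b c))]
      simp only [map_sum, map_smul]
    simp only [Matrix.of_apply, Matrix.mul_apply, h, map_sum, map_smul, Finsupp.coe_finsetSum,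
      Finset.sum_apply, Finsupp.smul_apply, smul_eq_mul, Finset.unop_sum, MulOpposite.unop_mul]
  map_zero' := by
    ext a c
    simp
  map_add' f g := by
    ext a c
    simp
  commutes' r := by
    ext a c
    have h : (algebraMap F (Module.End Dᵐᵒᵖ V) r) (b c) = (r • (1 : Dᵐᵒᵖ)) • b c := by
      rw [smul_assoc, one_smul]
      rfl
    rw [Matrix.of_apply, h, map_smul, b.repr_self, Matrix.algebraMap_matrix_apply,
      Finsupp.smul_apply, Finsupp.single_apply, Algebra.algebraMap_eq_smul_one]
    simp only [eq_comm (a := c)]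
    split_ifs <;> simp

theorem Module.Basis.endToMatrixHom_apply (f : Module.End Dᵐᵒᵖ V) (a c : I) :
    b.endToMatrixHom (F := F) f a c = (b.repr (f (b c)) a).unop := rfl

theorem Module.Basis.endToMatrixHom_bijective :
    Function.Bijective (b.endToMatrixHom (F := F)) := by
  constructor
  · intro f g hfg
    refine b.ext fun c => b.repr.injective (Finsupp.ext fun a => ?_)
    exact MulOpposite.unop_injective (congrFun (congrFun hfg a) c)
  · intro m
    refine ⟨b.constr ℕ fun c => ∑ a, MulOpposite.op (m a c) • b a, ?_⟩
    ext a c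
    rw [b.endToMatrixHom_apply, b.constr_basis, map_sum, Finsupp.finsetSum_apply]
    simp [Finsupp.single_apply]

/-- Endomorphisms of a right module with a finite basis are matrices. -/
noncomputable def Module.Basis.endToMatrix : Module.End Dᵐᵒᵖ V ≃ₐ[F] Matrix I I D :=
  AlgEquiv.ofBijective _ b.endToMatrixHom_bijective

theorem Module.Basis.endToMatrix_apply (f : Module.End Dᵐᵒᵖ V) (a c : I) :
    b.endToMatrix (F := F) f a c = (b.repr (f (b c)) a).unop := rfl

variable {K : Type*} [AddCommGroup K] {𝒟 : K → Submodule F D} {𝒱 : K → Submodule F V}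
  (h𝒟 : IsAbGrading 𝒟) (hindep : iSupIndep 𝒱)
  (hsmul : ∀ j k, ∀ x ∈ 𝒱 j, ∀ d ∈ 𝒟 k, MulOpposite.op d • x ∈ 𝒱 (j + k))
  {deg : I → K} (hdeg : ∀ a, b a ∈ 𝒱 (deg a))

-- The subspaces `𝒱'` cut out by the coordinate condition are contained in the components `𝒱 j` and
-- together span `V`, so `iSupIndep.eq_of_le` gives equality.
include h𝒟 hindep hsmul hdeg in
theorem Module.Basis.mem_grade_iff (j : K) (x : V) :
    x ∈ 𝒱 j ↔ ∀ a, (b.repr x a).unop ∈ 𝒟 (j - deg a) := by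
  have hrepr : ∀ (c : F) (y : V), b.repr (c • y) = c • b.repr y := fun c y => by
    have : c • y = (c • (1 : Dᵐᵒᵖ)) • y := by rw [smul_assoc, one_smul]
    rw [this, map_smul]
    ext a
    simp
  let 𝒱' : K → Submodule F V := fun j =>
    { carrier := {x | ∀ a, (b.repr x a).unop ∈ 𝒟 (j - deg a)}
      zero_mem' := fun a => by simp
      add_mem' := fun hx hy a => by
        rw [map_add, Finsupp.add_apply, MulOpposite.unop_add]
        exact Submodule.add_mem _ (hx a) (hy a)
      smul_mem' := fun c x hx a => by
        rw [hrepr, Finsupp.smul_apply, MulOpposite.unop_smul]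
        exact Submodule.smul_mem _ c (hx a) }
  have hle : ∀ j, 𝒱' j ≤ 𝒱 j := by
    intro j x hx
    rw [← b.sum_op_smul x]
    refine Submodule.sum_mem _ fun a _ => ?_
    have := hsmul _ _ _ (hdeg a) _ (hx a)
    rwa [add_sub_cancel] at this
  have htop : ⨆ j, 𝒱' j = ⊤ := by
    rw [eq_top_iff]
    intro x _
    rw [← b.sum_op_smul x]
    refine Submodule.sum_mem _ fun a _ => ?_
    let f : D →ₗ[F] V :=
      { toFun := fun d => MulOpposite.op d • b a
        map_add' := fun d e => by rw [MulOpposite.op_add, add_smul]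
        map_smul' := fun c d => by rw [MulOpposite.op_smul, smul_assoc]; rfl }
    have hf : ⨆ k, 𝒟 k ≤ (⨆ j, 𝒱' j).comap f := by
      refine iSup_le fun k d hd => Submodule.mem_iSup_of_mem (k + deg a) fun c => ?_
      change (b.repr (MulOpposite.op d • b a) c).unop ∈ _
      rw [map_smul, b.repr_self, Finsupp.smul_apply, Finsupp.single_apply]
      split_ifs with h
      · simpa [h] using hd
      · simp
    rw [h𝒟.iSup_eq_top] at hf
    exact hf (x := (b.repr x a).unop) trivial
  rw [← hindep.eq_of_le hle htop j]
  rfl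

include h𝒟 hindep hsmul hdeg in
theorem Module.Basis.mem_inducedGrading_iff (k : K) (f : Module.End Dᵐᵒᵖ V) :
    f ∈ inducedGrading (D := D) 𝒱 k ↔ b.endToMatrix (F := F) f ∈ matGrade 𝒟 deg k := by
  have hmem := b.mem_grade_iff h𝒟 hindep hsmul hdeg
  constructor
  · intro hf a c
    have h := (hmem _ _).1 (hf _ _ (hdeg c)) a
    rw [b.endToMatrix_apply]
    convert h using 2
    abel
  · intro hf j x hx
    have hfb : ∀ c, f (b c) ∈ 𝒱 (k + deg c) := fun c => by
      rw [hmem]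
      intro a
      have h := hf a c
      rw [b.endToMatrix_apply] at h
      convert h using 2
      abel
    rw [← b.sum_op_smul x, map_sum]
    refine Submodule.sum_mem _ fun c _ => ?_
    rw [map_smul]
    have h := hsmul _ _ _ (hfb c) _ ((hmem j x).1 hx c)
    convert h using 2
    abel

include h𝒟 hindep hsmul hdeg in
theorem Module.Basis.isGradedIso_endToMatrix :
    IsGradedIso (inducedGrading (D := D) 𝒱) (matGrade 𝒟 deg) (b.endToMatrix (F := F)) := by
  intro k _
  refine ⟨k, Submodule.ext fun m => ?_⟩
  constructor
  · rintro ⟨f, hf, rfl⟩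
    exact (b.mem_inducedGrading_iff h𝒟 hindep hsmul hdeg k f).1 hf
  · intro hm
    refine ⟨b.endToMatrix.symm m, ?_, b.endToMatrix.apply_symm_apply m⟩
    exact (b.mem_inducedGrading_iff h𝒟 hindep hsmul hdeg k _).2 (by rwa [AlgEquiv.apply_symm_apply])

end Coordinates

/-! ### The presentation given by a good basis. -/

/-- The involution of the index set of a good basis. -/
def pairStar {p s : ℕ} : Fin p ⊕ (Fin s ⊕ Fin s) → Fin p ⊕ (Fin s ⊕ Fin s) := Sum.map id Sum.swap

@[simp] theorem pairStar_inl {p s : ℕ} (i : Fin p) :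
    pairStar (s := s) (Sum.inl i) = Sum.inl i := rfl

@[simp] theorem pairStar_inr_inl {p s : ℕ} (j : Fin s) :
    pairStar (p := p) (Sum.inr (Sum.inl j)) = Sum.inr (Sum.inr j) := rfl

@[simp] theorem pairStar_inr_inr {p s : ℕ} (j : Fin s) :
    pairStar (p := p) (Sum.inr (Sum.inr j)) = Sum.inr (Sum.inl j) := rfl

theorem pairStar_pairStar {p s : ℕ} (a : Fin p ⊕ (Fin s ⊕ Fin s)) : pairStar (pairStar a) = a := by
  rcases a with i | j | j <;> rfl

theorem goodGram_eq {F D : Type*} [Field F] [Ring D] [Algebra F D] {p s : ℕ} (d : Fin p → D)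
    (ν : Fin s → F) (a b : Fin p ⊕ (Fin s ⊕ Fin s)) :
    goodGram d ν a b = if b = pairStar a then goodGram d ν a (pairStar a) else 0 := by
  rcases a with i | j | j <;> rcases b with i' | j' | j' <;> simp [goodGram, eq_comm]

/-- The inverses of the entries of the Gram matrix of a good basis. -/
def goodGramInv {F D : Type*} [Field F] [Ring D] [Algebra F D] {p s : ℕ} (d : Fin p → D)
    (ν : Fin s → F) : Fin p ⊕ (Fin s ⊕ Fin s) → D
  | .inl i => d i
  | .inr (.inl j) => algebraMap F D (ν j)⁻¹
  | .inr (.inr j) => algebraMap F D (ν j)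

theorem goodGram_mul_goodGramInv {F D : Type*} [Field F] [Ring D] [Algebra F D] {p s : ℕ}
    {d : Fin p → D} {ν : Fin s → F} (hd : ∀ i, d i * d i = 1) (hν : ∀ j, ν j ≠ 0)
    (a : Fin p ⊕ (Fin s ⊕ Fin s)) : goodGram d ν a (pairStar a) * goodGramInv d ν a = 1 := by
  rcases a with i | j | j
  · simpa [goodGram, goodGramInv] using hd i
  · simp [goodGram, goodGramInv, ← map_mul, hν, -map_inv₀]
  · simp [goodGram, goodGramInv, ← map_mul, hν, -map_inv₀]

theorem goodGramInv_mul_goodGram {F D : Type*} [Field F] [Ring D] [Algebra F D] {p s : ℕ}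
    {d : Fin p → D} {ν : Fin s → F} (hd : ∀ i, d i * d i = 1) (hν : ∀ j, ν j ≠ 0)
    (a : Fin p ⊕ (Fin s ⊕ Fin s)) : goodGramInv d ν a * goodGram d ν a (pairStar a) = 1 := by
  rcases a with i | j | j
  · simpa [goodGram, goodGramInv] using hd i
  · simp [goodGram, goodGramInv, ← map_mul, hν, -map_inv₀]
  · simp [goodGram, goodGramInv, ← map_mul, hν, -map_inv₀]

namespace Realization

variable {F A : Type u} {G : Type v} [Field F] [Ring A] [Algebra F A]
  [AddCommGroup G] {φ : AntiAut F A} {Γ : G → Submodule F A} {P : DivPair.{u, v} F}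

/-- The matrix presentation given by the good basis of a realization. -/
noncomputable def model (Z : Realization φ Γ P) :
    MonomialModel φ Γ P.grade (Fin P.p ⊕ (Fin Z.s ⊕ Fin Z.s)) where
  τ := Z.τ
  τ_graded := Z.τ_graded
  star := pairStar
  star_star := pairStar_pairStar
  deg a := (Z.basis_homogeneous a).choose
  κ := Z.degB
  γ a := goodGram P.d Z.ν a (pairStar a)
  γi := goodGramInv P.d Z.ν
  γ_mul_γi := goodGram_mul_goodGramInv Z.d_sq Z.ν_ne_zero
  γi_mul_γ := goodGramInv_mul_goodGram Z.d_sq Z.ν_ne_zero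
  γ_mem a := by
    rw [← Z.gram]
    exact Z.B_homogeneous _ _ _ (Z.basis_homogeneous a).choose_spec _
      (Z.basis_homogeneous (pairStar a)).choose_spec
  θ := Z.iso.trans Z.basis.endToMatrix
  θ_graded := Z.iso_graded.comp (Z.basis.isGradedIso_endToMatrix P.isDivision.isAbGrading
    Z.gradeV_indep Z.gradeV_smul_mem fun a => (Z.basis_homogeneous a).choose_spec)
  θ_app r a b := by
    -- Both sides of the adjoint identity are expanded at the vectors with indices `pairStar a` and
    -- `b`. As the Gram matrix is monomial, one term survives on each side, and inverting a Gram
    -- entry isolates the matrix entry of `φ.app r`.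
    have h1 : Z.B (Z.iso r (Z.basis (pairStar a))) (Z.basis b) =
        Z.τ.app (Z.basis.endToMatrix (F := F) (Z.iso r) (pairStar b) (pairStar a)) *
          goodGram P.d Z.ν (pairStar b) (pairStar (pairStar b)) := by
      rw [← Z.basis.sum_op_smul (Z.iso r (Z.basis (pairStar a))), map_sum, LinearMap.sum_apply,
        Finset.sum_eq_single (pairStar b)]
      · rw [Z.B_smul_left, Z.gram, pairStar_pairStar]
        rfl
      · intro c _ hc
        rw [Z.B_smul_left, Z.gram, goodGram_eq, if_neg, mul_zero]
        intro h
        exact hc (by rw [h, pairStar_pairStar])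
      · simp
    have h2 : Z.B (Z.basis (pairStar a)) (Z.iso (φ.app r) (Z.basis b)) =
        goodGram P.d Z.ν (pairStar a) (pairStar (pairStar a)) *
          Z.basis.endToMatrix (F := F) (Z.iso (φ.app r)) a b := by
      rw [← Z.basis.sum_op_smul (Z.iso (φ.app r) (Z.basis b)), map_sum,
        Finset.sum_eq_single a]
      · rw [Z.B_smul_right, Z.gram, pairStar_pairStar]
        rfl
      · intro c _ hc
        rw [Z.B_smul_right, Z.gram, goodGram_eq, if_neg, zero_mul]
        intro h
        exact hc (by rw [h, pairStar_pairStar])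
      · simp
    rw [Z.iso_adjoint, h2] at h1
    change Z.basis.endToMatrix (F := F) (Z.iso (φ.app r)) a b =
      _ * Z.τ.app (Z.basis.endToMatrix (F := F) (Z.iso r) (pairStar b) (pairStar a)) * _
    rw [mul_assoc, ← h1, ← mul_assoc,
      goodGramInv_mul_goodGram Z.d_sq Z.ν_ne_zero, one_mul]

end Realization

/-- The identity component is the one containing `1`, so it is preserved although the grading groups
are unrelated. -/
theorem IsGradedIso.map_mem_zero {F A A' G G' : Type*} [Field F] [Ring A] [Algebra F A]
    [Ring A'] [Algebra F A'] [AddCommGroup G] [AddCommGroup G'] {Γ : G → Submodule F A}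
    {Γ' : G' → Submodule F A'} {Φ : A ≃ₐ[F] A'} (hΓ : IsAbGrading Γ) (hΓ' : IsAbGrading Γ')
    (h : IsGradedIso Γ Γ' Φ) {x : A} (hx : x ∈ Γ 0) : Φ x ∈ Γ' 0 := by
  by_cases h1 : (1 : A) = 0
  · have : x = 0 := by rw [← mul_one x, h1, mul_zero]
    simp [this]
  obtain ⟨g, hg⟩ := h 0 fun hb => h1 (by simpa [hb] using hΓ.one_mem)
  have hmem : ∀ y ∈ Γ 0, Φ y ∈ Γ' g := fun y hy =>
    hg ▸ Submodule.mem_map_of_mem (f := Φ.toLinearMap) hy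
  have hone := hmem 1 hΓ.one_mem
  rw [map_one] at hone
  have h1' : (1 : A') ≠ 0 := fun h0 => h1 (Φ.injective (by simpa using h0))
  obtain rfl : g = 0 := hΓ'.indep.eq_of_mem hone hΓ'.one_mem h1'
  exact hmem x hx

theorem Matrix.single_inj {m n α : Type*} [DecidableEq m] [DecidableEq n] [Zero α] {i : m} {j : n}
    {x y : α} : Matrix.single i j x = Matrix.single i j y ↔ x = y :=
  ⟨fun h => by simpa using congrFun (congrFun h i) j, fun h => by rw [h]⟩

theorem Matrix.single_eq_zero_iff {m n α : Type*} [DecidableEq m] [DecidableEq n] [Zero α] {i : m}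
    {j : n} {x : α} : Matrix.single i j x = 0 ↔ x = 0 := by
  rw [← Matrix.single_zero i j, Matrix.single_inj]

theorem Matrix.eq_of_single_one_eq {n α : Type*} [DecidableEq n] [Zero α] [One α] [NeZero (1 : α)]
    {i j : n} (h : (Matrix.single i i 1 : Matrix n n α) = Matrix.single j j 1) : i = j := by
  by_contra hij
  have := congrFun (congrFun h i) i
  simp [Ne.symm hij] at this

/-! ### Graded isomorphisms permute the diagonal idempotents. -/

section DiagonalZeroComponent

variable {F D D' K K' I I' : Type*} [Field F] [IsAlgClosed F] [Ring D] [Algebra F D] [Ring D']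
  [Algebra F D'] [AddCommGroup K] [AddCommGroup K'] {𝒟 : K → Submodule F D}
  {𝒟' : K' → Submodule F D'} [Fintype I] [DecidableEq I] [Fintype I'] [DecidableEq I']
  {deg : I → K} {deg' : I' → K'} {Θ : Matrix I I D ≃ₐ[F] Matrix I' I' D'}

/-- In degree `0` the matrices are diagonal with scalar entries, so `E_bb * e = c • E_bb` for an
index `b` with `c ≠ 0`. Pulling `E_bb` back by `Θ` gives likewise `E_bb * e = c' • e`. Thus `e` is a
multiple of `E_bb`, and idempotency makes the factor `1`. -/
theorem exists_map_single_eq_single (hD : IsCentralGradedDivision 𝒟)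
    (hD' : IsCentralGradedDivision 𝒟') (hΘ : IsGradedIso (matGrade 𝒟 deg) (matGrade 𝒟' deg') Θ)
    (hdiag : ∀ m ∈ matGrade 𝒟 deg 0, ∀ a b, a ≠ b → m a b = 0)
    (hdiag' : ∀ m ∈ matGrade 𝒟' deg' 0, ∀ a b, a ≠ b → m a b = 0) (a : I) :
    ∃ b, Θ (Matrix.single a a 1) = Matrix.single b b 1 := by
  have := hD.nontrivial
  have := hD'.nontrivial
  have hΓ := hD.isAbGrading.matGrade deg
  have hΓ' := hD'.isAbGrading.matGrade deg'
  have hΘs := hΘ.symm_of hΓ hΓ'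
  have hsa : (Matrix.single a a 1 : Matrix I I D) ∈ matGrade 𝒟 deg 0 :=
    single_mem_matGrade (by simpa using hD.isAbGrading.one_mem)
  set e := Θ (Matrix.single a a 1) with he
  have he0 : e ∈ matGrade 𝒟' deg' 0 := hΘ.map_mem_zero hΓ hΓ' hsa
  have hene : e ≠ 0 := by
    rw [he, Ne, map_eq_zero_iff _ Θ.injective, Matrix.single_eq_zero_iff]
    exact one_ne_zero
  obtain ⟨b, hb⟩ : ∃ b, e b b ≠ 0 := by
    by_contra! hcon
    apply hene
    ext c c'
    by_cases hcc : c = c'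
    · rw [hcc, hcon, Matrix.zero_apply]
    · rw [hdiag' e he0 c c' hcc, Matrix.zero_apply]
  have hsb : (Matrix.single b b 1 : Matrix I' I' D') ∈ matGrade 𝒟' deg' 0 :=
    single_mem_matGrade (by simpa using hD'.isAbGrading.one_mem)
  obtain ⟨c, hc⟩ := hD'.exists_eq_smul_one (x := e b b) (by simpa using he0 b b)
  have hc0 : c ≠ 0 := by
    rintro rfl
    simp [hc] at hb
  have h1 : Matrix.single b b 1 * e = c • Matrix.single b b 1 := by
    ext x y
    rw [Matrix.smul_apply, Matrix.single_apply]
    by_cases hx : x = b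
    · subst hx
      rw [Matrix.single_mul_apply_same, one_mul]
      by_cases hy : x = y
      · subst hy
        simp [hc]
      · rw [hdiag' e he0 x y hy]
        simp [hy]
    · rw [Matrix.single_mul_apply_of_ne _ _ _ _ _ hx]
      simp [Ne.symm hx]
  set f := Θ.symm (Matrix.single b b 1) with hf
  have hf0 : f ∈ matGrade 𝒟 deg 0 := hΘs.map_mem_zero hΓ' hΓ hsb
  obtain ⟨c', hc'⟩ := hD.exists_eq_smul_one (x := f a a) (by simpa using hf0 a a)
  have h2 : f * Matrix.single a a 1 = c' • Matrix.single a a 1 := by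
    ext x y
    rw [Matrix.smul_apply, Matrix.single_apply]
    by_cases hy : y = a
    · subst hy
      rw [Matrix.mul_single_apply_same, mul_one]
      by_cases hx : x = y
      · subst hx
        simp [hc']
      · rw [hdiag f hf0 x y hx]
        simp [Ne.symm hx]
    · rw [Matrix.mul_single_apply_of_ne _ _ _ _ _ hy]
      simp [Ne.symm hy]
  have h3 := congrArg Θ h2
  rw [map_mul, map_smul, hf, AlgEquiv.apply_symm_apply, ← he, h1] at h3
  have hc'0 : c' ≠ 0 := by
    rintro rfl
    rw [zero_smul, smul_eq_zero, Matrix.single_eq_zero_iff] at h3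
    simp [hc0] at h3
  have h4 : e = (c'⁻¹ * c) • Matrix.single b b 1 := by
    rw [mul_smul, h3, smul_smul, inv_mul_cancel₀ hc'0, one_smul]
  have hidem : e * e = e := by
    rw [he, ← map_mul, Matrix.single_mul_single_same, one_mul]
  have h5 : c'⁻¹ * c = 1 := by
    rw [h4, smul_mul_smul_comm, Matrix.single_mul_single_same, one_mul] at hidem
    have h6 := congrFun (congrFun hidem b) b
    simp only [Matrix.smul_apply, Matrix.single_apply_same] at h6
    exact mul_left_cancel₀ (mul_ne_zero (inv_ne_zero hc'0) hc0)
      ((smul_left_injective F (one_ne_zero (α := D')) h6).trans (mul_one _).symm)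
  exact ⟨b, by rw [h4, h5, one_smul]⟩

theorem exists_equiv_map_single_eq_single (hD : IsCentralGradedDivision 𝒟)
    (hD' : IsCentralGradedDivision 𝒟') (hΘ : IsGradedIso (matGrade 𝒟 deg) (matGrade 𝒟' deg') Θ)
    (hdiag : ∀ m ∈ matGrade 𝒟 deg 0, ∀ a b, a ≠ b → m a b = 0)
    (hdiag' : ∀ m ∈ matGrade 𝒟' deg' 0, ∀ a b, a ≠ b → m a b = 0) :
    ∃ σ : I ≃ I', ∀ a, Θ (Matrix.single a a 1) = Matrix.single (σ a) (σ a) 1 := by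
  have := hD.nontrivial
  have := hD'.nontrivial
  choose σ hσ using exists_map_single_eq_single hD hD' hΘ hdiag hdiag'
  refine ⟨Equiv.ofBijective σ ⟨fun a b hab => ?_, fun b => ?_⟩, hσ⟩
  · apply Matrix.eq_of_single_one_eq (α := D)
    apply Θ.injective
    rw [hσ, hσ, hab]
  · have hΘs := hΘ.symm_of (hD.isAbGrading.matGrade deg) (hD'.isAbGrading.matGrade deg')
    obtain ⟨a, ha⟩ := exists_map_single_eq_single hD' hD hΘs hdiag' hdiag b
    refine ⟨a, Matrix.eq_of_single_one_eq (α := D') ?_⟩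
    rw [← hσ, ← ha, AlgEquiv.apply_symm_apply]

end DiagonalZeroComponent

/-! ### The induced isomorphism of coordinate algebras. -/

section Corner

variable {F D D' I I' : Type*} [Field F] [Ring D] [Algebra F D] [Ring D']
  [Algebra F D'] [Fintype I] [DecidableEq I] [Fintype I'] [DecidableEq I']
  {Θ : Matrix I I D ≃ₐ[F] Matrix I' I' D'} {σ : I ≃ I'}
  (hσ : ∀ a, Θ (Matrix.single a a 1) = Matrix.single (σ a) (σ a) 1)
include hσ

theorem map_single_eq_single_of_diag (a b : I) (d : D) :
    Θ (Matrix.single a b d) =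
      Matrix.single (σ a) (σ b) (Θ (Matrix.single a b d) (σ a) (σ b)) := by
  have h : (Matrix.single a b d : Matrix I I D) =
      Matrix.single a a 1 * Matrix.single a b d * Matrix.single b b 1 := by simp
  conv_lhs => rw [h]
  rw [map_mul, map_mul, hσ, hσ]
  simp [Matrix.single_mul_mul_single]

theorem map_single_mul_of_diag (a b c : I) (d e : D) :
    Θ (Matrix.single a b d) (σ a) (σ b) * Θ (Matrix.single b c e) (σ b) (σ c) =
      Θ (Matrix.single a c (d * e)) (σ a) (σ c) := by
  rw [← Matrix.single_mul_single_same d a b c e, map_mul,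
    map_single_eq_single_of_diag hσ a b d,
    map_single_eq_single_of_diag hσ b c e, Matrix.single_mul_single_same]
  simp

/-- The isomorphism of coordinate algebras induced by an isomorphism of matrix algebras which
permutes the diagonal idempotents. -/
noncomputable def cornerEquiv (a : I) : D ≃ₐ[F] D' :=
  AlgEquiv.ofBijective
    (AlgHom.ofLinearMap
      (Matrix.entryLinearMap F D' (σ a) (σ a) ∘ₗ Θ.toLinearMap ∘ₗ Matrix.singleLinearMap F a a)
      (by simp [hσ])
      (fun x y => (map_single_mul_of_diag hσ a a a x y).symm)) (by
    constructor
    · intro x y hxy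
      have h : Θ (Matrix.single a a x) = Θ (Matrix.single a a y) := by
        rw [map_single_eq_single_of_diag hσ, map_single_eq_single_of_diag hσ a a y]
        exact congrArg _ hxy
      exact Matrix.single_inj.1 (Θ.injective h)
    · intro y
      have h : Θ.symm (Matrix.single (σ a) (σ a) y) =
          Matrix.single a a (Θ.symm (Matrix.single (σ a) (σ a) y) a a) := by
        have h1 := map_single_eq_single_of_diag (Θ := Θ.symm) (σ := σ.symm)
          (fun b => by
            rw [AlgEquiv.symm_apply_eq, hσ, Equiv.apply_symm_apply]) (σ a) (σ a) y
        simpa using h1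
      refine ⟨Θ.symm (Matrix.single (σ a) (σ a) y) a a, ?_⟩
      change Θ (Matrix.single a a _) (σ a) (σ a) = y
      rw [← h, AlgEquiv.apply_symm_apply, Matrix.single_apply_same])

theorem cornerEquiv_apply (a : I) (d : D) :
    cornerEquiv hσ a d = Θ (Matrix.single a a d) (σ a) (σ a) := rfl

end Corner

/-- Nonzero components on both sides are lines, so mapping homogeneous elements to homogeneous
elements already maps components onto components. -/
theorem IsCentralGradedDivision.isGradedIso_of_maps {F D D' K K' : Type*} [Field F] [IsAlgClosed F]
    [Ring D] [Algebra F D] [Ring D'] [Algebra F D'] [AddCommGroup K] [AddCommGroup K']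
    {𝒟 : K → Submodule F D} {𝒟' : K' → Submodule F D'} (hD' : IsCentralGradedDivision 𝒟')
    {ψ : D ≃ₐ[F] D'} (h : ∀ k, ∀ x ∈ 𝒟 k, ∃ k', ψ x ∈ 𝒟' k') (hD : IsCentralGradedDivision 𝒟) :
    IsGradedIso 𝒟 𝒟' ψ := by
  intro k hk
  obtain ⟨x, hx, hx0⟩ := Submodule.exists_mem_ne_zero_of_ne_bot hk
  obtain ⟨k', hk'⟩ := h k x hx
  refine ⟨k', le_antisymm ?_ ?_⟩
  · rintro _ ⟨y, hy, rfl⟩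
    obtain ⟨c, rfl⟩ := hD.exists_smul_eq hx hy hx0
    simpa using Submodule.smul_mem _ c hk'
  · intro y hy
    obtain ⟨c, rfl⟩ := hD'.exists_smul_eq hk' hy (by simpa using hx0)
    exact ⟨c • x, Submodule.smul_mem _ c hx, by simp⟩

/-- Apply the intertwining relation to `E_ao` for a fixed index `o`. With `x`, `y`, `q` the entries
of the images of `E_ao`, `E_oa` and `E_{o*,o}`, where `o* = M.star o`, it reads `q ψ(γ_o⁻¹ γ_a) y =
c γ'_{σo}⁻¹ τ'(x) γ'_{σa}` when `a` is fixed by `star`. As `y` is inverse to `x`, moving it across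
leaves a multiple of `x² γ'_{σa}`, and `x²` is a scalar. -/
theorem MonomialModel.exists_coordinate_equiv {F A A' D D' : Type u} {G G' K K' : Type v}
    {I I' : Type} [Field F] [IsAlgClosed F] [Ring A] [Algebra F A] [Ring A'] [Algebra F A']
    [Ring D] [Algebra F D] [Ring D'] [Algebra F D'] [AddCommGroup G] [AddCommGroup G']
    [AddCommGroup K] [AddCommGroup K']
    [Fintype I] [DecidableEq I] [Fintype I'] [DecidableEq I']
    [Nonempty I]
    {φ : AntiAut F A} {Γ : G → Submodule F A} {𝒟 : K → Submodule F D}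
    {φ' : AntiAut F A'} {Γ' : G' → Submodule F A'} {𝒟' : K' → Submodule F D'}
    (M : MonomialModel φ Γ 𝒟 I) (M' : MonomialModel φ' Γ' 𝒟' I')
    (hD : IsCentralGradedDivision 𝒟) (hD' : IsCentralGradedDivision 𝒟')
    (h2 : ∀ k, 𝒟' k ≠ ⊥ → k + k = 0)
    (hΓ : IsFinePhiGrading φ Γ) (hΓ' : IsFinePhiGrading φ' Γ')
    {Φ : A ≃ₐ[F] A'} (hΦ : IsGradedIso Γ Γ' Φ)
    (hφ : ∀ g, ∀ x ∈ Γ' g, ∃ c : F, Φ (φ.app (Φ.symm x)) = c • φ'.app x) :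
    ∃ (ψ : D ≃ₐ[F] D') (σ : I ≃ I') (z : D), IsGradedIso 𝒟 𝒟' ψ ∧ z ≠ 0 ∧ (∃ k, z ∈ 𝒟 k) ∧
      (∀ a, σ (M.star a) = M'.star (σ a)) ∧
      ∀ a, M.star a = a → ∃ c : F, ψ (z * M.γ a) = c • M'.γ (σ a) := by
  have := hD.nontrivial
  have := hD'.nontrivial
  have hAb := hΓ.isPhiGrading.isAbGrading
  have hAb' := hΓ'.isPhiGrading.isAbGrading
  set Θ : Matrix I I D ≃ₐ[F] Matrix I' I' D' := M.θ.symm.trans (Φ.trans M'.θ) with hΘdef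
  have hΘapp : ∀ m, Θ m = M'.θ (Φ (M.θ.symm m)) := fun _ => rfl
  have hΘ : IsGradedIso (matGrade 𝒟 M.deg) (matGrade 𝒟' M'.deg) Θ :=
    (M.θ_symm_graded hD hAb).comp (hΦ.comp M'.θ_graded)
  obtain ⟨σ, hσ⟩ := exists_equiv_map_single_eq_single hD hD' hΘ
    (fun m hm a b hab => M.apply_eq_zero_of_mem_matGrade_zero hD hΓ hm hab)
    (fun m hm a b hab => M'.apply_eq_zero_of_mem_matGrade_zero hD' hΓ' hm hab)
  -- compatibility of `Θ` with the adjoints on homogeneous matrix units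
  have hhom : ∀ (k : K) (a b : I) (d : D), d ∈ 𝒟 k →
      ∃ k', Θ (Matrix.single a b d) (σ a) (σ b) ∈ 𝒟' k' := by
    intro k a b d hd
    by_cases hd0 : d = 0
    · exact ⟨0, by simp [hd0]⟩
    obtain ⟨k', hk'⟩ := hΘ.map_homogeneous (x := Matrix.single a b d)
      (by rwa [Ne, Matrix.single_eq_zero_iff])
      ⟨k + M.deg a - M.deg b, single_mem_matGrade (by convert hd using 2; abel)⟩
    exact ⟨_, hk' (σ a) (σ b)⟩
  have hadj : ∀ (k : K) (a b : I) (d : D), d ∈ 𝒟 k → ∃ c : F,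
      Θ (Matrix.single (M.star b) (M.star a) (M.γi b * M.τ.app d * M.γ a)) =
        c • Matrix.single (M'.star (σ b)) (M'.star (σ a))
          (M'.γi (σ b) * M'.τ.app (Θ (Matrix.single a b d) (σ a) (σ b)) * M'.γ (σ a)) := by
    intro k a b d hd
    obtain ⟨k', hk'⟩ := hhom k a b d hd
    obtain ⟨g, hg⟩ := M'.exists_comap_le hD' hAb' (k' + M'.deg (σ a) - M'.deg (σ b))
    have hmem : Φ (M.θ.symm (Matrix.single a b d)) ∈ Γ' g := by
      apply hg
      rw [Submodule.mem_comap, AlgEquiv.toLinearMap_apply, ← hΘapp, map_single_eq_single_of_diag hσ]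
      exact single_mem_matGrade (by convert hk' using 2; abel)
    obtain ⟨c, hc⟩ := hφ g _ hmem
    refine ⟨c, ?_⟩
    rw [← M.app_symm_single, ← M'.app_symm_single, ← map_single_eq_single_of_diag hσ, hΘapp,
      hΘapp, AlgEquiv.symm_apply_apply, AlgEquiv.symm_apply_apply, ← map_smul, ← hc,
      AlgEquiv.symm_apply_apply]
  -- Apply the compatibility to `E_aa`, which the adjoint sends to the idempotent at `star a`.
  have hstar : ∀ a, σ (M.star a) = M'.star (σ a) := by
    intro a
    obtain ⟨c, hc⟩ := hadj 0 a a 1 hD.isAbGrading.one_mem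
    rw [hσ, Matrix.single_apply_same, AntiAut.app_one, AntiAut.app_one, mul_one, mul_one,
      M.γi_mul_γ, M'.γi_mul_γ, hσ] at hc
    by_contra hne
    have := congrFun (congrFun hc (σ (M.star a))) (σ (M.star a))
    simp [Ne.symm hne] at this
  obtain ⟨o⟩ := ‹Nonempty I›
  have hx : ∀ a b : I, Θ (Matrix.single a b 1) (σ a) (σ b) *
      Θ (Matrix.single b a 1) (σ b) (σ a) = 1 := fun a b => by
    rw [map_single_mul_of_diag hσ, mul_one, hσ, Matrix.single_apply_same]
  set ψ := cornerEquiv hσ o with hψ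
  have hψg : IsGradedIso 𝒟 𝒟' ψ :=
    hD'.isGradedIso_of_maps (fun k x hx => hhom k o o x hx) hD
  set q := Θ (Matrix.single (M.star o) o 1) (σ (M.star o)) (σ o) with hq
  obtain ⟨kq, hkq⟩ := hhom 0 (M.star o) o 1 hD.isAbGrading.one_mem
  have hq0 : q ≠ 0 := fun h => by
    have := hx (M.star o) o
    rw [← hq, h, zero_mul] at this
    exact zero_ne_one this
  have hy0 : M'.γ (σ o) * q ≠ 0 := hD'.mul_ne_zero (M'.γ_mem (σ o)) (M'.γ_ne_zero hD' _) hq0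
  obtain ⟨l, hl⟩ := (hψg.symm_of hD.isAbGrading hD'.isAbGrading).map_homogeneous hy0
    ⟨_, hD'.isAbGrading.mul_mem (M'.γ_mem (σ o)) hkq⟩
  have hz : ψ.symm (M'.γ (σ o) * q) * M.γi o ≠ 0 := by
    refine hD.mul_ne_zero hl (by rwa [Ne, map_eq_zero_iff _ ψ.symm.injective]) fun h => ?_
    have := M.γ_mul_γi o
    rw [h, mul_zero] at this
    exact zero_ne_one this
  -- The factor `z` is the one solving the displayed relation for `ψ (z * γ a)`; it involves `o` but
  -- not `a`.
  refine ⟨ψ, σ, ψ.symm (M'.γ (σ o) * q) * M.γi o, hψg, hz,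
    ⟨_, hD.isAbGrading.mul_mem hl (M.γi_mem hD o)⟩, hstar, fun a ha => ?_⟩
  obtain ⟨c, hc⟩ := hadj 0 a o 1 hD.isAbGrading.one_mem
  obtain ⟨k', hk'⟩ := hhom 0 a o 1 hD.isAbGrading.one_mem
  rw [AntiAut.app_one, mul_one, ← hstar a, ← hstar o, ha] at hc
  have hc' := congrFun (congrFun hc (σ (M.star o))) (σ a)
  rw [Matrix.smul_apply, Matrix.single_apply_same] at hc'
  set x := Θ (Matrix.single a o 1) (σ a) (σ o) with hxdef
  set y := Θ (Matrix.single o a 1) (σ o) (σ a) with hydef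
  have hyx : y * x = 1 := hx o a
  -- the left-hand side is `q ψ(γi o γ a) y`
  have hL : Θ (Matrix.single (M.star o) a (M.γi o * M.γ a)) (σ (M.star o)) (σ a) =
      q * ψ (M.γi o * M.γ a) * y := by
    rw [hq, hψ, cornerEquiv_apply, hydef, map_single_mul_of_diag hσ, map_single_mul_of_diag hσ,
      one_mul, mul_one]
  obtain ⟨ε, -, hε⟩ := hD'.exists_antiAut_app M'.τ_graded hk'
  obtain ⟨m, hm⟩ := hD'.exists_mul_comm (M'.γ_mem (σ a)) hk'
  obtain ⟨w, hw⟩ := hD'.exists_mul_self h2 hk'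
  rw [hL, hε] at hc'
  refine ⟨c * ε * m * w, ?_⟩
  rw [mul_assoc, map_mul, AlgEquiv.apply_symm_apply]
  calc M'.γ (σ o) * q * ψ (M.γi o * M.γ a)
      = M'.γ (σ o) * (q * ψ (M.γi o * M.γ a) * y) * x := by
        simp only [mul_assoc, hyx, mul_one]
    _ = M'.γ (σ o) * (c • (M'.γi (σ o) * (ε • x) * M'.γ (σ a))) * x := by rw [hc']
    _ = (c * ε) • ((M'.γ (σ o) * M'.γi (σ o)) * x * (M'.γ (σ a) * x)) := by
        simp only [mul_smul_comm, smul_mul_assoc, smul_smul, mul_assoc]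
    _ = (c * ε * m) • ((x * x) * M'.γ (σ a)) := by
        rw [M'.γ_mul_γi, one_mul, hm, mul_smul_comm, smul_smul, ← mul_assoc x x]
    _ = (c * ε * m * w) • M'.γ (σ a) := by
        rw [hw, smul_mul_assoc, one_mul, smul_smul]

/-! ### Conjugation and transport of antiautomorphisms. -/

section Conjugation

variable {F A : Type*} [Field F] [Ring A] [Algebra F A]

/-- Conjugation by an invertible element. -/
def unitConj (F : Type*) [Field F] [Algebra F A] {u w : A} (h : u * w = 1) (h' : w * u = 1) :
    A ≃ₐ[F] A where
  toFun x := u * x * w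
  invFun x := w * x * u
  left_inv x := by
    dsimp only
    rw [← mul_assoc, ← mul_assoc, h', one_mul, mul_assoc, h', mul_one]
  right_inv x := by
    dsimp only
    rw [← mul_assoc, ← mul_assoc, h, one_mul, mul_assoc, h, mul_one]
  map_mul' x y := by
    calc u * (x * y) * w = u * x * 1 * y * w := by rw [mul_one, ← mul_assoc]
      _ = u * x * w * (u * y * w) := by simp only [← h', mul_assoc]
  map_add' x y := by rw [mul_add, add_mul]
  commutes' c := by rw [← Algebra.commutes c u, mul_assoc, h, mul_one]

@[simp] theorem unitConj_apply {u w : A} (h : u * w = 1) (h' : w * u = 1) (x : A) :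
    unitConj F h h' x = u * x * w := rfl

/-- The composition of two antiautomorphisms. -/
noncomputable def AntiAut.comp (τ τ' : AntiAut F A) : A ≃ₐ[F] A :=
  AlgEquiv.ofBijective
    (AlgHom.ofLinearMap (τ.linearMap ∘ₗ τ'.linearMap) (by simp) fun x y => by simp)
    ⟨τ.app_injective.comp τ'.app_injective, τ.app_surjective.comp τ'.app_surjective⟩

@[simp] theorem AntiAut.comp_apply (τ τ' : AntiAut F A) (x : A) :
    τ.comp τ' x = τ.app (τ'.app x) := rfl

/-- The antiautomorphism `ψ τ ψ⁻¹`. -/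
def AntiAut.transport {A' : Type*} [Ring A'] [Algebra F A'] (τ : AntiAut F A) (ψ : A ≃ₐ[F] A') :
    AntiAut F A' :=
  ψ.symm.trans (AlgEquiv.trans τ (AlgEquiv.op ψ))

@[simp] theorem AntiAut.transport_app {A' : Type*} [Ring A'] [Algebra F A'] (τ : AntiAut F A)
    (ψ : A ≃ₐ[F] A') (x : A') : (τ.transport ψ).app x = ψ (τ.app (ψ.symm x)) := rfl

theorem AntiAut.ext_app {τ τ' : AntiAut F A} (h : ∀ x, τ.app x = τ'.app x) : τ = τ' :=
  AlgEquiv.ext fun x => MulOpposite.unop_injective (h x)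

end Conjugation

/-! ### Diagonal automorphisms and fine gradings. -/

section PhiGrading

variable {F A A' G G' : Type*} [Field F] [Ring A] [Algebra F A] [Ring A'] [Algebra F A']

theorem Refines.mem_diagGroup {Γ : G → Submodule F A} {Γ' : G' → Submodule F A}
    (h : Refines Γ Γ') {Ψ : A ≃ₐ[F] A} (hΨ : Ψ ∈ diagGroup Γ') : Ψ ∈ diagGroup Γ := fun g => by
  obtain ⟨g', hg⟩ := h g
  obtain ⟨c, hc⟩ := hΨ g'
  exact ⟨c, fun x hx => hc x (hg hx)⟩

variable [AddCommGroup G] {φ : AntiAut F A} {Γ : G → Submodule F A}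

theorem IsPhiGrading.app_mem (h : IsPhiGrading φ Γ) {g : G} {x : A} (hx : x ∈ Γ g) :
    φ.app x ∈ Γ g := by
  have : φ.app x ∈ φ.app '' (Γ g : Set A) := ⟨x, hx, rfl⟩
  rwa [h.image_eq] at this

/-- The inclusion of `φ(Γ g)` in `Γ g` is enough: each `x` is the image of `α⁻¹ • φ(x)`. -/
theorem isPhiGrading_of_app_mem (hΓ : IsAbGrading Γ) (happ : ∀ g, ∀ x ∈ Γ g, φ.app x ∈ Γ g)
    (hsq : ∀ g, ∃ α : F, α ≠ 0 ∧ ∀ x ∈ Γ g, φ.app (φ.app x) = α • x)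
    (h0 : ∀ x ∈ Γ 0, φ.app (φ.app x) = x) : IsPhiGrading φ Γ := by
  refine ⟨hΓ, fun g => Set.Subset.antisymm ?_ fun x hx => ?_, hsq, h0⟩
  · rintro _ ⟨x, hx, rfl⟩
    exact happ g x hx
  · obtain ⟨α, hα, h⟩ := hsq g
    refine ⟨α⁻¹ • φ.app x, Submodule.smul_mem _ _ (happ g x hx), ?_⟩
    rw [AntiAut.app_smul, h x hx, smul_smul, inv_mul_cancel₀ hα, one_smul]

theorem IsPhiGrading.transport (h : IsPhiGrading φ Γ) (Φ : A ≃ₐ[F] A') :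
    IsPhiGrading (φ.transport Φ) fun g => (Γ g).comap Φ.symm.toLinearMap := by
  refine isPhiGrading_of_app_mem (h.isAbGrading.comap Φ.symm) (fun g x hx => ?_) (fun g => ?_)
    fun x hx => ?_
  · simpa using h.app_mem hx
  · obtain ⟨α, hα, hs⟩ := h.sq_scalar g
    refine ⟨α, hα, fun x hx => ?_⟩
    have h1 : φ.app (φ.app (Φ.symm x)) = α • Φ.symm x := hs _ hx
    simp [h1]
  · have h1 : φ.app (φ.app (Φ.symm x)) = Φ.symm x := h.sq_zero _ hx
    simp [h1]

/-- Where `Ψ` acts by `c`, the square of `Ψφ` is `c²` times that of `φ`. In degree `0` one has `c •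
1 = Ψ(1) = 1`, so the factor disappears. -/
theorem IsPhiGrading.leftComp (h : IsPhiGrading φ Γ) {Ψ : A ≃ₐ[F] A} (hΨ : Ψ ∈ diagGroup Γ) :
    IsPhiGrading (AntiAut.leftComp Ψ φ) Γ := by
  have hsq : ∀ g (c : F), (∀ x ∈ Γ g, Ψ x = c • x) → ∀ x ∈ Γ g,
      (AntiAut.leftComp Ψ φ).app ((AntiAut.leftComp Ψ φ).app x) =
        (c * c) • φ.app (φ.app x) := fun g c hc x hx => by
    rw [AntiAut.leftComp_app, AntiAut.leftComp_app, hc _ (h.app_mem hx), AntiAut.app_smul,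
      map_smul, hc _ (h.app_mem (h.app_mem hx)), smul_smul]
  refine isPhiGrading_of_app_mem h.isAbGrading (fun g x hx => ?_) (fun g => ?_) fun x hx => ?_
  · obtain ⟨c, hc⟩ := hΨ g
    rw [AntiAut.leftComp_app, hc _ (h.app_mem hx)]
    exact Submodule.smul_mem _ _ (h.app_mem hx)
  · obtain ⟨c, hc⟩ := hΨ g
    obtain ⟨α, hα, hs⟩ := h.sq_scalar g
    by_cases hc0 : c = 0
    · refine ⟨1, one_ne_zero, fun x hx => ?_⟩
      have : x = 0 := Ψ.injective (by rw [hc x hx, hc0, zero_smul, map_zero])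
      simp [this]
    · refine ⟨c * c * α, mul_ne_zero (mul_ne_zero hc0 hc0) hα, fun x hx => ?_⟩
      rw [hsq g c hc x hx, hs x hx, smul_smul]
  · obtain ⟨c, hc⟩ := hΨ 0
    rw [hsq 0 c hc x hx, h.sq_zero x hx]
    have h1 := hc 1 h.isAbGrading.one_mem
    rw [map_one] at h1
    rw [← one_mul x, ← smul_mul_assoc, mul_smul, ← h1, ← h1]

end PhiGrading

section Fine

variable {F A : Type u} {G : Type v} [Field F] [Ring A] [Algebra F A] [AddCommGroup G]
  {φ : AntiAut F A} {Γ : G → Submodule F A}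

theorem AntiAut.leftComp_inv_leftComp (Ψ : A ≃ₐ[F] A) (φ : AntiAut F A) :
    AntiAut.leftComp Ψ⁻¹ (AntiAut.leftComp Ψ φ) = φ :=
  AntiAut.ext_app fun x => by
    rw [AntiAut.leftComp_app, AntiAut.leftComp_app]
    exact Ψ.symm_apply_apply _

/-- A diagonal automorphism of `Γ` stays diagonal for every refinement of `Γ`. Composing with `Ψ⁻¹`
therefore turns a refining `Ψφ`-grading into a `φ`-grading, to which fineness applies. -/
theorem IsFinePhiGrading.leftComp (h : IsFinePhiGrading φ Γ) {Ψ : A ≃ₐ[F] A}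
    (hΨ : Ψ ∈ diagGroup Γ) : IsFinePhiGrading (AntiAut.leftComp Ψ φ) Γ := by
  refine ⟨h.isPhiGrading.leftComp hΨ, fun K _ Γ' hΓ' href => h.fine K Γ' ?_ href⟩
  have := hΓ'.leftComp (Subgroup.inv_mem _ (href.mem_diagGroup hΨ))
  rwa [AntiAut.leftComp_inv_leftComp] at this

end Fine

/-! ### Constructing graded isomorphisms from matching Gram entries. -/

namespace MonomialModel

section Rescale

variable {F A D K G I : Type*} [Field F] [Ring A] [Algebra F A]
  [Ring D] [Algebra F D] [AddCommGroup K] {φ : AntiAut F A} {Γ : G → Submodule F A}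
  {𝒟 : K → Submodule F D} [Fintype I] [DecidableEq I]

/-- The presentation obtained by multiplying the elements of the underlying basis by invertible
homogeneous elements of `D`. -/
def rescale (M : MonomialModel φ Γ 𝒟 I) (h𝒟 : IsAbGrading 𝒟) (y yi : I → D) (k : I → K)
    (hy : ∀ a, y a ∈ 𝒟 (k a)) (hyi : ∀ a, yi a ∈ 𝒟 (-k a)) (h1 : ∀ a, y a * yi a = 1)
    (h2 : ∀ a, yi a * y a = 1) : MonomialModel φ Γ 𝒟 I where
  τ := M.τ
  τ_graded := M.τ_graded
  star := M.star
  star_star := M.star_star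
  deg a := M.deg a + k a
  κ := M.κ
  -- The Gram entry of the new basis `v_a y_a`.
  γ a := M.τ.app (y a) * M.γ a * y (M.star a)
  γi a := yi (M.star a) * M.γi a * M.τ.app (yi a)
  γ_mul_γi a := by
    calc M.τ.app (y a) * M.γ a * y (M.star a) * (yi (M.star a) * M.γi a * M.τ.app (yi a))
        = M.τ.app (y a) * (M.γ a * (y (M.star a) * yi (M.star a)) * M.γi a) * M.τ.app (yi a) := by
          simp only [mul_assoc]
      _ = 1 := by rw [h1, mul_one, M.γ_mul_γi, mul_one, ← AntiAut.app_mul, h2, AntiAut.app_one]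
  γi_mul_γ a := by
    calc yi (M.star a) * M.γi a * M.τ.app (yi a) * (M.τ.app (y a) * M.γ a * y (M.star a))
        = yi (M.star a) * (M.γi a * (M.τ.app (yi a) * M.τ.app (y a)) * M.γ a) * y (M.star a) := by
          simp only [mul_assoc]
      _ = 1 := by
          rw [← AntiAut.app_mul, h1, AntiAut.app_one, mul_one, M.γi_mul_γ, mul_one, h2]
  γ_mem a := h𝒟.mul_mem_of_eq (h𝒟.mul_mem (M.τ_graded _ _ (hy a)) (M.γ_mem a)) (hy _) (by abel)
  θ := M.θ.trans (unitConj F (u := Matrix.diagonal yi) (w := Matrix.diagonal y)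
    (by simp [h2]) (by simp [h1]))
  θ_graded := by
    refine M.θ_graded.comp fun g _ => ⟨g, Submodule.ext fun m => ⟨?_, fun hm => ?_⟩⟩
    · rintro ⟨m, hm, rfl⟩ a b
      rw [AlgEquiv.toLinearMap_apply, unitConj_apply, Matrix.mul_diagonal, Matrix.diagonal_mul]
      exact h𝒟.mul_mem_of_eq (h𝒟.mul_mem (hyi a) (hm a b)) (hy b)
        (by dsimp only; abel)
    · refine ⟨Matrix.diagonal y * m * Matrix.diagonal yi, fun a b => ?_, ?_⟩
      · rw [Matrix.mul_diagonal, Matrix.diagonal_mul]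
        exact h𝒟.mul_mem_of_eq (h𝒟.mul_mem (hy a) (hm a b)) (hyi b)
          (by dsimp only; abel)
      · ext a b
        rw [AlgEquiv.toLinearMap_apply, unitConj_apply]
        simp only [Matrix.mul_diagonal, Matrix.diagonal_mul]
        rw [← mul_assoc, ← mul_assoc, h2, one_mul, mul_assoc, h2, mul_one]
  θ_app r a b := by
    simp only [AlgEquiv.trans_apply, unitConj_apply, Matrix.mul_diagonal, Matrix.diagonal_mul,
      M.θ_app, M.star_star, AntiAut.app_mul]
    have hc : ∀ c x, M.τ.app (yi c) * (M.τ.app (y c) * x) = x := fun c x => by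
      rw [← mul_assoc, ← AntiAut.app_mul, h1, AntiAut.app_one, one_mul]
    simp only [mul_assoc, hc]

end Rescale

section Isomorphism

variable {F A A' D D' : Type u} {G G' K K' : Type v}
    {I I' : Type} [Field F] [IsAlgClosed F] [Ring A] [Algebra F A] [Ring A'] [Algebra F A']
    [Ring D] [Algebra F D] [Ring D'] [Algebra F D'] [AddCommGroup K] [AddCommGroup K']
    [Fintype I] [DecidableEq I] [Fintype I'] [DecidableEq I']
    {φ : AntiAut F A} {Γ : G → Submodule F A} {𝒟 : K → Submodule F D}
    {φ' : AntiAut F A'} {Γ' : G' → Submodule F A'} {𝒟' : K' → Submodule F D'}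

/-- The nonzero entries of the elements of a component of the refined grading are all determined by
one of them. -/
theorem exists_refined_generator (M : MonomialModel φ Γ 𝒟 I) (hD : IsCentralGradedDivision 𝒟)
    (u : K × ULift.{v} (I → ℤ × ZMod 2)) (hu : M.refined u ≠ ⊥) :
    ∃ (a₀ b₀ : I) (d₀ : D), d₀ ∈ 𝒟 (u.1 - M.deg a₀ + M.deg b₀) ∧ d₀ ≠ 0 ∧
      ∀ x ∈ M.refined u, ∀ a b, M.θ x a b ≠ 0 →
        (a = b ∧ a₀ = b₀ ∧ ∃ c : F, M.θ x a b = c • d₀) ∨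
        (a = a₀ ∧ b = b₀ ∧ ∃ c : F, M.θ x a b = c • d₀) ∨
        (a = M.star b₀ ∧ b = M.star a₀ ∧
          ∃ c : F, M.θ x a b = c • (M.γi b₀ * M.τ.app d₀ * M.γ a₀)) := by
  obtain ⟨x₀, hx₀, hne⟩ := Submodule.exists_mem_ne_zero_of_ne_bot hu
  obtain ⟨a₀, b₀, h₀⟩ : ∃ a b, M.θ x₀ a b ≠ 0 := by
    by_contra! h
    exact hne (M.θ.injective (by rw [map_zero]; ext a b; exact h a b))
  obtain ⟨hd₀, hw₀⟩ := M.mem_refined.1 hx₀ a₀ b₀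
  refine ⟨a₀, b₀, _, hd₀, h₀, fun x hx a b hab => ?_⟩
  obtain ⟨hd, hw⟩ := M.mem_refined.1 hx a b
  rcases starWeight_sub_eq M.star_star ((hw₀ h₀).trans (hw hab).symm) with h | h | h
  · refine Or.inl ⟨h.2, h.1, hD.exists_smul_eq hd₀ ?_ h₀⟩
    rw [h.1, sub_add_cancel]
    rw [h.2, sub_add_cancel] at hd
    rwa [h.2]
  · refine Or.inr (Or.inl ⟨h.1, h.2, ?_⟩)
    rw [h.1, h.2] at hd ⊢
    exact hD.exists_smul_eq hd₀ hd h₀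
  · refine Or.inr (Or.inr ⟨h.1, h.2, ?_⟩)
    rw [h.1, h.2] at hd ⊢
    refine hD.exists_smul_eq (M.γi_mul_mul_γ_mem hD hd₀) hd ?_
    rw [mul_assoc]
    have hτ : M.τ.app (M.θ x₀ a₀ b₀) ≠ 0 := by simpa using h₀
    have := hD.nontrivial
    refine hD.mul_ne_zero (M.γi_mem hD b₀) (fun h0 => ?_)
      (hD.mul_ne_zero (M.τ_graded _ _ hd₀) hτ (M.γ_ne_zero hD a₀))
    have h1 := M.γ_mul_γi b₀
    rw [h0, mul_zero] at h1
    exact zero_ne_one h1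

variable [AddCommGroup G] [AddCommGroup G']

/-- Fineness reduces the claim to components of `refined`. The scalars of `Ψ` at `(a, b)` and `(star
b, star a)` must agree; `hXγ` makes the factors from `γ a` and the inverse of `γ b` compensate
exactly. -/
theorem mem_diagGroup_of_apply (M : MonomialModel φ Γ 𝒟 I) (hD : IsCentralGradedDivision 𝒟)
    (hΓ : IsFinePhiGrading φ Γ) {Ψ : A ≃ₐ[F] A} {X : D ≃ₐ[F] D} {ρ : I → F} (hρ : ∀ a, ρ a ≠ 0)
    (hΨ : ∀ x a b, M.θ (Ψ x) a b = (ρ a * (ρ b)⁻¹) • X (M.θ x a b))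
    (hX : ∀ k, ∀ d ∈ 𝒟 k, ∃ c : F, X d = c • d)
    (hXγ : ∀ a, X (M.γ a) = (ρ a * ρ (M.star a)) • M.γ a) : Ψ ∈ diagGroup Γ := by
  refine (M.refines_refined hD hΓ).mem_diagGroup fun u => ?_
  by_cases hu : M.refined u = ⊥
  · refine ⟨1, fun x hx => ?_⟩
    have : x = 0 := by simpa [hu] using hx
    simp [this]
  obtain ⟨a₀, b₀, d₀, hd₀, h₀, hgen⟩ := M.exists_refined_generator hD u hu
  obtain ⟨χ, hχ⟩ := hX _ _ hd₀
  have hXγi : ∀ a, X (M.γi a) = (ρ a * ρ (M.star a))⁻¹ • M.γi a := fun a => by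
    have hne : ρ a * ρ (M.star a) ≠ 0 := mul_ne_zero (hρ _) (hρ _)
    have h1 : (ρ a * ρ (M.star a)) • (X (M.γi a) * M.γ a) = 1 := by
      rw [← mul_smul_comm, ← hXγ, ← map_mul, M.γi_mul_γ, map_one]
    have h2 : X (M.γi a) * M.γ a = (ρ a * ρ (M.star a))⁻¹ • 1 := by
      rw [← h1, smul_smul, inv_mul_cancel₀ hne, one_smul]
    calc X (M.γi a) = X (M.γi a) * M.γ a * M.γi a := by rw [mul_assoc, M.γ_mul_γi, mul_one]
      _ = _ := by rw [h2, smul_mul_assoc, one_mul]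
  refine ⟨ρ a₀ * (ρ b₀)⁻¹ * χ, fun x hx => M.θ.injective ?_⟩
  ext a b
  rw [hΨ, map_smul, Matrix.smul_apply]
  by_cases hab : M.θ x a b = 0
  · simp [hab]
  rcases hgen x hx a b hab with ⟨h1, h2, c, hc⟩ | ⟨h1, h2, c, hc⟩ | ⟨h1, h2, c, hc⟩
  · rw [hc, map_smul, hχ, h1, h2, mul_inv_cancel₀ (hρ _), mul_inv_cancel₀ (hρ _), one_smul,
      one_mul, smul_comm]
  · rw [hc, map_smul, hχ, h1, h2, mul_smul _ χ, smul_comm c]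
  · obtain ⟨ε, -, hε⟩ := hD.exists_antiAut_app M.τ_graded hd₀
    rw [hc, hε, map_smul, map_mul, map_mul, map_smul, hχ, hXγ, hXγi, h1, h2]
    simp only [smul_mul_assoc, mul_smul_comm, smul_smul]
    congr 1
    have := hρ a₀
    have := hρ b₀
    have := hρ (M.star a₀)
    have := hρ (M.star b₀)
    field_simp

end Isomorphism

end MonomialModel

namespace MonomialModel

section Isomorphism

variable {F A A' D D' : Type u} {G G' K K' : Type v}
    {I I' : Type} [Field F] [IsAlgClosed F] [Ring A] [Algebra F A] [Ring A'] [Algebra F A']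
    [Ring D] [Algebra F D] [Ring D'] [Algebra F D'] [AddCommGroup K] [AddCommGroup K']
    [Fintype I] [DecidableEq I] [Fintype I'] [DecidableEq I']
    {φ : AntiAut F A} {Γ : G → Submodule F A} {𝒟 : K → Submodule F D}
    {φ' : AntiAut F A'} {Γ' : G' → Submodule F A'} {𝒟' : K' → Submodule F D'}
  [AddCommGroup G] [AddCommGroup G']

/-- `Φ` applies `ψ` entrywise and reindexes by `e`; `Ψ` applies `X` entrywise and conjugates by the
diagonal matrix of the `c a`. The normalization `hXγ` is used both for the intertwining relation and
for `Ψ` being diagonal. -/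
theorem exists_gradedIso_of_normalized (M : MonomialModel φ Γ 𝒟 I)
    (M' : MonomialModel φ' Γ' 𝒟' I') (hD : IsCentralGradedDivision 𝒟)
    (hD' : IsCentralGradedDivision 𝒟') (hΓ : IsFinePhiGrading φ Γ) (hΓ' : IsFinePhiGrading φ' Γ')
    {e : I ≃ I'} (he : ∀ a, e (M.star a) = M'.star (e a)) {ψ : D ≃ₐ[F] D'}
    (hψ : IsGradedIso 𝒟 𝒟' ψ) {z w : D'} (hzw : z * w = 1) (hwz : w * z = 1) {k : K'}
    (hz : z ∈ 𝒟' k) {X : D' ≃ₐ[F] D'} (hX : ∀ d, X (M'.τ.app (ψ d)) = z * ψ (M.τ.app d) * w)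
    (hXs : ∀ k, ∀ d ∈ 𝒟' k, ∃ c : F, X d = c • d) {c : I → F} (hc0 : ∀ a, c a ≠ 0)
    (hc : ∀ a, z * ψ (M.γ a) = c a • M'.γ (e a))
    (hXγ : ∀ a, X (M'.γ (e a)) = (c a * c (M.star a)) • M'.γ (e a)) :
    ∃ Φ : A ≃ₐ[F] A', IsGradedIso Γ Γ' Φ ∧
      ∃ Ψ ∈ diagGroup Γ', ∀ x, Φ (φ.app (Φ.symm x)) = Ψ (φ'.app x) := by
  have hAb := hΓ.isPhiGrading.isAbGrading
  have hAb' := hΓ'.isPhiGrading.isAbGrading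
  let Θ : Matrix I I D ≃ₐ[F] Matrix I' I' D' := ψ.mapMatrix.trans (Matrix.reindexAlgEquiv F D' e)
  have hΘ : ∀ m a b, Θ m (e a) (e b) = ψ (m a b) := fun m a b => by
    change ψ (m (e.symm (e a)) (e.symm (e b))) = _
    rw [e.symm_apply_apply, e.symm_apply_apply]
  let ρ : I' → F := fun a => c (e.symm a)
  have hρ : ∀ a, ρ (e a) = c a := fun a => congrArg c (e.symm_apply_apply a)
  have hρ0 : ∀ a, ρ a ≠ 0 := fun a => hc0 _
  have hdr : (Matrix.diagonal fun a => ρ a • (1 : D')) *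
      (Matrix.diagonal fun a => (ρ a)⁻¹ • (1 : D')) = 1 := by
    rw [Matrix.diagonal_mul_diagonal]
    simp [smul_smul, hρ0]
  have hdl : (Matrix.diagonal fun a => (ρ a)⁻¹ • (1 : D')) *
      (Matrix.diagonal fun a => ρ a • (1 : D')) = 1 := by
    rw [Matrix.diagonal_mul_diagonal]
    simp [smul_smul, hρ0]
  let Φ : A ≃ₐ[F] A' := M.θ.trans (Θ.trans M'.θ.symm)
  let Ψ : A' ≃ₐ[F] A' := M'.θ.trans ((X.mapMatrix.trans (unitConj F hdr hdl)).trans M'.θ.symm)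
  have hΨ : ∀ x a b, M'.θ (Ψ x) a b = (ρ a * (ρ b)⁻¹) • X (M'.θ x a b) := fun x a b => by
    simp only [Ψ, AlgEquiv.trans_apply, AlgEquiv.apply_symm_apply, unitConj_apply,
      Matrix.mul_diagonal, Matrix.diagonal_mul]
    rw [smul_one_mul, mul_smul_one, smul_smul, mul_comm]
    rfl
  have hΨd : Ψ ∈ diagGroup Γ' := by
    refine M'.mem_diagGroup_of_apply hD' hΓ' hρ0 hΨ hXs fun a => ?_
    obtain ⟨a, rfl⟩ := e.surjective a
    rw [hXγ, ← he, hρ, hρ]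
  have hcγ : ∀ a, ψ (M.γ a) = c a • (w * M'.γ (e a)) := fun a => by
    rw [← mul_smul_comm, ← hc, ← mul_assoc, hwz, one_mul]
  have hcγi : ∀ a, ψ (M.γi a) = (c a)⁻¹ • (M'.γi (e a) * z) := fun a => by
    have h1 : (c a)⁻¹ • (M'.γi (e a) * z) * ψ (M.γ a) = 1 := by
      rw [hcγ, smul_mul_smul_comm, inv_mul_cancel₀ (hc0 a), one_smul, mul_assoc,
        ← mul_assoc z, hzw, one_mul, M'.γi_mul_γ]
    calc ψ (M.γi a) = (c a)⁻¹ • (M'.γi (e a) * z) * ψ (M.γ a) * ψ (M.γi a) := by rw [h1, one_mul]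
      _ = _ := by rw [mul_assoc, ← map_mul, M.γ_mul_γi, map_one, mul_one]
  have hXγi : ∀ a, X (M'.γi (e a)) = (c a * c (M.star a))⁻¹ • M'.γi (e a) := fun a => by
    have hne : c a * c (M.star a) ≠ 0 := mul_ne_zero (hc0 _) (hc0 _)
    have h2 : X (M'.γi (e a)) * M'.γ (e a) = (c a * c (M.star a))⁻¹ • 1 := by
      rw [← map_one X, ← M'.γi_mul_γ (e a), map_mul, hXγ, mul_smul_comm, smul_smul,
        inv_mul_cancel₀ hne, one_smul]
    calc X (M'.γi (e a)) = X (M'.γi (e a)) * M'.γ (e a) * M'.γi (e a) := by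
          rw [mul_assoc, M'.γ_mul_γi, mul_one]
      _ = _ := by rw [h2, smul_mul_assoc, one_mul]
  have hΦ : ∀ x a b, M'.θ (Φ x) (e a) (e b) = ψ (M.θ x a b) := fun x a b => by
    have : M'.θ (Φ x) = Θ (M.θ x) := M'.θ.apply_symm_apply _
    rw [this, hΘ]
  have hΦs : ∀ x a b, M.θ (Φ.symm x) a b = ψ.symm (M'.θ x (e a) (e b)) := fun x a b => by
    have := hΦ (Φ.symm x) a b
    rw [Φ.apply_symm_apply] at this
    rw [this, ψ.symm_apply_apply]
  have hcompat : ∀ x, Φ (φ.app (Φ.symm x)) = Ψ (φ'.app x) := by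
    intro x
    apply M'.θ.injective
    ext a b
    obtain ⟨a, rfl⟩ := e.surjective a
    obtain ⟨b, rfl⟩ := e.surjective b
    rw [hΦ, M.θ_app, hΦs, hΨ, M'.θ_app, ← he, ← he]
    set t := M'.θ x (e (M.star b)) (e (M.star a)) with ht
    obtain ⟨d, hd⟩ := ψ.surjective t
    rw [← hd, ψ.symm_apply_apply, map_mul, map_mul, map_mul, map_mul, hX, hXγ, hXγi, hcγ, hcγi,
      M.star_star, M.star_star, hρ, hρ]
    simp only [smul_mul_assoc, mul_smul_comm, smul_smul, mul_assoc]
    congr 1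
    have := hc0 a
    have := hc0 b
    have := hc0 (M.star a)
    field_simp
  -- every component of the refined grading of `A` is mapped into a component of that of `A'`
  have hinto : ∀ u, ∃ u', ∀ x ∈ M.refined u, Φ x ∈ M'.refined u' := by
    intro u
    by_cases hu : M.refined u = ⊥
    · refine ⟨0, fun x hx => ?_⟩
      have : x = 0 := by simpa [hu] using hx
      simp [this]
    obtain ⟨a₀, b₀, d₀, hd₀, h₀, hgen⟩ := M.exists_refined_generator hD u hu
    obtain ⟨l, hl⟩ := hψ.map_homogeneous h₀ ⟨_, hd₀⟩
    refine ⟨(l + M'.deg (e a₀) - M'.deg (e b₀),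
      ULift.up (starWeight M'.star (e a₀) - starWeight M'.star (e b₀))), fun x hx => ?_⟩
    rw [mem_refined]
    intro a b
    obtain ⟨a, rfl⟩ := e.surjective a
    obtain ⟨b, rfl⟩ := e.surjective b
    rw [hΦ]
    have hl' : ψ d₀ ∈ 𝒟' (l + M'.deg (e a₀) - M'.deg (e b₀) - M'.deg (e a₀) + M'.deg (e b₀)) := by
      convert hl using 2
      abel
    by_cases hab : M.θ x a b = 0
    · simp [hab]
    rcases hgen x hx a b hab with ⟨h1, h2, r, hr⟩ | ⟨h1, h2, r, hr⟩ | ⟨h1, h2, r, hr⟩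
    · subst h1 h2
      refine ⟨?_, fun _ => by simp⟩
      rw [hr, map_smul]
      exact Submodule.smul_mem _ _ (by simpa using hl)
    · subst h1 h2
      refine ⟨?_, fun _ => rfl⟩
      rw [hr, map_smul]
      exact Submodule.smul_mem _ _ hl'
    · have hneg : ∀ c, starWeight M'.star (M'.star c) = -starWeight M'.star c := fun c =>
        (neg_eq_of_add_eq_zero_right (starWeight_add_star M'.star_star c)).symm
      refine ⟨?_, fun _ => ?_⟩
      · obtain ⟨ε, -, hε⟩ := hD.exists_antiAut_app M.τ_graded hd₀
        obtain ⟨ε', hε'0, hε'⟩ := hD'.exists_antiAut_app M'.τ_graded hl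
        obtain ⟨m, hm⟩ := hD'.exists_mul_comm hz hl
        have hval : ψ (M.θ x a b) = (r * ((c b₀)⁻¹ * ε * m * c a₀) * ε'⁻¹) •
            (M'.γi (e b₀) * M'.τ.app (ψ d₀) * M'.γ (e a₀)) := by
          rw [hr, hε, hε', map_smul, map_mul, map_mul, map_smul, hcγ, hcγi]
          simp only [smul_mul_assoc, mul_smul_comm, smul_smul]
          have h3 : M'.γi (e b₀) * z * ψ d₀ * (w * M'.γ (e a₀)) =
              m • (M'.γi (e b₀) * ψ d₀ * M'.γ (e a₀)) := by
            calc _ = M'.γi (e b₀) * (z * ψ d₀) * w * M'.γ (e a₀) := by simp only [mul_assoc]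
              _ = m • (M'.γi (e b₀) * ψ d₀ * (z * w) * M'.γ (e a₀)) := by
                rw [hm]
                simp only [mul_smul_comm, smul_mul_assoc, mul_assoc]
              _ = _ := by rw [hzw, mul_one]
          rw [h3, smul_smul]
          congr 1
          field_simp
        rw [hval, h1, h2, he, he]
        exact Submodule.smul_mem _ _ (M'.γi_mul_mul_γ_mem hD' hl')
      · rw [h1, h2, he, he, hneg, hneg]
        exact neg_sub_neg _ _
  -- Transporting `M.refined` by `Φ` gives a grading for `Ψφ'` that refines `M'.refined`. Hence
  -- `Ψ⁻¹` is diagonal on it, and it is a `φ'`-grading as well.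
  have hphi' : IsPhiGrading φ' fun u => (M.refined u).comap Φ.symm.toLinearMap := by
    have h1 := (M.isPhiGrading_refined hD).transport Φ
    have h2 : φ.transport Φ = AntiAut.leftComp Ψ φ' := AntiAut.ext_app fun x => hcompat x
    have href : Refines (fun u => (M.refined u).comap Φ.symm.toLinearMap) M'.refined := fun u => by
      obtain ⟨u', hu'⟩ := hinto u
      exact ⟨u', fun x hx => by simpa using hu' _ hx⟩
    rw [h2] at h1
    have h3 : Ψ⁻¹ ∈ diagGroup fun u => (M.refined u).comap Φ.symm.toLinearMap :=
      Subgroup.inv_mem _ (href.mem_diagGroup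
        ((M'.refined_refines hD' hAb').mem_diagGroup hΨd))
    have := h1.leftComp h3
    rwa [AntiAut.leftComp_inv_leftComp] at this
  -- Fineness of `Γ'` gives the converse refinement, so `Φ.symm` sends each component of `Γ'` into a
  -- single component of `Γ`; with `hinto` this yields equality of components.
  have hback := hΓ'.fine _ _ hphi' fun u => by
    obtain ⟨u', hu'⟩ := hinto u
    obtain ⟨g, hg⟩ := M'.refined_refines hD' hAb' u'
    exact ⟨g, fun x hx => hg (by simpa using hu' _ hx)⟩
  refine ⟨Φ, fun g hg => ?_, Ψ, hΨd, hcompat⟩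
  obtain ⟨x, hx, hx0⟩ := Submodule.exists_mem_ne_zero_of_ne_bot hg
  obtain ⟨u, hu⟩ := M.refines_refined hD hΓ g
  obtain ⟨u', hu'⟩ := hinto u
  obtain ⟨g', hg'⟩ := M'.refined_refines hD' hAb' u'
  obtain ⟨v, hv⟩ := hback g'
  obtain ⟨g₂, hg₂⟩ := M.refined_refines hD hAb v
  have hinv : ∀ y ∈ Γ' g', Φ.symm y ∈ Γ g₂ := fun y hy => hg₂ (hv hy)
  have hxg : x ∈ Γ g₂ := by
    have := hinv _ (hg' (hu' x (hu hx)))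
    rwa [Φ.symm_apply_apply] at this
  obtain rfl : g = g₂ := hAb.indep.eq_of_mem hx hxg hx0
  refine ⟨g', le_antisymm ?_ fun y hy => ⟨Φ.symm y, hinv y hy, by simp⟩⟩
  rintro _ ⟨y, hy, rfl⟩
  exact hg' (hu' y (hu hy))

end Isomorphism

end MonomialModel

namespace MonomialModel

variable {F A A' D D' : Type u} {G G' K K' : Type v}
    {I I' : Type} [Field F] [IsAlgClosed F] [Ring A] [Algebra F A] [Ring A'] [Algebra F A']
    [Ring D] [Algebra F D] [Ring D'] [Algebra F D'] [AddCommGroup K] [AddCommGroup K']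
    [Fintype I] [DecidableEq I] [Fintype I'] [DecidableEq I']
    {φ : AntiAut F A} {Γ : G → Submodule F A} {𝒟 : K → Submodule F D}
    {φ' : AntiAut F A'} {Γ' : G' → Submodule F A'} {𝒟' : K' → Submodule F D'}
  [AddCommGroup G] [AddCommGroup G']

/-- `X` compares the transported involution, twisted by `z`, with that of `D'`. It multiplies `γ' (e
a)` by some `χ a`, whereas the normalized statement requires `c a * c (star a)`; rescaling the
second basis by scalars repairs the discrepancy. -/
theorem exists_gradedIso (M : MonomialModel φ Γ 𝒟 I)
    (M' : MonomialModel φ' Γ' 𝒟' I') (hD : IsCentralGradedDivision 𝒟)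
    (hD' : IsCentralGradedDivision 𝒟') (hΓ : IsFinePhiGrading φ Γ) (hΓ' : IsFinePhiGrading φ' Γ')
    {e : I ≃ I'} (he : ∀ a, e (M.star a) = M'.star (e a)) {ψ : D ≃ₐ[F] D'}
    (hψ : IsGradedIso 𝒟 𝒟' ψ) {z w : D'} (hzw : z * w = 1) (hwz : w * z = 1) {k : K'}
    (hz : z ∈ 𝒟' k) (hc : ∀ a, ∃ c : F, z * ψ (M.γ a) = c • M'.γ (e a)) :
    ∃ Φ : A ≃ₐ[F] A', IsGradedIso Γ Γ' Φ ∧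
      ∃ Ψ ∈ diagGroup Γ', ∀ x, Φ (φ.app (Φ.symm x)) = Ψ (φ'.app x) := by
  choose c hc using hc
  have hc0 : ∀ a, c a ≠ 0 := fun a h => by
    have h1 := hc a
    rw [h, zero_smul] at h1
    have h2 : ψ (M.γ a) = 0 := by rw [← one_mul (ψ _), ← hwz, mul_assoc, h1, mul_zero]
    exact M.γ_ne_zero hD a (by simpa using h2)
  let X : D' ≃ₐ[F] D' := ((M.τ.transport ψ).comp M'.τ).trans (unitConj F hzw hwz)
  have hXapp : ∀ d, X d = z * ψ (M.τ.app (ψ.symm (M'.τ.app d))) * w := fun d => rfl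
  have hX : ∀ d, X (M'.τ.app (ψ d)) = z * ψ (M.τ.app d) * w := fun d => by
    rw [hXapp, hD'.antiAut_involutive M'.τ_graded, ψ.symm_apply_apply]
  have hψs := hψ.symm_of hD.isAbGrading hD'.isAbGrading
  have hXs : ∀ k, ∀ d ∈ 𝒟' k, ∃ c : F, X d = c • d := by
    intro l d hd
    by_cases hd0 : d = 0
    · exact ⟨0, by simp [hd0]⟩
    obtain ⟨ε, -, hε⟩ := hD'.exists_antiAut_app M'.τ_graded hd
    obtain ⟨l', hl'⟩ := hψs.map_homogeneous hd0 ⟨l, hd⟩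
    obtain ⟨ε', -, hε'⟩ := hD.exists_antiAut_app M.τ_graded hl'
    obtain ⟨m, hm⟩ := hD'.exists_mul_comm hz hd
    refine ⟨ε * ε' * m, ?_⟩
    rw [hXapp, hε, map_smul, AntiAut.app_smul, hε', map_smul, map_smul, ψ.apply_symm_apply,
      smul_smul, mul_smul_comm, hm, smul_smul, smul_mul_assoc, mul_assoc d,
      hzw, mul_one, mul_assoc]
  choose χ hχ using fun a => hXs _ _ (M'.γ_mem (e a))
  have hχ0 : ∀ a, χ a ≠ 0 := fun a h => by
    have h1 := hχ a
    rw [h, zero_smul] at h1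
    exact M'.γ_ne_zero hD' (e a) (by simpa using h1)
  have hχs : ∀ a, χ (M.star a) = χ a := fun a => by
    obtain ⟨m, hm⟩ := M'.exists_γ_star hD' (e a)
    have h1 := hχ (M.star a)
    rw [he] at h1
    refine smul_left_injective F (M'.γ_ne_zero hD' (M'.star (e a))) (h1.symm.trans ?_)
    simp only
    rw [hm, map_smul, hχ, smul_comm]
  -- Multiplying the vectors at `e a` and `e (star a)` by `l` divides each of `c a`, `c (star a)` by
  -- `l²`, hence their product by `l⁴`. Fixing one fourth root for every element of `F` ensures that
  -- `a` and `star a` receive the same `l`.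
  choose r hr using fun x : F => IsAlgClosed.exists_pow_nat_eq x (n := 4) (by norm_num)
  let l : I → F := fun a => r (c a * c (M.star a) * (χ a)⁻¹)
  have hl : ∀ a, l a ^ 4 = c a * c (M.star a) * (χ a)⁻¹ := fun a => hr _
  have hls : ∀ a, l (M.star a) = l a := fun a => by
    simp only [l]
    rw [M.star_star, hχs, mul_comm (c (M.star a))]
  have hl0 : ∀ a, l a ≠ 0 := fun a h => by
    have h1 := hl a
    rw [h, zero_pow (by norm_num)] at h1
    exact mul_ne_zero (mul_ne_zero (hc0 _) (hc0 _)) (inv_ne_zero (hχ0 a)) h1.symm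
  let M'' := M'.rescale hD'.isAbGrading (fun a => l (e.symm a) • 1)
    (fun a => (l (e.symm a))⁻¹ • 1) (fun _ => 0)
    (fun _ => Submodule.smul_mem _ _ hD'.isAbGrading.one_mem)
    (fun _ => Submodule.smul_mem _ _ (by simpa using hD'.isAbGrading.one_mem))
    (fun a => by simp [smul_smul, hl0]) (fun a => by simp [smul_smul, hl0])
  have hγ : ∀ a, M''.γ (e a) = (l a * l a) • M'.γ (e a) := fun a => by
    change M'.τ.app (l (e.symm (e a)) • 1) * M'.γ (e a) * (l (e.symm (M'.star (e a))) • 1) = _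
    rw [← he, e.symm_apply_apply, e.symm_apply_apply, hls, AntiAut.app_smul, AntiAut.app_one,
      smul_one_mul, mul_smul_one, smul_smul]
  refine M.exists_gradedIso_of_normalized M'' hD hD' hΓ hΓ' (e := e) he hψ hzw hwz hz hX hXs
    (c := fun a => c a * (l a * l a)⁻¹)
    (fun a => mul_ne_zero (hc0 a) (inv_ne_zero (mul_ne_zero (hl0 a) (hl0 a)))) (fun a => ?_)
    fun a => ?_
  · rw [hγ, hc, smul_smul, mul_assoc, inv_mul_cancel₀ (mul_ne_zero (hl0 a) (hl0 a)), mul_one]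
  · have h4 : c a * (l a * l a)⁻¹ * (c (M.star a) * (l (M.star a) * l (M.star a))⁻¹) = χ a := by
      have h1 := hl a
      have h2 := hl0 a
      have h3 := hχ0 a
      rw [hls]
      field_simp at h1 ⊢
      linear_combination -h1
    rw [hγ, map_smul, hχ, h4, smul_comm]

end MonomialModel

/-! ### Equivalence of pairs versus graded isomorphism. -/

namespace Realization

variable {F A A' : Type u} {G G' : Type v} [Field F] [IsAlgClosed F] [Ring A] [Algebra F A]
  [Ring A'] [Algebra F A'] [AddCommGroup G] [AddCommGroup G'] {φ : AntiAut F A}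
  {Γ : G → Submodule F A} {φ' : AntiAut F A'} {Γ' : G' → Submodule F A'} {P Q : DivPair.{u, v} F}

theorem equivalent_of_gradedIso [Nontrivial A] (Z : Realization φ Γ P) (Z' : Realization φ' Γ' Q)
    (hΓ : IsFinePhiGrading φ Γ) (hΓ' : IsFinePhiGrading φ' Γ') {Φ : A ≃ₐ[F] A'}
    (hΦ : IsGradedIso Γ Γ' Φ) {Ψ : A' ≃ₐ[F] A'} (hΨ : Ψ ∈ diagGroup Γ')
    (h : ∀ x, Φ (φ.app (Φ.symm x)) = Ψ (φ'.app x)) : P.Equivalent Q := by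
  have : Nonempty (Fin P.p ⊕ (Fin Z.s ⊕ Fin Z.s)) := by
    by_contra hne
    rw [not_nonempty_iff] at hne
    exact zero_ne_one (Z.model.θ.injective (Subsingleton.elim (Z.model.θ (0 : A)) (Z.model.θ 1)))
  obtain ⟨ψ, σ, z, hψ, hz0, hz, hstar, hγ⟩ := Z.model.exists_coordinate_equiv Z'.model
    P.isDivision Q.isDivision Q.two_elementary hΓ hΓ' hΦ fun g x hx => by
      obtain ⟨c, hc⟩ := hΨ g
      exact ⟨c, by rw [h, hc _ (hΓ'.isPhiGrading.app_mem hx)]⟩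
  -- The indices fixed by `pairStar` are exactly the `Sum.inl i`, so `σ` restricts to a bijection
  -- between them.
  have hfix : ∀ i : Fin P.p, ∃ j : Fin Q.p, σ (Sum.inl i) = Sum.inl j := fun i => by
    have h1 : σ (Sum.inl i) = pairStar (σ (Sum.inl i)) := hstar (Sum.inl i)
    rcases hi : σ (Sum.inl i) with j | j | j
    · exact ⟨j, rfl⟩
    · simp [hi] at h1
    · simp [hi] at h1
  choose π hπ using hfix
  have hπb : Function.Bijective π := by
    refine ⟨fun i j hij => ?_, fun j => ?_⟩
    · have : σ (Sum.inl i) = σ (Sum.inl j) := by rw [hπ, hπ, hij]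
      simpa using this
    · obtain ⟨a, ha⟩ := σ.surjective (Sum.inl j)
      have h1 : σ (pairStar a) = pairStar (σ a) := hstar a
      rw [ha, pairStar_inl, ← ha] at h1
      have h2 := σ.injective h1
      rcases a with i | i | i
      · refine ⟨i, ?_⟩
        rw [hπ] at ha
        simpa using ha
      · simp at h2
      · simp at h2
  refine ⟨ψ, Equiv.ofBijective π hπb, z, hψ, hz0, hz, fun i => ?_⟩
  obtain ⟨c, hc⟩ := hγ (Sum.inl i) rfl
  refine ⟨c, ?_⟩
  rw [hπ] at hc
  simpa [model, goodGram] using hc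

theorem gradedIso_of_equivalent {φ' : AntiAut F A} {Γ' : G' → Submodule F A}
    (Z : Realization φ Γ P) (Z' : Realization φ' Γ' Q)
    (hΓ : IsFinePhiGrading φ Γ) (hΓ' : IsFinePhiGrading φ' Γ') (h : P.Equivalent Q) :
    ∃ Φ : A ≃ₐ[F] A, IsGradedIso Γ Γ' Φ ∧
      ∃ Ψ ∈ diagGroup Γ', ∀ x, Φ (φ.app (Φ.symm x)) = Ψ (φ'.app x) := by
  have hD := P.isDivision
  have hD' := Q.isDivision
  obtain ⟨ψ, π, z, hψ, hz0, hz, hc⟩ := h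
  have hψz0 : ψ z ≠ 0 := by simpa using hz0
  obtain ⟨k, hk⟩ := hψ.map_homogeneous hz0 hz
  obtain ⟨w, hw, hzw, hwz⟩ := hD'.exists_inv hk hψz0
  have hp : P.p = Q.p := by simpa using Fintype.card_congr π
  -- Both matrix algebras are isomorphic to `A`, and `D`, `D'` have equal dimension.
  have hs : Z.s = Z'.s := by
    have := hD.nontrivial
    have := hD.finiteDimensional
    have h1 := Z.model.θ.toLinearEquiv.finrank_eq
    rw [Z'.model.θ.toLinearEquiv.finrank_eq, Module.finrank_matrix, Module.finrank_matrix,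
      ψ.toLinearEquiv.finrank_eq] at h1
    have hpos : 0 < Module.finrank F Q.D := by
      rw [← ψ.toLinearEquiv.finrank_eq]
      exact Module.finrank_pos
    have h2 := Nat.eq_of_mul_eq_mul_right hpos h1
    rw [Nat.mul_self_inj] at h2
    simp only [Fintype.card_sum, Fintype.card_fin] at h2
    omega
  let e : Fin P.p ⊕ (Fin Z.s ⊕ Fin Z.s) ≃ Fin Q.p ⊕ (Fin Z'.s ⊕ Fin Z'.s) :=
    Equiv.sumCongr π (Equiv.sumCongr (finCongr hs) (finCongr hs))
  -- On a hyperbolic pair the Gram entries are scalars, which the factor `ψ z` would move to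
  -- multiples of `ψ z`. Multiplying the second vector of each pair of `Z'` by `ψ z` makes its Gram
  -- entries multiples of `ψ z` too.
  let M' := Z'.model.rescale hD'.isAbGrading (Sum.elim 1 (Sum.elim 1 fun _ => ψ z))
    (Sum.elim 1 (Sum.elim 1 fun _ => w)) (Sum.elim 0 (Sum.elim 0 fun _ => k))
    (by rintro (i | j | j) <;> simp [hk, hD'.isAbGrading.one_mem])
    (by rintro (i | j | j) <;> simp [hw, hD'.isAbGrading.one_mem])
    (by rintro (i | j | j) <;> simp [hzw])
    (by rintro (i | j | j) <;> simp [hwz])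
  refine Z.model.exists_gradedIso M' hD hD' hΓ hΓ' (e := e) ?_ hψ hzw hwz hk ?_
  · rintro (i | j | j) <;> rfl
  · rintro (i | j | j)
    · obtain ⟨c, hc⟩ := hc i
      refine ⟨c, ?_⟩
      have h1 : M'.γ (e (Sum.inl i)) = Q.d (π i) := by
        change Z'.τ.app 1 * goodGram Q.d Z'.ν (Sum.inl (π i)) (Sum.inl (π i)) * 1 = _
        simp [goodGram]
      rw [h1, ← hc, map_mul]
      simp [model, goodGram]
    · have h1 : M'.γ (e (Sum.inr (Sum.inl j))) = Z'.ν (finCongr hs j) • ψ z := by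
        change Z'.τ.app 1 * goodGram Q.d Z'.ν (Sum.inr (Sum.inl (finCongr hs j)))
          (Sum.inr (Sum.inr (finCongr hs j))) * ψ z = _
        simp [goodGram, Algebra.smul_def]
      have h2 : ψ (Z.model.γ (Sum.inr (Sum.inl j))) = Z.ν j • 1 := by
        simp [model, goodGram, Algebra.algebraMap_eq_smul_one]
      refine ⟨Z.ν j * (Z'.ν (finCongr hs j))⁻¹, ?_⟩
      rw [h1, h2, mul_smul_one, smul_smul, inv_mul_cancel_right₀ (Z'.ν_ne_zero _)]
    · obtain ⟨ε, hε0, hε⟩ := hD'.exists_antiAut_app Z'.τ_graded hk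
      have h1 : M'.γ (e (Sum.inr (Sum.inr j))) = ((Z'.ν (finCongr hs j))⁻¹ * ε) • ψ z := by
        change Z'.τ.app (ψ z) * goodGram Q.d Z'.ν (Sum.inr (Sum.inr (finCongr hs j)))
          (Sum.inr (Sum.inl (finCongr hs j))) * 1 = _
        rw [hε, mul_one, mul_smul]
        simp [goodGram, Algebra.algebraMap_eq_smul_one, -map_inv₀]
      have h2 : ψ (Z.model.γ (Sum.inr (Sum.inr j))) = (Z.ν j)⁻¹ • 1 := by
        simp [model, goodGram, Algebra.algebraMap_eq_smul_one, -map_inv₀]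
      refine ⟨(Z.ν j)⁻¹ * ((Z'.ν (finCongr hs j))⁻¹ * ε)⁻¹, ?_⟩
      rw [h1, h2, mul_smul_one, smul_smul, inv_mul_cancel_right₀
        (mul_ne_zero (inv_ne_zero (Z'.ν_ne_zero _)) hε0)]

end Realization

/-! ### Existence of good bases. -/

section GoodSystem

variable {F D V K : Type*} [Field F] [Ring D] [Algebra F D] [AddCommGroup V]
  [Module F V]

/-- A family of homogeneous vectors whose Gram matrix is that of a good basis. -/
structure IsGoodSystem (𝒱 : K → Submodule F V) (B : V →ₗ[F] V →ₗ[F] D) {p s : ℕ} (d : Fin p → D)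
    (ν : Fin s → F) (v : Fin p ⊕ (Fin s ⊕ Fin s) → V) : Prop where
  homogeneous : ∀ a, ∃ k, v a ∈ 𝒱 k
  d_sq : ∀ i, d i * d i = 1
  ν_ne_zero : ∀ j, ν j ≠ 0
  gram : ∀ a b, B (v a) (v b) = goodGram d ν a b

variable {𝒱 : K → Submodule F V} {B : V →ₗ[F] V →ₗ[F] D} {p s : ℕ} {d : Fin p → D}
  {ν : Fin s → F} {v : Fin p ⊕ (Fin s ⊕ Fin s) → V}

namespace IsGoodSystem

theorem cons_anisotropic (h : IsGoodSystem 𝒱 B d ν v) {x : V} {k : K} (hx : x ∈ 𝒱 k)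
    (hl : ∀ a, B (v a) x = 0) (hr : ∀ a, B x (v a) = 0) (hsq : B x x * B x x = 1) :
    IsGoodSystem 𝒱 B (Fin.cons (B x x) d : Fin (p + 1) → D) ν
      (Sum.elim (Fin.cons x fun i => v (Sum.inl i)) fun j => v (Sum.inr j)) where
  homogeneous := by
    rintro (i | j)
    · refine Fin.cases ⟨k, hx⟩ (fun i => ?_) i
      simpa using h.homogeneous (Sum.inl i)
    · exact h.homogeneous _
  d_sq := Fin.cases (by simpa using hsq) fun i => by simpa using h.d_sq i
  ν_ne_zero := h.ν_ne_zero
  gram := by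
    rintro (i | j) (i' | j')
    · refine Fin.cases ?_ (fun i => ?_) i <;> refine Fin.cases ?_ (fun i' => ?_) i'
      · simp [goodGram]
      · simp [goodGram, hr, (Fin.succ_ne_zero _).symm]
      · simp [goodGram, hl]
      · simpa [goodGram] using h.gram (Sum.inl i) (Sum.inl i')
    · refine Fin.cases ?_ (fun i => ?_) i
      · rcases j' with j' | j' <;> simp [goodGram, hr]
      · have := h.gram (Sum.inl i) (Sum.inr j')
        rcases j' with j' | j' <;> simpa [goodGram] using this
    · refine Fin.cases ?_ (fun i' => ?_) i'
      · rcases j with j | j <;> simp [goodGram, hl]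
      · have := h.gram (Sum.inr j) (Sum.inl i')
        rcases j with j | j <;> simpa [goodGram] using this
    · have := h.gram (Sum.inr j) (Sum.inr j')
      rcases j with j | j <;> rcases j' with j' | j' <;> simpa [goodGram] using this

theorem cons_hyperbolic (h : IsGoodSystem 𝒱 B d ν v) {x y : V} {k l : K} (hx : x ∈ 𝒱 k)
    (hy : y ∈ 𝒱 l) (hlx : ∀ a, B (v a) x = 0) (hrx : ∀ a, B x (v a) = 0)
    (hly : ∀ a, B (v a) y = 0) (hry : ∀ a, B y (v a) = 0) (hxx : B x x = 0) (hyy : B y y = 0)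
    {c : F} (hc : c ≠ 0) (hxy : B x y = algebraMap F D c) (hyx : B y x = algebraMap F D c⁻¹) :
    IsGoodSystem 𝒱 B d (Fin.cons c ν : Fin (s + 1) → F)
      (Sum.elim (fun i => v (Sum.inl i)) (Sum.elim (Fin.cons x fun j => v (Sum.inr (Sum.inl j)))
        (Fin.cons y fun j => v (Sum.inr (Sum.inr j))))) where
  homogeneous := by
    rintro (i | j | j)
    · exact h.homogeneous _
    · refine Fin.cases ⟨k, hx⟩ (fun j => ?_) j
      simpa using h.homogeneous (Sum.inr (Sum.inl j))
    · refine Fin.cases ⟨l, hy⟩ (fun j => ?_) j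
      simpa using h.homogeneous (Sum.inr (Sum.inr j))
  d_sq := h.d_sq
  ν_ne_zero := Fin.cases (by simpa using hc) fun j => by simpa using h.ν_ne_zero j
  gram := by
    rintro (i | j | j) (i' | j' | j')
    · exact h.gram (Sum.inl i) (Sum.inl i')
    · refine Fin.cases ?_ (fun j' => ?_) j'
      · simp [goodGram, hlx]
      · simpa [goodGram] using h.gram (Sum.inl i) (Sum.inr (Sum.inl j'))
    · refine Fin.cases ?_ (fun j' => ?_) j'
      · simp [goodGram, hly]
      · simpa [goodGram] using h.gram (Sum.inl i) (Sum.inr (Sum.inr j'))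
    · refine Fin.cases ?_ (fun j => ?_) j
      · simp [goodGram, hrx]
      · simpa [goodGram] using h.gram (Sum.inr (Sum.inl j)) (Sum.inl i')
    · refine Fin.cases ?_ (fun j => ?_) j <;> refine Fin.cases ?_ (fun j' => ?_) j'
      · simp [goodGram, hxx]
      · simp [goodGram, hrx]
      · simp [goodGram, hlx]
      · simpa [goodGram] using h.gram (Sum.inr (Sum.inl j)) (Sum.inr (Sum.inl j'))
    · refine Fin.cases ?_ (fun j => ?_) j <;> refine Fin.cases ?_ (fun j' => ?_) j'
      · simp [goodGram, hxy]
      · simp [goodGram, hrx, (Fin.succ_ne_zero _).symm]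
      · simp [goodGram, hly]
      · simpa [goodGram] using h.gram (Sum.inr (Sum.inl j)) (Sum.inr (Sum.inr j'))
    · refine Fin.cases ?_ (fun j => ?_) j
      · simp [goodGram, hry]
      · simpa [goodGram] using h.gram (Sum.inr (Sum.inr j)) (Sum.inl i')
    · refine Fin.cases ?_ (fun j => ?_) j <;> refine Fin.cases ?_ (fun j' => ?_) j'
      · simpa [goodGram] using hyx
      · simp [goodGram, hry, (Fin.succ_ne_zero _).symm]
      · simp [goodGram, hlx]
      · simpa [goodGram] using h.gram (Sum.inr (Sum.inr j)) (Sum.inr (Sum.inl j'))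
    · refine Fin.cases ?_ (fun j => ?_) j <;> refine Fin.cases ?_ (fun j' => ?_) j'
      · simp [goodGram, hyy]
      · simp [goodGram, hry]
      · simp [goodGram, hly]
      · simpa [goodGram] using h.gram (Sum.inr (Sum.inr j)) (Sum.inr (Sum.inr j'))

section

variable [Module Dᵐᵒᵖ V] (hBr : ∀ x y (d : D), B x (MulOpposite.op d • y) = B x y * d)
include hBr

theorem linearIndependent (h : IsGoodSystem 𝒱 B d ν v) : LinearIndependent Dᵐᵒᵖ v := by
  rw [Fintype.linearIndependent_iff]
  intro g hg a
  have h1 : B (v (pairStar a)) (∑ b, g b • v b) =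
      goodGram d ν (pairStar a) (pairStar (pairStar a)) * (g a).unop := by
    rw [map_sum, Finset.sum_eq_single a]
    · rw [← MulOpposite.op_unop (g a), hBr, h.gram, pairStar_pairStar]
      rfl
    · intro b _ hb
      rw [← MulOpposite.op_unop (g b), hBr, h.gram, goodGram_eq, pairStar_pairStar, if_neg hb,
        zero_mul]
    · simp
  rw [hg, map_zero] at h1
  have h2 := goodGramInv_mul_goodGram h.d_sq h.ν_ne_zero (pairStar a)
  have h3 : (g a).unop = 0 := by
    rw [← one_mul (g a).unop, ← h2, mul_assoc, ← h1, mul_zero]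
  exact MulOpposite.unop_injective h3

theorem card_le_finrank [Nontrivial D] [FiniteDimensional F V] [IsScalarTower F Dᵐᵒᵖ V]
    (h : IsGoodSystem 𝒱 B d ν v) : p + 2 * s ≤ Module.finrank F V := by
  have h1 : LinearIndependent F v := by
    refine (h.linearIndependent hBr).restrict_scalars fun x y hxy => ?_
    exact smul_left_injective F (one_ne_zero (α := Dᵐᵒᵖ)) hxy
  have h2 := h1.fintype_card_le_finrank
  simp only [Fintype.card_sum, Fintype.card_fin] at h2
  omega

/-- Orthogonal projection: the component of `y` along `v (pairStar a)` is recovered by pairing with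
`v a`, since only that vector pairs nontrivially with `v a`. All corrections have the degree of `y`.
-/
theorem exists_orthogonal [AddCommGroup K] {𝒟 : K → Submodule F D} (hD : IsCentralGradedDivision 𝒟)
    (hsmul : ∀ j k, ∀ x ∈ 𝒱 j, ∀ d ∈ 𝒟 k, MulOpposite.op d • x ∈ 𝒱 (j + k)) {degB : K}
    (hB : ∀ j k, ∀ x ∈ 𝒱 j, ∀ y ∈ 𝒱 k, B x y ∈ 𝒟 (j + k + degB))
    (h : IsGoodSystem 𝒱 B d ν v) {j : K} {y : V} (hy : y ∈ 𝒱 j) :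
    ∃ y' ∈ 𝒱 j, (∀ a, B (v a) y' = 0) ∧ y - y' ∈ Submodule.span Dᵐᵒᵖ (Set.range v) := by
  have := hD.nontrivial
  choose deg hdeg using h.homogeneous
  refine ⟨y - ∑ a, MulOpposite.op (goodGramInv d ν a * B (v a) y) • v (pairStar a),
    Submodule.sub_mem _ hy (Submodule.sum_mem _ fun a _ => ?_), fun c => ?_, ?_⟩
  · have hg := hB _ _ _ (hdeg a) _ (hdeg (pairStar a))
    rw [h.gram] at hg
    have h1 := goodGram_mul_goodGramInv h.d_sq h.ν_ne_zero a
    have h2 := goodGramInv_mul_goodGram h.d_sq h.ν_ne_zero a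
    obtain ⟨w, hw, hgw, -⟩ := hD.exists_inv hg (fun h0 => by
      rw [h0, zero_mul] at h1
      exact zero_ne_one h1)
    have hw' : goodGramInv d ν a = w := by
      rw [← mul_one (goodGramInv d ν a), ← hgw, ← mul_assoc, h2, one_mul]
    rw [hw']
    have h3 := hsmul _ _ _ (hdeg (pairStar a)) _
      (hD.isAbGrading.mul_mem hw (hB _ _ _ (hdeg a) _ hy))
    convert h3 using 2
    abel
  · rw [map_sub, map_sum, Finset.sum_eq_single c]
    · rw [hBr, h.gram, ← mul_assoc, goodGram_mul_goodGramInv h.d_sq h.ν_ne_zero, one_mul, sub_self]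
    · intro b _ hb
      rw [hBr, h.gram, goodGram_eq, if_neg, zero_mul]
      intro hb'
      exact hb (by rw [← pairStar_pairStar b, hb', pairStar_pairStar])
    · simp
  · rw [sub_sub_cancel]
    exact Submodule.sum_mem _ fun a _ => Submodule.smul_mem _ _ (Submodule.subset_span ⟨_, rfl⟩)

end

end IsGoodSystem

/-- Take a good system with the most vectors; linear independence bounds their number. If it did not
span, maximality would make every homogeneous vector orthogonal to it isotropic, and nondegeneracy
would then produce a further hyperbolic pair. -/
theorem exists_isGoodSystem_span_eq_top [IsAlgClosed F] [FiniteDimensional F V]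
    [Module Dᵐᵒᵖ V] [IsScalarTower F Dᵐᵒᵖ V] [AddCommGroup K]
    {𝒟 : K → Submodule F D} (hD : IsCentralGradedDivision 𝒟)
    (h2 : ∀ k, 𝒟 k ≠ ⊥ → k + k = 0) (htop : ⨆ k, 𝒱 k = ⊤)
    (hsmul : ∀ j k, ∀ x ∈ 𝒱 j, ∀ d ∈ 𝒟 k, MulOpposite.op d • x ∈ 𝒱 (j + k)) {degB : K}
    (hB : ∀ j k, ∀ x ∈ 𝒱 j, ∀ y ∈ 𝒱 k, B x y ∈ 𝒟 (j + k + degB))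
    (hBr : ∀ x y (d : D), B x (MulOpposite.op d • y) = B x y * d)
    (hnd : ∀ x, (∀ y, B x y = 0) → x = 0)
    (hbal : ∀ j k, ∀ x ∈ 𝒱 j, ∀ y ∈ 𝒱 k, B x y = 0 ↔ B y x = 0) :
    ∃ (p s : ℕ) (d : Fin p → D) (ν : Fin s → F) (v : Fin p ⊕ (Fin s ⊕ Fin s) → V),
      IsGoodSystem 𝒱 B d ν v ∧ Submodule.span Dᵐᵒᵖ (Set.range v) = ⊤ := by
  have := hD.nontrivial
  let S : Set ℕ := {n | ∃ (p s : ℕ) (d : Fin p → D) (ν : Fin s → F)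
    (v : Fin p ⊕ (Fin s ⊕ Fin s) → V), IsGoodSystem 𝒱 B d ν v ∧ p + 2 * s = n}
  have hbdd : BddAbove S := by
    refine ⟨Module.finrank F V, ?_⟩
    rintro _ ⟨p, s, d, ν, v, h, rfl⟩
    exact h.card_le_finrank hBr
  have hne : S.Nonempty := by
    refine ⟨0, 0, 0, Fin.elim0, Fin.elim0, Sum.elim Fin.elim0 (Sum.elim Fin.elim0 Fin.elim0),
      ⟨?_, fun i => i.elim0, fun i => i.elim0, ?_⟩, rfl⟩
    · rintro (i | i | i) <;> exact i.elim0
    · rintro (i | i | i) <;> exact i.elim0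
  obtain ⟨p, s, d, ν, v, h, hn⟩ := Nat.sSup_mem hne hbdd
  refine ⟨p, s, d, ν, v, h, ?_⟩
  by_contra hspan
  have hmax : ∀ {p' s' : ℕ} {d' : Fin p' → D} {ν' : Fin s' → F}
      {v' : Fin p' ⊕ (Fin s' ⊕ Fin s') → V}, IsGoodSystem 𝒱 B d' ν' v' →
      p' + 2 * s' ≤ p + 2 * s := fun {p' s' d' ν' v'} h' => by
    rw [hn]
    exact le_csSup hbdd ⟨p', s', d', ν', v', h', rfl⟩
  have hW : ∀ {k : K} {x : V}, x ∈ 𝒱 k → (∀ a, B (v a) x = 0) → ∀ a, B x (v a) = 0 :=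
    fun {k x} hx hl a => by
      obtain ⟨l, hl'⟩ := h.homogeneous a
      exact (hbal _ _ _ hl' _ hx).1 (hl a)
  -- every homogeneous vector orthogonal to the system is isotropic
  have hiso : ∀ {k : K} {x : V}, x ∈ 𝒱 k → (∀ a, B (v a) x = 0) → B x x = 0 := by
    intro k x hx hl
    by_contra hxx
    have hdeg := hB _ _ _ hx _ hx
    obtain ⟨c, hc⟩ := hD.exists_mul_self h2 hdeg
    have hc0 : c ≠ 0 := by
      rintro rfl
      rw [zero_smul] at hc
      exact hD.mul_ne_zero hdeg hxx hxx hc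
    -- `B (l • x) (l • x)` squares to `l⁴ c`, whence a fourth root.
    obtain ⟨l, hl4⟩ := IsAlgClosed.exists_pow_nat_eq c⁻¹ (n := 4) (by norm_num)
    have h1 := h.cons_anisotropic (x := l • x) (Submodule.smul_mem _ _ hx)
      (fun a => by rw [map_smul, hl, smul_zero])
      (fun a => by rw [map_smul, LinearMap.smul_apply, hW hx hl, smul_zero]) (by
        simp only [map_smul, LinearMap.smul_apply, smul_smul, smul_mul_smul_comm, hc]
        rw [show l * l * (l * l) * c = l ^ 4 * c by ring, hl4, inv_mul_cancel₀ hc0, one_smul])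
    have := hmax h1
    omega
  obtain ⟨k, y, hy, hys⟩ : ∃ k, ∃ y ∈ 𝒱 k, y ∉ Submodule.span Dᵐᵒᵖ (Set.range v) := by
    by_contra! hcon
    apply hspan
    have : (⊤ : Submodule F V) ≤ (Submodule.span Dᵐᵒᵖ (Set.range v)).restrictScalars F := by
      rw [← htop]
      exact iSup_le fun k y hy => hcon k y hy
    exact eq_top_iff.2 fun y _ => this (x := y) trivial
  obtain ⟨x, hx, hxl, hyx⟩ := h.exists_orthogonal hBr hD hsmul hB hy
  have hx0 : x ≠ 0 := by
    rintro rfl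
    exact hys (by simpa using hyx)
  have hxr := hW hx hxl
  obtain ⟨t, ht⟩ : ∃ t, B x t ≠ 0 := by
    by_contra! hcon
    exact hx0 (hnd x hcon)
  obtain ⟨l, t, htl, ht⟩ := exists_homogeneous_ne_zero htop (B x) ht
  obtain ⟨t', ht'l, ht'v, htt'⟩ := h.exists_orthogonal hBr hD hsmul hB htl
  have hxt' : B x t' ≠ 0 := by
    have h0 : ∀ z ∈ Submodule.span Dᵐᵒᵖ (Set.range v), B x z = 0 := by
      intro z hz
      induction hz using Submodule.span_induction with
      | mem z hz =>
        obtain ⟨a, rfl⟩ := hz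
        exact hxr a
      | zero => rw [map_zero]
      | add z w _ _ hz hw => rw [map_add, hz, hw, add_zero]
      | smul r z _ hz => rw [← MulOpposite.op_unop r, hBr, hz, zero_mul]
    have := h0 _ htt'
    rw [map_sub, sub_eq_zero] at this
    rwa [← this]
  obtain ⟨w, hw, hmw, -⟩ := hD.exists_inv (hB _ _ _ hx _ ht'l) hxt'
  have hzl := hsmul _ _ _ ht'l _ hw
  set z := MulOpposite.op w • t' with hz
  have hxz : B x z = 1 := by rw [hz, hBr, hmw]
  have hzv : ∀ a, B (v a) z = 0 := fun a => by rw [hz, hBr, ht'v, zero_mul]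
  have h10 := hB _ _ _ hx _ hzl
  rw [hxz] at h10
  -- Since `B x z = 1` has degree `0`, so has `B z x`, which is therefore a scalar `μ`, nonzero by
  -- balance.
  have hdeg := hD.isAbGrading.indep.eq_of_mem h10 hD.isAbGrading.one_mem one_ne_zero
  have hzx := hB _ _ _ hzl _ hx
  rw [add_comm _ k, hdeg] at hzx
  obtain ⟨μ, hμ⟩ := hD.exists_eq_smul_one hzx
  have hμ0 : μ ≠ 0 := by
    rintro rfl
    rw [zero_smul] at hμ
    rw [(hbal _ _ _ hzl _ hx).1 hμ] at hxz
    exact zero_ne_one hxz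
  -- The pair `c • x`, `z` has values `c` and `c μ`; these are mutually inverse exactly when `c² =
  -- μ⁻¹`.
  obtain ⟨c, hc⟩ := IsAlgClosed.exists_pow_nat_eq μ⁻¹ (n := 2) (by norm_num)
  have hc0 : c ≠ 0 := by
    rintro rfl
    rw [zero_pow (by norm_num)] at hc
    exact inv_ne_zero hμ0 hc.symm
  have h1 := h.cons_hyperbolic (x := c • x) (y := z) (c := c) (Submodule.smul_mem _ _ hx) hzl
    (fun a => by rw [map_smul, hxl, smul_zero])
    (fun a => by rw [map_smul, LinearMap.smul_apply, hxr, smul_zero]) hzv (hW hzl hzv)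
    (by rw [map_smul, map_smul, LinearMap.smul_apply, hiso hx hxl, smul_zero, smul_zero])
    (hiso hzl hzv) hc0
    (by rw [B.map_smul c x, LinearMap.smul_apply, hxz, Algebra.algebraMap_eq_smul_one])
    (by
      rw [map_smul, hμ, Algebra.algebraMap_eq_smul_one, smul_smul]
      congr 1
      have : c * c * μ = 1 := by rw [← sq, hc, inv_mul_cancel₀ hμ0]
      exact eq_inv_of_mul_eq_one_left (by linear_combination this))
  have := hmax h1
  omega

end GoodSystem

/-! ### Simplicity and minimal graded left ideals. -/

/-- Every nonzero element generates the unit two-sided ideal. -/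
def IsFullyIdeal (A : Type*) [Ring A] : Prop :=
  ∀ x : A, x ≠ 0 → ∃ (m : ℕ) (y z : Fin m → A), ∑ i, y i * x * z i = 1

theorem isFullyIdeal_matrix (F : Type*) [Field F] (n : ℕ) :
    IsFullyIdeal (Matrix (Fin n) (Fin n) F) := by
  intro x hx
  obtain ⟨a, b, hab⟩ : ∃ a b, x a b ≠ 0 := by
    by_contra! h
    exact hx (Matrix.ext h)
  refine ⟨n, fun i => Matrix.single i a (x a b)⁻¹, fun i => Matrix.single b i 1, ?_⟩
  simp only [Matrix.single_mul_mul_single, inv_mul_cancel₀ hab, mul_one]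
  ext i j
  rw [Matrix.sum_apply, Matrix.one_apply]
  simp only [Matrix.single_apply]
  by_cases hij : i = j
  · simp [hij]
  · rw [if_neg hij]
    refine Finset.sum_eq_zero fun k _ => if_neg ?_
    rintro ⟨rfl, rfl⟩
    exact hij rfl

section MinimalIdempotent

variable {F A G : Type*} [Field F] [Ring A] [Algebra F A]
  [AddCommGroup G] {Γ : G → Submodule F A} (hA : IsFullyIdeal A) (hΓ : IsAbGrading Γ)

omit [AddCommGroup G] in
include hA in
theorem IsFullyIdeal.exists_mul_mul_ne_zero (htop : ⨆ g, Γ g = ⊤) {x y : A} (hx : x ≠ 0)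
    (hy : y ≠ 0) : ∃ g, ∃ t ∈ Γ g, x * t * y ≠ 0 := by
  obtain ⟨m, u, w, h⟩ := hA x hx
  obtain ⟨i, hi⟩ : ∃ i, x * w i * y ≠ 0 := by
    by_contra! hcon
    apply hy
    rw [← one_mul y, ← h, Finset.sum_mul]
    refine Finset.sum_eq_zero fun i _ => ?_
    rw [mul_assoc, mul_assoc, ← mul_assoc x, hcon, mul_zero]
  obtain ⟨g, t, ht, hne⟩ := exists_homogeneous_ne_zero htop
    (LinearMap.mulRight F y ∘ₗ LinearMap.mulLeft F x) (x := w i) (by simpa using hi)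
  exact ⟨g, t, ht, by simpa using hne⟩

/-- A nonzero idempotent of degree `0` which generates a minimal graded left ideal. -/
structure IsMinimalIdempotent (Γ : G → Submodule F A) (e : A) : Prop where
  mem : e ∈ Γ 0
  ne_zero : e ≠ 0
  mul_self : e * e = e
  exists_mul_eq : ∀ g, ∀ x ∈ Γ g, x ≠ 0 → x * e = x → ∃ y, y * x = e

-- Choose a nonzero homogeneous `x` with `Ax` of least dimension, so that each nonzero homogeneous
-- element of `Ax` generates `Ax`. Simplicity gives a homogeneous `t` with `x t x ≠ 0`; then `t x`
-- is a left multiple `r (x t x)` with `r` homogeneous, and the idempotent is `e = r x`, of degree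
-- `0`.
include hA hΓ in
theorem IsFullyIdeal.exists_isMinimalIdempotent [Nontrivial A] [FiniteDimensional F A] :
    ∃ e, IsMinimalIdempotent Γ e := by
  classical
  have hex : ∃ n, ∃ g, ∃ x ∈ Γ g, x ≠ 0 ∧
      Module.finrank F (LinearMap.range (LinearMap.mulRight F x)) = n :=
    ⟨_, 0, 1, hΓ.one_mem, one_ne_zero, rfl⟩
  obtain ⟨k, x, hx, hx0, hn⟩ := Nat.find_spec hex
  have hmin : ∀ (r : A), r * x ≠ 0 → (∃ g, r * x ∈ Γ g) → ∃ s, s * (r * x) = x := by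
    rintro r h0 ⟨g, hg⟩
    have hle : LinearMap.range (LinearMap.mulRight F (r * x)) ≤
        LinearMap.range (LinearMap.mulRight F x) := by
      rintro _ ⟨s, rfl⟩
      exact ⟨s * r, by simp [mul_assoc]⟩
    have heq := Submodule.eq_of_le_of_finrank_le hle (by
      rw [hn]
      exact Nat.find_min' hex ⟨g, _, hg, h0, rfl⟩)
    have hmem : x ∈ LinearMap.range (LinearMap.mulRight F (r * x)) := heq ▸ ⟨1, by simp⟩
    obtain ⟨s, hs⟩ := hmem
    exact ⟨s, hs⟩
  obtain ⟨j, t, ht, hxtx⟩ := hA.exists_mul_mul_ne_zero hΓ.iSup_eq_top hx0 hx0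
  have hy : t * x ∈ Γ (j + k) := hΓ.mul_mem ht hx
  have hxy : x * (t * x) ∈ Γ (k + (j + k)) := hΓ.mul_mem hx hy
  obtain ⟨s, hs⟩ := hmin (x * t) hxtx ⟨k + (j + k), by rw [mul_assoc]; exact hxy⟩
  have hs' : t * s * (x * (t * x)) = t * x := by
    conv_rhs => rw [← hs]
    simp only [mul_assoc]
  obtain ⟨r, hr, hrs⟩ := hΓ.exists_homogeneous_mul_eq (m := j + k) hxy (by rwa [hs'])
  rw [hs'] at hrs
  have hmem : r * x ∈ Γ 0 := hΓ.mul_mem_of_eq hr hx (by abel)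
  have hey : r * x * (t * x) = t * x := by rw [mul_assoc, hrs]
  have hy0 : t * x ≠ 0 := fun h => hxtx (by rw [mul_assoc, h, mul_zero])
  have hidem : r * x * (r * x) = r * x := by
    by_contra hne
    have hf : (r * x * r - r) * x = r * x * (r * x) - r * x := by rw [sub_mul, mul_assoc (r * x)]
    obtain ⟨q, hq⟩ := hmin (r * x * r - r) (by rw [hf]; exact sub_ne_zero.2 hne)
      ⟨0, by
        rw [hf]
        exact Submodule.sub_mem _ (hΓ.mul_mem_of_eq hmem hmem (add_zero 0)) hmem⟩
    apply hxtx
    rw [hf] at hq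
    rw [mul_assoc, ← hq, mul_assoc, sub_mul, mul_assoc (r * x), hq, hey, hey, sub_self, mul_zero]
  refine ⟨r * x, hmem, fun h => hy0 (by rw [← hey, h, zero_mul]), hidem, fun g y hy hy0 hye => ?_⟩
  rw [← mul_assoc] at hye
  obtain ⟨q, hq⟩ := hmin (y * r) (by rwa [hye]) ⟨g, by rwa [hye]⟩
  exact ⟨r * q, by rw [← hye, mul_assoc, hq]⟩

namespace IsMinimalIdempotent

variable {e : A} (he : IsMinimalIdempotent Γ e)
include he hΓ

theorem exists_inv {g : G} {x : A} (hx : x ∈ Γ g) (hx0 : x ≠ 0) (hex : e * x = x)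
    (hxe : x * e = x) :
    ∃ y ∈ Γ (-g), e * y = y ∧ y * e = y ∧ x * y = e ∧ y * x = e := by
  -- Minimality yields left inverses inside `eAe`; a left inverse has a left inverse itself, so it
  -- is two-sided.
  have key : ∀ {g : G} {x : A}, x ∈ Γ g → x ≠ 0 → e * x = x → x * e = x →
      ∃ y ∈ Γ (-g), e * y = y ∧ y * e = y ∧ y * x = e := by
    intro g x hx hx0 hex hxe
    obtain ⟨y, hy⟩ := he.exists_mul_eq g x hx hx0 hxe
    obtain ⟨t, ht, hty⟩ := hΓ.exists_homogeneous_mul_eq (r := y) (m := 0) hx (hy ▸ he.mem)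
    rw [hy] at hty
    refine ⟨e * t * e, hΓ.mul_mem_of_eq (hΓ.mul_mem he.mem ht) he.mem (by abel), ?_, ?_, ?_⟩
    · rw [← mul_assoc, ← mul_assoc, he.mul_self]
    · rw [mul_assoc, he.mul_self]
    · rw [mul_assoc, hex, mul_assoc, hty, he.mul_self]
  obtain ⟨y, hy, hey, hye, hyx⟩ := key hx hx0 hex hxe
  obtain ⟨z, -, hez, hze, hzy⟩ := key hy (fun h => he.ne_zero (by rw [← hyx, h, zero_mul])) hey hye
  refine ⟨y, hy, hey, hye, ?_, hyx⟩
  have : x = z := by rw [← hex, ← hzy, mul_assoc, hyx, hze]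
  rw [this, hzy]

end IsMinimalIdempotent

end MinimalIdempotent

/-! ### The corner `eAe` and the right `eAe`-module `Ae`. -/

section CornerAlgebra

variable (F : Type*) {A : Type*} [Field F] [Ring A] [Algebra F A] {e : A}

/-- The corner `e A e`. -/
def cornerSubmodule (e : A) : Submodule F A where
  carrier := {x | e * x = x ∧ x * e = x}
  zero_mem' := by simp
  add_mem' := fun hx hy => ⟨by rw [mul_add, hx.1, hy.1], by rw [add_mul, hx.2, hy.2]⟩
  smul_mem' := fun c x hx => ⟨by rw [mul_smul_comm, hx.1], by rw [smul_mul_assoc, hx.2]⟩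

/-- The left ideal `A e`. -/
def columnSubmodule (e : A) : Submodule F A where
  carrier := {x | x * e = x}
  zero_mem' := by simp
  add_mem' := fun hx hy => by
    rw [Set.mem_ofPred_eq] at hx hy ⊢
    rw [add_mul, hx, hy]
  smul_mem' := fun c x hx => by
    rw [Set.mem_ofPred_eq] at hx ⊢
    rw [smul_mul_assoc, hx]

/-- The corner `e A e` of an idempotent as an algebra. -/
def CornerAlg (_ : e * e = e) : Type _ := cornerSubmodule F e

/-- The left ideal `A e` as a right module over `e A e`. -/
def ColumnModule (_ : e * e = e) : Type _ := columnSubmodule F e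

variable (hee : e * e = e)

instance : AddCommGroup (CornerAlg F hee) := inferInstanceAs (AddCommGroup (cornerSubmodule F e))
instance : Module F (CornerAlg F hee) := inferInstanceAs (Module F (cornerSubmodule F e))
instance : AddCommGroup (ColumnModule F hee) := inferInstanceAs (AddCommGroup (columnSubmodule F e))
instance : Module F (ColumnModule F hee) := inferInstanceAs (Module F (columnSubmodule F e))

/-- The inclusion `e A e → A`. -/
def CornerAlg.val : CornerAlg F hee →ₗ[F] A := (cornerSubmodule F e).subtype

/-- The inclusion `A e → A`. -/
def ColumnModule.val : ColumnModule F hee →ₗ[F] A := (columnSubmodule F e).subtype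

/-- The element of `e A e` with a given value. -/
def CornerAlg.mk (x : A) (h : e * x = x) (h' : x * e = x) : CornerAlg F hee := ⟨x, h, h'⟩

/-- The element of `A e` with a given value. -/
def ColumnModule.mk (x : A) (h : x * e = x) : ColumnModule F hee := ⟨x, h⟩

variable {F hee}

@[simp] theorem CornerAlg.val_mk (x : A) (h : e * x = x) (h' : x * e = x) :
    CornerAlg.val F hee (CornerAlg.mk F hee x h h') = x := rfl

@[simp] theorem ColumnModule.val_mk (x : A) (h : x * e = x) :
    ColumnModule.val F hee (ColumnModule.mk F hee x h) = x := rfl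

theorem CornerAlg.val_injective : Function.Injective (CornerAlg.val F hee) :=
  Subtype.val_injective

theorem ColumnModule.val_injective : Function.Injective (ColumnModule.val F hee) :=
  Subtype.val_injective

theorem CornerAlg.left_mul (x : CornerAlg F hee) :
    e * CornerAlg.val F hee x = CornerAlg.val F hee x := x.2.1

theorem CornerAlg.mul_right (x : CornerAlg F hee) :
    CornerAlg.val F hee x * e = CornerAlg.val F hee x := x.2.2

theorem ColumnModule.mul_right (x : ColumnModule F hee) :
    ColumnModule.val F hee x * e = ColumnModule.val F hee x := x.2

instance : Mul (CornerAlg F hee) where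
  mul x y := CornerAlg.mk F hee (CornerAlg.val F hee x * CornerAlg.val F hee y)
    (by rw [← mul_assoc, CornerAlg.left_mul]) (by rw [mul_assoc, CornerAlg.mul_right])

instance : One (CornerAlg F hee) where
  one := CornerAlg.mk F hee e hee hee

@[simp] theorem CornerAlg.val_mul (x y : CornerAlg F hee) :
    CornerAlg.val F hee (x * y) = CornerAlg.val F hee x * CornerAlg.val F hee y := rfl

@[simp] theorem CornerAlg.val_one : CornerAlg.val F hee 1 = e := rfl

instance : Ring (CornerAlg F hee) :=
  { (inferInstance : AddCommGroup (CornerAlg F hee)) with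
    mul := (· * ·)
    one := 1
    mul_assoc := fun x y z => CornerAlg.val_injective (mul_assoc _ _ _)
    one_mul := fun x => CornerAlg.val_injective (CornerAlg.left_mul x)
    mul_one := fun x => CornerAlg.val_injective (CornerAlg.mul_right x)
    left_distrib := fun x y z => CornerAlg.val_injective (mul_add _ _ _)
    right_distrib := fun x y z => CornerAlg.val_injective (add_mul _ _ _)
    zero_mul := fun x => CornerAlg.val_injective (zero_mul _)
    mul_zero := fun x => CornerAlg.val_injective (mul_zero _) }

instance : Algebra F (CornerAlg F hee) :=
  Algebra.ofModule (fun _ _ _ => CornerAlg.val_injective (smul_mul_assoc _ _ _))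
    fun _ _ _ => CornerAlg.val_injective (mul_smul_comm _ _ _)

instance : SMul (CornerAlg F hee)ᵐᵒᵖ (ColumnModule F hee) where
  smul d x := ColumnModule.mk F hee (ColumnModule.val F hee x * CornerAlg.val F hee d.unop)
    (by rw [mul_assoc, CornerAlg.mul_right])

@[simp] theorem ColumnModule.val_smul (d : (CornerAlg F hee)ᵐᵒᵖ) (x : ColumnModule F hee) :
    ColumnModule.val F hee (d • x) = ColumnModule.val F hee x * CornerAlg.val F hee d.unop := rfl

instance : Module (CornerAlg F hee)ᵐᵒᵖ (ColumnModule F hee) where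
  one_smul x := ColumnModule.val_injective (ColumnModule.mul_right x)
  mul_smul _ _ _ := ColumnModule.val_injective (mul_assoc _ _ _).symm
  smul_zero _ := ColumnModule.val_injective (zero_mul _)
  smul_add _ _ _ := ColumnModule.val_injective (add_mul _ _ _)
  add_smul _ _ _ := ColumnModule.val_injective (mul_add _ _ _)
  zero_smul _ := ColumnModule.val_injective (mul_zero _)

instance : IsScalarTower F (CornerAlg F hee)ᵐᵒᵖ (ColumnModule F hee) where
  smul_assoc _ _ _ := ColumnModule.val_injective (mul_smul_comm _ _ _)

instance [FiniteDimensional F A] : FiniteDimensional F (CornerAlg F hee) :=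
  inferInstanceAs (FiniteDimensional F (cornerSubmodule F e))

instance [FiniteDimensional F A] : FiniteDimensional F (ColumnModule F hee) :=
  inferInstanceAs (FiniteDimensional F (columnSubmodule F e))

variable (F hee) in
/-- The projection `x ↦ e x e`. -/
def CornerAlg.proj : A →ₗ[F] CornerAlg F hee where
  toFun x := CornerAlg.mk F hee (e * x * e) (by rw [← mul_assoc, ← mul_assoc, hee])
    (by rw [mul_assoc, hee])
  map_add' x y := CornerAlg.val_injective (by simp [mul_add, add_mul])
  map_smul' c x := CornerAlg.val_injective (by simp)

@[simp] theorem CornerAlg.val_proj (x : A) :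
    CornerAlg.val F hee (CornerAlg.proj F hee x) = e * x * e := rfl

theorem CornerAlg.proj_val (x : CornerAlg F hee) :
    CornerAlg.proj F hee (CornerAlg.val F hee x) = x :=
  CornerAlg.val_injective (by rw [val_proj, left_mul, mul_right])

variable (F hee) in
/-- The projection `x ↦ x e`. -/
def ColumnModule.proj : A →ₗ[F] ColumnModule F hee where
  toFun x := ColumnModule.mk F hee (x * e) (by rw [mul_assoc, hee])
  map_add' x y := ColumnModule.val_injective (by simp [add_mul])
  map_smul' c x := ColumnModule.val_injective (by simp)

@[simp] theorem ColumnModule.val_proj (x : A) :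
    ColumnModule.val F hee (ColumnModule.proj F hee x) = x * e := rfl

theorem ColumnModule.proj_val (x : ColumnModule F hee) :
    ColumnModule.proj F hee (ColumnModule.val F hee x) = x :=
  ColumnModule.val_injective (by rw [val_proj, mul_right])

end CornerAlgebra

/-! ### Gradings on the corner, and `A` as endomorphisms of `Ae`. -/

section CornerGrading

variable {F A G : Type*} [Field F] [Ring A] [Algebra F A] [AddCommGroup G]
  {Γ : G → Submodule F A} {e : A} (hee : e * e = e)

/-- The grading of `e A e` inherited from `A`. -/
def cornerGrade (Γ : G → Submodule F A) (k : G) : Submodule F (CornerAlg F hee) :=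
  (Γ k).comap (CornerAlg.val F hee)

/-- The grading of `A e` inherited from `A`. -/
def columnGrade (Γ : G → Submodule F A) (k : G) : Submodule F (ColumnModule F hee) :=
  (Γ k).comap (ColumnModule.val F hee)

variable {hee} (hΓ : IsAbGrading Γ) (he : e ∈ Γ 0)

include he hΓ in
theorem cornerProj_mem {k : G} {x : A} (hx : x ∈ Γ k) :
    CornerAlg.proj F hee x ∈ cornerGrade hee Γ k :=
  hΓ.mul_mem_of_eq (hΓ.mul_mem he hx) he (by abel)

include he hΓ in
theorem columnProj_mem {k : G} {x : A} (hx : x ∈ Γ k) :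
    ColumnModule.proj F hee x ∈ columnGrade hee Γ k :=
  hΓ.mul_mem_of_eq hx he (by abel)

include he hΓ in
theorem iSup_cornerGrade : ⨆ k, cornerGrade hee Γ k = ⊤ := by
  refine top_unique fun x _ => ?_
  have h : (⊤ : Submodule F A) ≤ (⨆ k, cornerGrade hee Γ k).comap (CornerAlg.proj F hee) := by
    rw [← hΓ.iSup_eq_top]
    exact iSup_le fun k y hy => Submodule.mem_iSup_of_mem k (cornerProj_mem hΓ he hy)
  rw [← CornerAlg.proj_val x]
  exact h trivial

include he hΓ in
theorem iSup_columnGrade : ⨆ k, columnGrade hee Γ k = ⊤ := by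
  refine top_unique fun x _ => ?_
  have h : (⊤ : Submodule F A) ≤ (⨆ k, columnGrade hee Γ k).comap (ColumnModule.proj F hee) := by
    rw [← hΓ.iSup_eq_top]
    exact iSup_le fun k y hy => Submodule.mem_iSup_of_mem k (columnProj_mem hΓ he hy)
  rw [← ColumnModule.proj_val x]
  exact h trivial

include hΓ in
theorem iSupIndep_columnGrade : iSupIndep (columnGrade hee Γ) :=
  iSupIndep.of_jointly_injective (ι := Unit) (fun _ => ColumnModule.val F hee)
    (fun _ h => (map_eq_zero_iff _ ColumnModule.val_injective).1 (h ())) (fun _ => hΓ.indep)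
    fun _ _ _ hx => hx

include he hΓ in
theorem isAbGrading_cornerGrade : IsAbGrading (cornerGrade hee Γ) where
  gradedMonoid :=
    { one_mem := he
      mul_mem := fun _ _ _ _ hx hy => hΓ.mul_mem hx hy }
  indep := iSupIndep.of_jointly_injective (ι := Unit) (fun _ => CornerAlg.val F hee)
    (fun _ h => (map_eq_zero_iff _ CornerAlg.val_injective).1 (h ())) (fun _ => hΓ.indep)
    fun _ _ _ hx => hx
  iSup_eq_top := iSup_cornerGrade hΓ he

include hΓ in
theorem columnGrade_smul_mem {j k : G} {x : ColumnModule F hee} (hx : x ∈ columnGrade hee Γ j)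
    {d : CornerAlg F hee} (hd : d ∈ cornerGrade hee Γ k) :
    MulOpposite.op d • x ∈ columnGrade hee Γ (j + k) :=
  hΓ.mul_mem hx hd

theorem CornerAlg.exists_sum_eq_one (hA : IsFullyIdeal A) {d : CornerAlg F hee} (hd : d ≠ 0) :
    ∃ (m : ℕ) (y z : Fin m → CornerAlg F hee), ∑ i, y i * d * z i = 1 := by
  obtain ⟨m, y, z, h⟩ := hA (CornerAlg.val F hee d) (by
    rwa [Ne, map_eq_zero_iff _ CornerAlg.val_injective])
  refine ⟨m, fun i => CornerAlg.proj F hee (y i), fun i => CornerAlg.proj F hee (z i),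
    CornerAlg.val_injective ?_⟩
  have h' := congrArg (fun t => e * t * e) h
  simp only [mul_one, hee, Finset.mul_sum, Finset.sum_mul] at h'
  rw [map_sum, CornerAlg.val_one]
  refine Eq.trans ?_ h'
  refine Finset.sum_congr rfl fun i _ => ?_
  simp only [CornerAlg.val_mul, CornerAlg.val_proj]
  conv_rhs => rw [← CornerAlg.left_mul d, ← CornerAlg.mul_right d]
  simp only [mul_assoc]

/-- For `c` central and `l` in its spectrum, `l - c` is a central nonunit. A nonzero one would
generate the unit ideal, and by centrality would then be invertible. -/
theorem CornerAlg.isCentral [IsAlgClosed F] [FiniteDimensional F A] (hA : IsFullyIdeal A)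
    (he0 : e ≠ 0) : Algebra.IsCentral F (CornerAlg F hee) where
  out := by
    intro c hc
    have hnt : Nontrivial (CornerAlg F hee) :=
      ⟨1, 0, fun h => he0 (by simpa using congrArg (CornerAlg.val F hee) h)⟩
    obtain ⟨l, hl⟩ := spectrum.nonempty_of_isAlgClosed_of_finiteDimensional F c
    rw [spectrum.mem_iff] at hl
    have hcen : algebraMap F (CornerAlg F hee) l - c ∈ Subalgebra.center F (CornerAlg F hee) :=
      Subalgebra.sub_mem _ (Subalgebra.algebraMap_mem _ l) hc
    have h0 : algebraMap F (CornerAlg F hee) l - c = 0 := by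
      by_contra hd
      obtain ⟨m, y, z, h⟩ := CornerAlg.exists_sum_eq_one hA hd
      apply hl
      rw [Subalgebra.mem_center_iff] at hcen
      have h1 : (algebraMap F (CornerAlg F hee) l - c) * ∑ i, y i * z i = 1 := by
        rw [← h, Finset.mul_sum]
        refine Finset.sum_congr rfl fun i _ => ?_
        rw [← mul_assoc, hcen]
      exact isUnit_iff_exists.2 ⟨_, h1, by rw [hcen, h1]⟩
    rw [sub_eq_zero] at h0
    exact Algebra.mem_bot.2 ⟨l, h0⟩

theorem IsMinimalIdempotent.isCentralGradedDivision [IsAlgClosed F] [FiniteDimensional F A]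
    (hA : IsFullyIdeal A) (hΓ : IsAbGrading Γ) (he : IsMinimalIdempotent Γ e) :
    IsCentralGradedDivision (cornerGrade he.mul_self Γ) where
  isAbGrading := isAbGrading_cornerGrade hΓ he.mem
  nontrivial := ⟨1, 0, fun h => he.ne_zero (by
    simpa using congrArg (CornerAlg.val F he.mul_self) h)⟩
  finiteDimensional := inferInstance
  isCentral := CornerAlg.isCentral hA he.ne_zero
  isUnit := by
    intro k x hx hx0
    obtain ⟨y, -, hey, hye, hxy, hyx⟩ := he.exists_inv hΓ hx (by
      rwa [Ne, map_eq_zero_iff _ CornerAlg.val_injective]) (CornerAlg.left_mul x)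
      (CornerAlg.mul_right x)
    exact isUnit_iff_exists.2 ⟨CornerAlg.mk F _ y hey hye, CornerAlg.val_injective hxy,
      CornerAlg.val_injective hyx⟩

variable (F hee) in
/-- The left multiplication `A → End(A e)`. -/
def columnLeftMul : A →ₐ[F] Module.End (CornerAlg F hee)ᵐᵒᵖ (ColumnModule F hee) where
  toFun r :=
    { toFun := fun x => ColumnModule.mk F hee (r * ColumnModule.val F hee x)
        (by rw [mul_assoc, ColumnModule.mul_right])
      map_add' := fun x y => ColumnModule.val_injective (by simp [mul_add])
      map_smul' := fun d x => ColumnModule.val_injective (by simp [mul_assoc]) }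
  map_one' := LinearMap.ext fun x => ColumnModule.val_injective (one_mul _)
  map_mul' r s := LinearMap.ext fun x => ColumnModule.val_injective (mul_assoc _ _ _)
  map_zero' := LinearMap.ext fun x => ColumnModule.val_injective (zero_mul _)
  map_add' r s := LinearMap.ext fun x => ColumnModule.val_injective (add_mul _ _ _)
  commutes' c := LinearMap.ext fun x => ColumnModule.val_injective (by
    simp [Algebra.algebraMap_eq_smul_one])

@[simp] theorem val_columnLeftMul (r : A) (x : ColumnModule F hee) :
    ColumnModule.val F hee (columnLeftMul F hee r x) = r * ColumnModule.val F hee x := rfl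

/-- Everything follows from `1 = ∑ y_i e z_i`: an `r` killing `Ae` kills each `y_i e`, and an
endomorphism `f` is left multiplication by `∑ f(y_i e) z_i` because `x = ∑ (y_i e)(e z_i x e)`. -/
theorem columnLeftMul_bijective (hA : IsFullyIdeal A) (he0 : e ≠ 0) :
    Function.Bijective (columnLeftMul F hee) := by
  obtain ⟨m, y, z, h⟩ := hA e he0
  constructor
  · rw [injective_iff_map_eq_zero]
    intro r hr
    rw [← mul_one r, ← h, Finset.mul_sum]
    refine Finset.sum_eq_zero fun i _ => ?_
    have := congrArg (ColumnModule.val F hee)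
      (LinearMap.congr_fun hr (ColumnModule.proj F hee (y i)))
    simp only [val_columnLeftMul, ColumnModule.val_proj, LinearMap.zero_apply, map_zero] at this
    rw [← mul_assoc, this, zero_mul]
  · intro f
    refine ⟨∑ i, ColumnModule.val F hee (f (ColumnModule.proj F hee (y i))) * z i, ?_⟩
    refine LinearMap.ext fun x => ?_
    have hx : x = ∑ i, MulOpposite.op (CornerAlg.proj F hee (z i * ColumnModule.val F hee x)) •
        ColumnModule.proj F hee (y i) := by
      apply ColumnModule.val_injective
      conv_lhs => rw [← one_mul (ColumnModule.val F hee x), ← h, Finset.sum_mul]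
      rw [map_sum]
      refine Finset.sum_congr rfl fun i _ => ?_
      simp only [ColumnModule.val_smul, ColumnModule.val_proj, MulOpposite.unop_op,
        CornerAlg.val_proj]
      conv_lhs => rw [← ColumnModule.mul_right x]
      simp only [mul_assoc]
      rw [← mul_assoc e e, hee]
    conv_rhs => rw [hx, map_sum]
    apply ColumnModule.val_injective
    rw [val_columnLeftMul, Finset.sum_mul, map_sum]
    refine Finset.sum_congr rfl fun i _ => ?_
    rw [map_smul, ColumnModule.val_smul, MulOpposite.unop_op, CornerAlg.val_proj]
    rw [← ColumnModule.mul_right (f _)]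
    conv_lhs => rw [← ColumnModule.mul_right x]
    simp only [mul_assoc]
    rw [← mul_assoc e e, hee]

variable (F hee) in
/-- The isomorphism `A ≃ End(A e)` given by left multiplication. -/
noncomputable def columnEquiv (hA : IsFullyIdeal A) (he0 : e ≠ 0) :
    A ≃ₐ[F] Module.End (CornerAlg F hee)ᵐᵒᵖ (ColumnModule F hee) :=
  AlgEquiv.ofBijective (columnLeftMul F hee) (columnLeftMul_bijective hA he0)

@[simp] theorem val_columnEquiv (hA : IsFullyIdeal A) (he0 : e ≠ 0) (r : A)
    (x : ColumnModule F hee) :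
    ColumnModule.val F hee (columnEquiv F hee hA he0 r x) = r * ColumnModule.val F hee x := rfl

theorem iSupIndep_inducedGrading {D V K : Type*} [Ring D] [Algebra F D] [AddCommGroup V]
    [Module F V] [Module Dᵐᵒᵖ V] [IsScalarTower F Dᵐᵒᵖ V] [AddCommGroup K]
    {𝒱 : K → Submodule F V} (hind : iSupIndep 𝒱) (htop : ⨆ k, 𝒱 k = ⊤) :
    iSupIndep (inducedGrading (D := D) 𝒱) := by
  refine iSupIndep.of_jointly_injective (ι := Σ j, 𝒱 j) (N := fun _ => V)
    (𝒩 := fun x k => 𝒱 (k + x.1))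
    (fun x =>
      { toFun := fun f => f x.2.1
        map_add' := fun _ _ => rfl
        map_smul' := fun _ _ => rfl }) (fun f hf => ?_) (fun x => ?_)
    fun x k f hf => hf x.1 x.2.1 x.2.2
  · refine LinearMap.ext fun x => ?_
    exact LinearMap.eq_zero_of_iSup_eq_top htop (f.restrictScalars F)
      (fun j y hy => hf ⟨j, y, hy⟩) x
  · exact hind.comp (add_left_injective x.1)

/-- The images of the components are contained in the induced ones and span, and the induced
components are independent. -/
theorem columnEquiv_isGradedIso (hA : IsFullyIdeal A) (he0 : e ≠ 0) (hΓ : IsAbGrading Γ)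
    (he : e ∈ Γ 0) :
    IsGradedIso Γ (inducedGrading (D := CornerAlg F hee) (columnGrade hee Γ))
      (columnEquiv F hee hA he0) := by
  refine fun g _ => ⟨g, ?_⟩
  refine (iSupIndep_inducedGrading (iSupIndep_columnGrade hΓ)
    (iSup_columnGrade hΓ he)).eq_of_le
    (𝒜 := fun g => (Γ g).map (columnEquiv F hee hA he0).toLinearMap) (fun k => ?_) ?_ g
  · rintro _ ⟨r, hr, rfl⟩ j x hx
    exact hΓ.mul_mem hr hx
  · rw [← Submodule.map_iSup, hΓ.iSup_eq_top, Submodule.map_top, LinearMap.range_eq_top]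
    exact (columnEquiv F hee hA he0).surjective

end CornerGrading

/-! ### The sesquilinear form attached to `φ`. -/

/-- `w` and `w'` are mutually inverse homogeneous elements of `e A φ(e)` and `φ(e) A e`. -/
structure IsFormElement {F A G : Type*} [Field F] [Ring A] [Algebra F A] [AddCommGroup G]
    (φ : AntiAut F A) (Γ : G → Submodule F A) (e : A) (a : G) (w w' : A) : Prop where
  mem : w ∈ Γ a
  mem' : w' ∈ Γ (-a)
  left_mul : e * w = w
  mul_right' : w' * e = w'
  mul_eq : w * w' = e
  mul_eq' : w' * w = φ.app e

section FormElement

variable {F A G : Type*} [Field F] [Ring A] [Algebra F A] [AddCommGroup G]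
  {φ : AntiAut F A} {Γ : G → Submodule F A} {e : A}

/-- Simplicity gives a nonzero homogeneous `w = e t φ(e)` and a homogeneous `r` with `w r w ≠ 0`.
Then `w r e` is invertible in `eAe`, with inverse `v` say, and `w' = φ(e) r v` satisfies `w w' = e`.
-/
theorem IsMinimalIdempotent.exists_isFormElement (hA : IsFullyIdeal A) (hφ : IsPhiGrading φ Γ)
    (he : IsMinimalIdempotent Γ e) : ∃ a w w', IsFormElement φ Γ e a w w' := by
  have hΓ := hφ.isAbGrading
  have hff : φ.app e * φ.app e = φ.app e := by rw [← AntiAut.app_mul, he.mul_self]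
  have hf0 : φ.app e ≠ 0 := by
    rw [Ne, AntiAut.app_eq_zero]
    exact he.ne_zero
  have hf := hφ.app_mem he.mem
  obtain ⟨a, t, ht, hne⟩ := hA.exists_mul_mul_ne_zero hΓ.iSup_eq_top he.ne_zero hf0
  obtain ⟨w, hw⟩ : ∃ w, w = e * t * φ.app e := ⟨_, rfl⟩
  rw [← hw] at hne
  have hew : e * w = w := by rw [hw, ← mul_assoc, ← mul_assoc, he.mul_self]
  have hwf : w * φ.app e = w := by rw [hw, mul_assoc, hff]
  have hwa : w ∈ Γ a := hw ▸ hΓ.mul_mem_of_eq (hΓ.mul_mem he.mem ht) hf (by abel)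
  obtain ⟨b, r, hr, hwrw⟩ := hA.exists_mul_mul_ne_zero hΓ.iSup_eq_top hne hne
  obtain ⟨v, hv, hev, hve, huv, hvu⟩ := he.exists_inv hΓ (x := w * r * e)
    (hΓ.mul_mem (hΓ.mul_mem hwa hr) he.mem)
    (fun h => hwrw (by rw [← hew, ← mul_assoc, hew, h, zero_mul]))
    (by rw [← mul_assoc, ← mul_assoc, hew]) (by rw [mul_assoc, he.mul_self])
  obtain ⟨w', hw'⟩ : ∃ w', w' = φ.app e * r * v := ⟨_, rfl⟩
  have hww' : w * w' = e := by
    rw [hw', ← mul_assoc, ← mul_assoc, hwf, ← huv, mul_assoc (w * r), hev]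
  have hfw' : φ.app e * w' = w' := by rw [hw', ← mul_assoc, ← mul_assoc, hff]
  have hw'e : w' * e = w' := by rw [hw', mul_assoc, hve]
  have hw'a : w' ∈ Γ (-a) := hw' ▸ hΓ.mul_mem_of_eq (hΓ.mul_mem hf hr) hv (by abel)
  refine ⟨a, w, w', hwa, hw'a, hew, hw'e, hww', ?_⟩
  -- The idempotent `w' w` of `φ(e) A φ(e)` is `φ(g)` for a nonzero idempotent `g` of degree `0` in
  -- `eAe`. Such a `g` is invertible there, so `g = e`.
  have hq : w' * w ∈ φ.app '' (Γ 0 : Set A) := by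
    rw [hφ.image_eq]
    exact hΓ.mul_mem_of_eq hw'a hwa (neg_add_cancel a)
  obtain ⟨g, hg, hgq⟩ := hq
  have hqq : w' * w * (w' * w) = w' * w := by
    rw [mul_assoc, ← mul_assoc w w', hww', hew]
  have hgg : g * g = g := φ.app_injective (by rw [AntiAut.app_mul, hgq, hqq])
  have heg : e * g = g := φ.app_injective (by rw [AntiAut.app_mul, hgq, mul_assoc, hwf])
  have hge : g * e = g := φ.app_injective (by rw [AntiAut.app_mul, hgq, ← mul_assoc, hfw'])
  have hg0 : g ≠ 0 := by
    rintro rfl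
    rw [AntiAut.app_zero] at hgq
    apply he.ne_zero
    rw [← he.mul_self, ← hww', mul_assoc, ← mul_assoc w', ← hgq, zero_mul, mul_zero]
  obtain ⟨y, -, -, -, hgy, -⟩ := he.exists_inv hΓ hg hg0 heg hge
  rw [← hgq, ← hge, ← hgy, ← mul_assoc, hgg]

namespace IsFormElement

variable {a : G} {w w' : A} (hw : IsFormElement φ Γ e a w w') (hee : e * e = e)
include hw

theorem app_eq_zero_iff (x : ColumnModule F hee) (y : A) :
    w * φ.app (ColumnModule.val F hee x) * y = 0 ↔ φ.app (ColumnModule.val F hee x) * y = 0 := by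
  constructor <;> intro h
  · rw [← ColumnModule.mul_right x, AntiAut.app_mul, ← hw.mul_eq', mul_assoc, mul_assoc,
      ← mul_assoc w, h, mul_zero]
  · rw [mul_assoc, h, mul_zero]

theorem conj_conj (d : CornerAlg F hee) :
    w' * (w * φ.app (CornerAlg.val F hee d) * w') * w = φ.app (CornerAlg.val F hee d) := by
  have h : w' * (w * φ.app (CornerAlg.val F hee d) * w') * w =
      w' * w * φ.app (CornerAlg.val F hee d) * (w' * w) := by
    simp only [mul_assoc]
  rw [h, hw.mul_eq', ← AntiAut.app_mul, CornerAlg.mul_right, ← AntiAut.app_mul,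
    CornerAlg.left_mul]

/-- The antiautomorphism `d ↦ w φ(d) w'` of `e A e`. -/
noncomputable def cornerAntiAut : AntiAut F (CornerAlg F hee) :=
  AlgEquiv.ofBijective
    { toFun := fun d => MulOpposite.op (CornerAlg.mk F hee (w * φ.app (CornerAlg.val F hee d) * w')
        (by rw [← mul_assoc, ← mul_assoc, hw.left_mul]) (by rw [mul_assoc, hw.mul_right']))
      map_one' := MulOpposite.unop_injective <| CornerAlg.val_injective <| by
        simp [← hw.mul_eq', ← mul_assoc, hw.mul_eq, hw.left_mul]
      map_mul' := fun x y => MulOpposite.unop_injective <| CornerAlg.val_injective <| by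
        simp only [CornerAlg.val_mul, AntiAut.app_mul, MulOpposite.unop_op, CornerAlg.val_mk,
          MulOpposite.unop_mul]
        conv_lhs => rw [← CornerAlg.left_mul y, AntiAut.app_mul, ← hw.mul_eq']
        simp only [mul_assoc]
      map_zero' := MulOpposite.unop_injective <| CornerAlg.val_injective <| by simp
      map_add' := fun x y => MulOpposite.unop_injective <| CornerAlg.val_injective <| by
        simp [mul_add, add_mul]
      commutes' := fun c => MulOpposite.unop_injective <| CornerAlg.val_injective <| by
        simp [Algebra.algebraMap_eq_smul_one, ← hw.mul_eq', ← mul_assoc, hw.mul_eq,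
          hw.left_mul] } <| by
    constructor
    · rw [injective_iff_map_eq_zero]
      intro d hd
      have h := congrArg (fun t : (CornerAlg F hee)ᵐᵒᵖ => CornerAlg.val F hee t.unop) hd
      simp only [AlgHom.coe_mk, RingHom.coe_mk, MonoidHom.coe_mk, OneHom.coe_mk,
        MulOpposite.unop_op, CornerAlg.val_mk, MulOpposite.unop_zero, map_zero] at h
      apply CornerAlg.val_injective
      rw [map_zero, ← φ.app_eq_zero, ← hw.conj_conj hee d, h, mul_zero, zero_mul]
    · intro d
      obtain ⟨y, hy⟩ := φ.app_surjective (w' * CornerAlg.val F hee d.unop * w)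
      refine ⟨CornerAlg.proj F hee y, MulOpposite.unop_injective <| CornerAlg.val_injective ?_⟩
      simp only [AlgHom.coe_mk, RingHom.coe_mk, MonoidHom.coe_mk, OneHom.coe_mk,
        MulOpposite.unop_op, CornerAlg.val_mk, CornerAlg.val_proj, AntiAut.app_mul]
      have h (z : A) : w * (w' * z) = e * z := by rw [← mul_assoc, hw.mul_eq]
      rw [hy, ← hw.mul_eq']
      simp only [mul_assoc, h, hw.mul_eq, hee]
      rw [CornerAlg.mul_right, CornerAlg.left_mul, CornerAlg.left_mul]

@[simp] theorem val_cornerAntiAut (d : CornerAlg F hee) :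
    CornerAlg.val F hee ((hw.cornerAntiAut hee).app d) = w * φ.app (CornerAlg.val F hee d) * w' :=
  rfl

theorem cornerAntiAut_mem (hφ : IsPhiGrading φ Γ) {k : G} {d : CornerAlg F hee}
    (hd : d ∈ cornerGrade hee Γ k) : (hw.cornerAntiAut hee).app d ∈ cornerGrade hee Γ k :=
  hφ.isAbGrading.mul_mem_of_eq (hφ.isAbGrading.mul_mem hw.mem (hφ.app_mem hd)) hw.mem' (by abel)

/-- The form `B(x, y) = w φ(x) y` on `A e`. -/
def columnForm : ColumnModule F hee →ₗ[F] ColumnModule F hee →ₗ[F] CornerAlg F hee :=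
  LinearMap.mk₂ F
    (fun x y => CornerAlg.mk F hee (w * φ.app (ColumnModule.val F hee x) * ColumnModule.val F hee y)
      (by rw [← mul_assoc, ← mul_assoc, hw.left_mul]) (by rw [mul_assoc, ColumnModule.mul_right]))
    (fun _ _ _ => CornerAlg.val_injective (by simp [mul_add, add_mul]))
    (fun _ _ _ => CornerAlg.val_injective (by simp))
    (fun _ _ _ => CornerAlg.val_injective (by simp [mul_add]))
    (fun _ _ _ => CornerAlg.val_injective (by simp))

@[simp] theorem val_columnForm (x y : ColumnModule F hee) :
    CornerAlg.val F hee (hw.columnForm hee x y) =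
      w * φ.app (ColumnModule.val F hee x) * ColumnModule.val F hee y := rfl

theorem columnForm_eq_zero_iff (x y : ColumnModule F hee) :
    hw.columnForm hee x y = 0 ↔
      φ.app (ColumnModule.val F hee x) * ColumnModule.val F hee y = 0 := by
  rw [← map_eq_zero_iff _ CornerAlg.val_injective, val_columnForm, hw.app_eq_zero_iff]

theorem columnForm_mem (hφ : IsPhiGrading φ Γ) {j k : G} {x y : ColumnModule F hee}
    (hx : x ∈ columnGrade hee Γ j) (hy : y ∈ columnGrade hee Γ k) :
    hw.columnForm hee x y ∈ cornerGrade hee Γ (j + k + a) :=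
  hφ.isAbGrading.mul_mem_of_eq (hφ.isAbGrading.mul_mem hw.mem (hφ.app_mem hx)) hy (by abel)

theorem columnForm_smul_left (x y : ColumnModule F hee) (d : CornerAlg F hee) :
    hw.columnForm hee (MulOpposite.op d • x) y =
      (hw.cornerAntiAut hee).app d * hw.columnForm hee x y := by
  apply CornerAlg.val_injective
  simp only [val_columnForm, ColumnModule.val_smul, CornerAlg.val_mul, val_cornerAntiAut,
    MulOpposite.unop_op, AntiAut.app_mul]
  conv_lhs => rw [← ColumnModule.mul_right x, AntiAut.app_mul, ← hw.mul_eq']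
  simp only [mul_assoc]

theorem columnForm_smul_right (x y : ColumnModule F hee) (d : CornerAlg F hee) :
    hw.columnForm hee x (MulOpposite.op d • y) = hw.columnForm hee x y * d :=
  CornerAlg.val_injective (mul_assoc _ _ _).symm

/-- Multiplying `φ(x)` by `1 = ∑ y_i e z_i` exhibits it as a combination of the vanishing products
`φ(x) y_i e`. -/
theorem columnForm_left_nondegenerate (hA : IsFullyIdeal A) (he0 : e ≠ 0) (x : ColumnModule F hee)
    (hx : ∀ y, hw.columnForm hee x y = 0) : x = 0 := by
  obtain ⟨m, y, z, h⟩ := hA e he0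
  rw [← map_eq_zero_iff _ ColumnModule.val_injective, ← φ.app_eq_zero,
    ← mul_one (φ.app _), ← h, Finset.mul_sum]
  refine Finset.sum_eq_zero fun i _ => ?_
  have := (hw.columnForm_eq_zero_iff hee _ _).1 (hx (ColumnModule.proj F hee (y i)))
  rw [ColumnModule.val_proj] at this
  rw [← mul_assoc, this, zero_mul]

theorem columnForm_right_nondegenerate (hA : IsFullyIdeal A) (he0 : e ≠ 0) (y : ColumnModule F hee)
    (hy : ∀ x, hw.columnForm hee x y = 0) : y = 0 := by
  obtain ⟨m, u, z, h⟩ := hA (φ.app e) (by rwa [Ne, AntiAut.app_eq_zero])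
  rw [← map_eq_zero_iff _ ColumnModule.val_injective, ← one_mul (ColumnModule.val F hee y), ← h,
    Finset.sum_mul]
  refine Finset.sum_eq_zero fun i _ => ?_
  obtain ⟨t, ht⟩ := φ.app_surjective (z i)
  have := (hw.columnForm_eq_zero_iff hee _ _).1 (hy (ColumnModule.proj F hee t))
  rw [ColumnModule.val_proj, AntiAut.app_mul, ht] at this
  rw [mul_assoc (u i), mul_assoc, this, mul_zero]

theorem columnForm_adjoint (hA : IsFullyIdeal A) (he0 : e ≠ 0) (r : A)
    (x y : ColumnModule F hee) :
    hw.columnForm hee (columnEquiv F hee hA he0 r x) y =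
      hw.columnForm hee x (columnEquiv F hee hA he0 (φ.app r) y) :=
  CornerAlg.val_injective (by simp [mul_assoc])

/-- Applying `φ` to `φ(x) y = 0` gives `φ(y) φ²(x) = 0`, and `φ²(x)` is a nonzero multiple of `x`.
-/
theorem columnForm_balanced (hφ : IsPhiGrading φ Γ) {j : G} {x y : ColumnModule F hee}
    (hx : x ∈ columnGrade hee Γ j) (h : hw.columnForm hee x y = 0) :
    hw.columnForm hee y x = 0 := by
  rw [columnForm_eq_zero_iff] at h ⊢
  obtain ⟨c, hc0, hc⟩ := hφ.sq_scalar j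
  have h' := congrArg φ.app h
  rwa [AntiAut.app_mul, hc _ hx, AntiAut.app_zero, mul_smul_comm,
    smul_eq_zero_iff_right hc0] at h'

end IsFormElement

end FormElement

/-! ### Existence of realizations and the final theorem. -/

theorem IsPhiGrading.exists_realization {F A : Type u} {G : Type v} [Field F] [IsAlgClosed F]
    [Ring A] [Algebra F A] [Nontrivial A] [FiniteDimensional F A] [AddCommGroup G]
    {φ : AntiAut F A} {Γ : G → Submodule F A} (hA : IsFullyIdeal A) (hφ : IsPhiGrading φ Γ) :
    ∃ P : DivPair.{u, v} F, Nonempty (Realization φ Γ P) := by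
  have hΓ := hφ.isAbGrading
  obtain ⟨e, he⟩ := hA.exists_isMinimalIdempotent hΓ
  obtain ⟨a, w, w', hw⟩ := he.exists_isFormElement hA hφ
  have hee := he.mul_self
  have hD : IsCentralGradedDivision (cornerGrade hee Γ) := he.isCentralGradedDivision hA hΓ
  have hτ : ∀ k, ∀ x ∈ cornerGrade hee Γ k, (hw.cornerAntiAut hee).app x ∈ cornerGrade hee Γ k :=
    fun k x hx => hw.cornerAntiAut_mem hee hφ hx
  have hbal : ∀ j k, ∀ x ∈ columnGrade hee Γ j, ∀ y ∈ columnGrade hee Γ k,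
      hw.columnForm hee x y = 0 ↔ hw.columnForm hee y x = 0 := fun j k x hx y hy =>
    ⟨hw.columnForm_balanced hee hφ hx, hw.columnForm_balanced hee hφ hy⟩
  have h2 := hD.two_elementary_of_antiAut hτ
  have hB : ∀ j k, ∀ x ∈ columnGrade hee Γ j, ∀ y ∈ columnGrade hee Γ k,
      hw.columnForm hee x y ∈ cornerGrade hee Γ (j + k + a) :=
    fun j k x hx y hy => hw.columnForm_mem hee hφ hx hy
  have hsmul : ∀ j k, ∀ x ∈ columnGrade hee Γ j, ∀ d ∈ cornerGrade hee Γ k,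
      MulOpposite.op d • x ∈ columnGrade hee Γ (j + k) :=
    fun j k x hx d hd => columnGrade_smul_mem hΓ hx hd
  obtain ⟨p, s, d, ν, b, hb, hspan⟩ := exists_isGoodSystem_span_eq_top hD h2
    (iSup_columnGrade hΓ he.mem) hsmul hB (hw.columnForm_smul_right hee)
    (hw.columnForm_left_nondegenerate hee hA he.ne_zero) hbal
  have hli := hb.linearIndependent (hw.columnForm_smul_right hee)
  have := hD.nontrivial
  have hbasis (i) : Module.Basis.mk hli hspan.ge i = b i := Module.Basis.mk_apply hli hspan.ge i
  let P : DivPair.{u, v} F :=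
    { D := CornerAlg F hee
      K := G
      grade := cornerGrade hee Γ
      isDivision := hD
      two_elementary := h2
      p := p
      d := d
      d_ne_zero := fun i hi => one_ne_zero (by rw [← hb.d_sq i, hi, zero_mul])
      d_homogeneous := fun i => by
        obtain ⟨k, hk⟩ := hb.homogeneous (Sum.inl i)
        refine ⟨k + k + a, ?_⟩
        have := hB k k _ hk _ hk
        rwa [hb.gram, goodGram, if_pos rfl] at this }
  exact ⟨P, ⟨
    { τ := hw.cornerAntiAut hee
      τ_involutive := hD.antiAut_involutive hτ
      τ_graded := hτ
      V := ColumnModule F hee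
      gradeV := columnGrade hee Γ
      gradeV_indep := iSupIndep_columnGrade hΓ
      gradeV_iSup_eq_top := iSup_columnGrade hΓ he.mem
      gradeV_smul_mem := hsmul
      B := hw.columnForm hee
      degB := a
      B_homogeneous := hB
      B_smul_left := hw.columnForm_smul_left hee
      B_smul_right := hw.columnForm_smul_right hee
      B_left_nondegenerate := hw.columnForm_left_nondegenerate hee hA he.ne_zero
      B_right_nondegenerate := hw.columnForm_right_nondegenerate hee hA he.ne_zero
      B_balanced := hbal
      iso := columnEquiv F hee hA he.ne_zero
      iso_graded := columnEquiv_isGradedIso hA he.ne_zero hΓ he.mem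
      iso_adjoint := hw.columnForm_adjoint hee hA he.ne_zero
      s := s
      basis := Module.Basis.mk hli hspan.ge
      basis_homogeneous := fun i => (hbasis i).symm ▸ hb.homogeneous i
      d_sq := hb.d_sq
      ν := ν
      ν_ne_zero := hb.ν_ne_zero
      gram := fun i j => by rw [hbasis, hbasis]; exact hb.gram i j }⟩⟩

theorem IsFinePhiGrading.isInvariantClass_calI {F A : Type u} {G : Type v} [Field F] [IsAlgClosed F]
    [Ring A] [Algebra F A] [Nontrivial A] [FiniteDimensional F A] [AddCommGroup G]
    {φ : AntiAut F A} {Γ : G → Submodule F A} (hA : IsFullyIdeal A) (h : IsFinePhiGrading φ Γ) :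
    IsInvariantClass φ Γ (calI φ Γ : DivPairClass.{u, v} F) := by
  obtain ⟨P, hP⟩ := h.isPhiGrading.exists_realization hA
  exact Classical.epsilon_spec (p := IsInvariantClass φ Γ) ⟨_, P, hP, rfl⟩

theorem IsInvariantClass.eq_of_gradedIso {F A : Type u} {G G' : Type v} [Field F] [IsAlgClosed F]
    [CharZero F] [Ring A] [Algebra F A] [Nontrivial A] [FiniteDimensional F A] [AddCommGroup G]
    [AddCommGroup G'] {φ φ' : AntiAut F A} {Γ : G → Submodule F A} {Γ' : G' → Submodule F A}
    {c c' : DivPairClass.{u, v} F} (hc : IsInvariantClass φ Γ c) (hc' : IsInvariantClass φ' Γ' c')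
    (h : IsFinePhiGrading φ Γ) (h' : IsFinePhiGrading φ' Γ') {Φ : A ≃ₐ[F] A}
    (hΦ : IsGradedIso Γ Γ' Φ) {Ψ : A ≃ₐ[F] A} (hΨ : Ψ ∈ diagGroup Γ')
    (hcomm : ∀ x, Φ (φ.app (Φ.symm x)) = Ψ (φ'.app x)) : c = c' := by
  obtain ⟨P, ⟨Z⟩, rfl⟩ := hc
  obtain ⟨Q, ⟨Z'⟩, rfl⟩ := hc'
  exact Quotient.sound (Z.equivalent_of_gradedIso Z' h h' hΦ hΨ hcomm)

theorem isGradedIso_refl {F A G : Type*} [Field F] [Ring A] [Algebra F A]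
    (Γ : G → Submodule F A) : IsGradedIso Γ Γ AlgEquiv.refl :=
  fun g _ => ⟨g, Submodule.map_id _⟩

theorem mainTheorem5 {F : Type u} [Field F] [IsAlgClosed F] [CharZero F] (n : ℕ) [NeZero n] :
    -- the invariant is well defined
    (∀ (G : Type v) [AddCommGroup G] (φ : AntiAut F (Matrix (Fin n) (Fin n) F))
        (Γ : G → Submodule F (Matrix (Fin n) (Fin n) F)), IsFinePhiGrading φ Γ →
        ∀ c : DivPairClass.{u, v} F, IsInvariantClass φ Γ c ↔ c = calI φ Γ) ∧
    -- part (1)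
    (∀ (G : Type v) [AddCommGroup G] (φ : AntiAut F (Matrix (Fin n) (Fin n) F))
        (Γ : G → Submodule F (Matrix (Fin n) (Fin n) F)), IsFinePhiGrading φ Γ →
        ∀ Ψ ∈ diagGroup Γ,
          IsFinePhiGrading (AntiAut.leftComp Ψ φ) Γ ∧
          calI φ Γ = calI (AntiAut.leftComp Ψ φ) Γ) ∧
    -- part (2)
    (∀ (G₁ G₂ : Type v) [AddCommGroup G₁] [AddCommGroup G₂]
        (φ₁ φ₂ : AntiAut F (Matrix (Fin n) (Fin n) F))
        (Γ₁ : G₁ → Submodule F (Matrix (Fin n) (Fin n) F))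
        (Γ₂ : G₂ → Submodule F (Matrix (Fin n) (Fin n) F)),
        IsFinePhiGrading φ₁ Γ₁ → IsFinePhiGrading φ₂ Γ₂ →
        (calI φ₁ Γ₁ = calI φ₂ Γ₂ ↔
          ∃ Φ : Matrix (Fin n) (Fin n) F ≃ₐ[F] Matrix (Fin n) (Fin n) F, IsGradedIso Γ₁ Γ₂ Φ ∧
            ∃ Ψ ∈ diagGroup Γ₂, ∀ x, Φ (φ₁.app (Φ.symm x)) = Ψ (φ₂.app x))) := by
  have hA := isFullyIdeal_matrix F n
  refine ⟨fun G _ φ Γ h c => ?_, fun G _ φ Γ h Ψ hΨ => ?_, fun G₁ G₂ _ _ φ₁ φ₂ Γ₁ Γ₂ h₁ h₂ => ?_⟩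
  · refine ⟨fun hc => ?_, fun hc => hc ▸ h.isInvariantClass_calI hA⟩
    exact hc.eq_of_gradedIso (h.isInvariantClass_calI hA) h h (isGradedIso_refl Γ)
      (Subgroup.one_mem _) fun x => rfl
  · have h' := h.leftComp hΨ
    refine ⟨h', (h.isInvariantClass_calI hA).eq_of_gradedIso (h'.isInvariantClass_calI hA) h h'
      -- The identity is the graded isomorphism, and `φ = Ψ⁻¹(Ψφ)` supplies the diagonal
      -- automorphism.
      (isGradedIso_refl Γ) (Subgroup.inv_mem _ hΨ) fun x => ?_⟩
    exact (Ψ.symm_apply_apply _).symm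
  · have hc₁ := h₁.isInvariantClass_calI hA
    have hc₂ := h₂.isInvariantClass_calI hA
    refine ⟨fun heq => ?_, fun ⟨Φ, hΦ, Ψ, hΨ, h⟩ => hc₁.eq_of_gradedIso hc₂ h₁ h₂ hΦ hΨ h⟩
    obtain ⟨P, ⟨Z⟩, hP⟩ := hc₁
    obtain ⟨Q, ⟨Z'⟩, hQ⟩ := hc₂
    exact Z.gradedIso_of_equivalent Z' h₁ h₂ (Quotient.exact (hP.symm.trans (heq.trans hQ)))
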